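/- Let $m\ge 1$, let $(\Omega,\mathcal F,\mathbb P)$ be a probability space, and let $\varpi_0,\dots,\varpi_{m-1}$ be $n\times n$ matrices whose entries are finite signed Borel measures concentrated on $[0,\infty)$ with finite second moment. For a matrix $\mu$ of finite signed measures put $\mathcal L[\mu](z)=\int e^{zu}\,\mu(du)$ for $z\in D(\mu)=\{z\in\mathbb C:\int e^{\mathrm{Re}(z)u}|\mu_{ab}|(du)<\infty\ \text{for all } a,b\}$, and $\mathcal F[\mu](y)=\mathcal L[\mu](iy)$; for an integrable matrix function $g$ put $\mathcal F[g](y)=\int e^{iyu}g(u)\,du$. Let $(Z_t)_{t\in\mathbb R}$ be an $n$-dimensional measurable, integrable process with stationary increments which is a regular integrator: for each $k$ there is a linear map $I_k=\int\cdot\,dZ^k: L^1(\mathbb R)\cap L^2(\mathbb R)\to L^1(\mathbb P)$ with $I_k(\mathbf 1_{(s,t]})=Z^k_t-Z^k_s$ for $s<t$, and with $I_k\big(\int f_r(t-\cdot)\,\mu(dr)\big)=\int I_k(f_r(t-\cdot))\,\mu(dr)$ almost surely for each $t\in\mathbb R$ and each finite Borel measure $\mu$ on $\mathbb R$ with first moment,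 where $f_r=\mathbf 1_{[0,\infty)}(\cdot-r)-\mathbf 1_{[0,\infty)}$. The maps $I_k$ are fixed. A solution of the $m$-th order equation $$dX^{(m-1)}_t=\sum_{j=0}^{m-1}\varpi_j*X^{(j)}(t)\,dt+dZ_t$$ is a measurable, integrable and stationary $n$-dimensional process $X$ which is $m-1$ times differentiable and such that, for each $s<t$, almost surely, $$X^{(m-1)}_t-X^{(m-1)}_s=\sum_{j=0}^{m-1}\int_s^t\int_{[0,\infty)}\varpi_j(dv)\,X^{(j)}_{u-v}\,du+Z_t-Z_s ,$$ the double integrals being absolutely convergent. Here differentiability is understood as follows: for $j<m-1$, $X^{(j+1)}$ is a measurable process, almost every path of $X^{(j)}$ is locally absolutely continuous with density $X^{(j+1)}$, and for each fixed $t$, almost surely, $X^{(j)}$ is differentiable at $t$ with derivative $X^{(j+1)}_t$. Let $\eta$ be the $mn\times mn$ matrix measure of the associated first-order system: in $n\times n$ blocks, block row $j<m$ of $\eta$ has $I_n\delta_0$ in block column $j+1$ and zeros elsewhere, and the last block row is $(\varpi_0,\dots,\varpi_{m-1})$. Put $h(z)=-zI_{mn}-\mathcal L[\eta](z)$ for $z\in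 D(\eta)$. Then: 1. For all $z\in D(\eta)$, $\displaystyle\det h(z)=\det\Big(I_n(-z)^m-\sum_{j=0}^{m-1}\mathcal L[\varpi_j](z)(-z)^j\Big)$. 2. Suppose $\det h(iy)\ne0$ for all $y\in\mathbb R$. Then there is a function $g:\mathbb R\to\mathbb R^{mn\times mn}$ with entries in $L^1\cap L^2$ and $\mathcal F[g](y)=h(iy)^{-1}$ for all $y\in\mathbb R$. Its $n\times n$ block $g_{1m}$ in position $(1,m)$ satisfies $$\mathcal F[g_{1m}](y)=\Big(I_n(-iy)^m-\sum_{j=0}^{m-1}\mathcal F[\varpi_j](y)(-iy)^j\Big)^{-1},\qquad y\in\mathbb R,$$ and is, up to Lebesgue-almost everywhere equality, the only function $\mathbb R\to\mathbb R^{n\times n}$ with entries in $L^1$ that does so. The $m$-th order equation has a solution $X$, which is unique up to modification, and for each $t\in\mathbb R$, almost surely, $$X_t=\int_{\mathbb R}g_{1m}(t-u)\,dZ_u,\qquad\text{i.e. } X^a_t=\sum_{b=1}^n I_b\big((g_{1m})_{ab}(t-\cdot)\big),\quad a=1,\dots,n .$$ 3. If moreover $\det h(z)\ne0$ for all $z\in\mathbb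 C$ with $\mathrm{Re}(z)\le0$, then this solution is causal: for each $t$, $X_t$ is, up to a $\mathbb P$-null set, measurable with respect to $\sigma(Z_t-Z_s:s<t)$. -/

import Mathlib

open MeasureTheory

namespace MSDDE

noncomputable section

/-! ### Finite signed matrix measures on the line and their transforms -/

/-- `∫ f dμ = ∫ f dμ⁺ - ∫ f dμ⁻` for a finite signed measure with Jordan decomposition
`μ = μ⁺ - μ⁻`; meaningful when `f` is integrable for the variation measure `|μ| = μ⁺ + μ⁻`. -/
def sIntegral {E : Type*} [NormedAddCommGroup E] [NormedSpace ℝ E]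
    (μ : SignedMeasure ℝ) (f : ℝ → E) : E :=
  (∫ u, f u ∂μ.toJordanDecomposition.posPart) - ∫ u, f u ∂μ.toJordanDecomposition.negPart

/-- A matrix whose entries are finite signed Borel measures on `ℝ`. -/
abbrev MatrixMeasure (ι : Type*) := Matrix ι ι (SignedMeasure ℝ)

/-- All entries are concentrated on `[0, ∞)`. -/
def ConcentratedOnNonneg {ι : Type*} (η : MatrixMeasure ι) : Prop :=
  ∀ a b, (η a b).totalVariation (Set.Iio 0) = 0

/-- All entries have a moment of order `p`: `∫ |u|^p |η_ab|(du) < ∞`. -/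
def HasMoment {ι : Type*} (η : MatrixMeasure ι) (p : ℕ) : Prop :=
  ∀ a b, Integrable (fun u : ℝ => |u| ^ p) (η a b).totalVariation

/-- The domain `D(η)` of the Laplace transform: `∫ e^{Re(z) u} |η_ab|(du) < ∞` for all entries. -/
def laplaceDomain {ι : Type*} (η : MatrixMeasure ι) : Set ℂ :=
  {z | ∀ a b, Integrable (fun u : ℝ => Real.exp (z.re * u)) (η a b).totalVariation}

/-- The Laplace transform `L[η](z) = ∫ e^{zu} η(du)`, entrywise. -/
def laplace {ι : Type*} (η : MatrixMeasure ι) (z : ℂ) : Matrix ι ι ℂ :=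
  Matrix.of fun a b => sIntegral (η a b) fun u : ℝ => Complex.exp (z * u)

/-- The Fourier transform `F[η](y) = L[η](iy)`. -/
def fourier {ι : Type*} (η : MatrixMeasure ι) (y : ℝ) : Matrix ι ι ℂ :=
  laplace η (Complex.I * y)

/-- The Fourier transform `F[g](y) = ∫ e^{iyu} g(u) du` of a real matrix function with
integrable entries. -/
def fourierFun {ι : Type*} (g : ℝ → Matrix ι ι ℝ) (y : ℝ) : Matrix ι ι ℂ :=
  Matrix.of fun a b => ∫ u : ℝ, Complex.exp (Complex.I * y * u) * (g u a b : ℂ)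

/-- All entries of the matrix function belong to `L^p` for Lebesgue measure. -/
def EntriesMemLp {ι : Type*} (g : ℝ → Matrix ι ι ℝ) (p : ENNReal) : Prop :=
  ∀ a b, MemLp (fun u => g u a b) p volume

/-- The characteristic matrix `h(z) = -z I - L[η](z)` of the first-order equation with delay
measure `η`. -/
def charMatrix {ι : Type*} [DecidableEq ι] (η : MatrixMeasure ι) (z : ℂ) : Matrix ι ι ℂ :=
  -(z • (1 : Matrix ι ι ℂ)) - laplace η z

/-- The delay measure of the `mn`-dimensional first-order system into which the `m`-th order
equation is embedded: block row `j < m - 1` has the single nonzero block `I_n δ_0` in block column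
`j + 1`, and the last block row is `(ϖ_0, …, ϖ_{m-1})`. -/
def companionMeasure {m n : ℕ} (ϖ : Fin m → MatrixMeasure (Fin n)) :
    MatrixMeasure (Fin m × Fin n) :=
  Matrix.of fun p q =>
    if (p.1 : ℕ) + 1 < m then
      if (q.1 : ℕ) = (p.1 : ℕ) + 1 ∧ q.2 = p.2 then (Measure.dirac (0 : ℝ)).toSignedMeasure else 0
    else ϖ q.1 p.2 q.2

/-- Block `(1, m)` of an `m × m` matrix of `n × n` blocks. -/
def topRightBlock {R : Type*} {m n : ℕ} (hm : 0 < m)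
    (A : Matrix (Fin m × Fin n) (Fin m × Fin n) R) : Matrix (Fin n) (Fin n) R :=
  A.submatrix (fun a => (⟨0, hm⟩, a)) (fun b => (⟨m - 1, Nat.sub_one_lt_of_lt hm⟩, b))

/-! ### Processes indexed by the line -/

section Processes

variable {Ω : Type*} [MeasurableSpace Ω]

/-- Stationarity: the finite-dimensional distributions are invariant under time shifts. -/
def IsStationary {n : ℕ} (P : Measure Ω) (X : ℝ → Ω → Fin n → ℝ) : Prop :=
  ∀ (r : ℝ) (T : Finset ℝ),
    P.map (fun ω (t : T) => X (t + r) ω) = P.map (fun ω (t : T) => X t ω)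

/-- Stationary increments: for each `r`, the process `(Z_{t+r} - Z_r)_t` has the same
finite-dimensional distributions as `(Z_t - Z_0)_t`. -/
def HasStationaryIncrements {n : ℕ} (P : Measure Ω) (Z : ℝ → Ω → Fin n → ℝ) : Prop :=
  ∀ (r : ℝ) (T : Finset ℝ),
    P.map (fun ω (t : T) => Z (t + r) ω - Z r ω) = P.map (fun ω (t : T) => Z t ω - Z 0 ω)

/-- A process that is jointly measurable in time and chance. -/
def IsMeasurableProcess {n : ℕ} (X : ℝ → Ω → Fin n → ℝ) : Prop :=
  Measurable (fun p : ℝ × Ω => X p.1 p.2)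

/-- The process is integrable: `E|X_t| < ∞` for each `t`. -/
def IsIntegrableProcess {n : ℕ} (P : Measure Ω) (X : ℝ → Ω → Fin n → ℝ) : Prop :=
  ∀ t, Integrable (X t) P

/-! ### Regular integrators -/

/-- The space `L^1 ∩ L^2` of (classes of) real functions on `ℝ`, for Lebesgue measure. -/
abbrev L1L2 : Submodule ℝ (ℝ →ₘ[volume] ℝ) :=
  Lp.LpSubmodule ℝ ℝ 1 volume ⊓ Lp.LpSubmodule ℝ ℝ 2 volume

/-- The class in `L^1 ∩ L^2` of a function. -/
def toL1L2 (f : ℝ → ℝ) (h : MemLp f 1 volume ∧ MemLp f 2 volume) : L1L2 :=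
  ⟨AEEqFun.mk f h.1.1, (h.1.toLp f).2, (h.2.toLp f).2⟩

open Classical in
/-- The value of a linear map `I : L^1 ∩ L^2 → L^1(P)` at a function `f` in `L^1 ∩ L^2`. -/
def integ {P : Measure Ω} (I : L1L2 →ₗ[ℝ] Lp ℝ 1 P) (f : ℝ → ℝ) : Ω → ℝ :=
  if h : MemLp f 1 volume ∧ MemLp f 2 volume then ⇑(I (toL1L2 f h)) else 0

/-- `f_r = 1_{[0,∞)}(· - r) - 1_{[0,∞)}`. -/
def stepDiff (r : ℝ) (v : ℝ) : ℝ :=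
  (Set.Ici (0 : ℝ)).indicator 1 (v - r) - (Set.Ici (0 : ℝ)).indicator 1 v

/-- The linear map `I : L^1 ∩ L^2 → L^1(P)` is a regular integral for the real process `ζ`:
(i) it maps `1_{(s,t]}` to `ζ_t - ζ_s`;
(ii) it satisfies the Fubini relation
`I (∫ f_r(t - ·) μ(dr)) = ∫ I (f_r(t - ·)) μ(dr)` almost surely, for each `t` and each finite
measure `μ` with first moment. The right-hand side is the pathwise integral of any jointly
measurable version `Y` of `r ↦ I (f_r(t - ·))`. -/
structure IsRegularIntegral (P : Measure Ω) (ζ : ℝ → Ω → ℝ) (I : L1L2 →ₗ[ℝ] Lp ℝ 1 P) :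
    Prop where
  increment : ∀ s t : ℝ, s < t →
    integ I ((Set.Ioc s t).indicator 1) =ᵐ[P] fun ω => ζ t ω - ζ s ω
  fubini : ∀ (μ : Measure ℝ) [IsFiniteMeasure μ], Integrable (fun r : ℝ => |r|) μ →
    ∀ (t : ℝ) (Y : ℝ → Ω → ℝ), Measurable (fun p : ℝ × Ω => Y p.1 p.2) →
      (∀ r, Y r =ᵐ[P] integ I (fun u => stepDiff r (t - u))) →
      integ I (fun u => ∫ r, stepDiff r (t - u) ∂μ) =ᵐ[P] fun ω => ∫ r, Y r ω ∂μ

/-! ### Higher-order equations -/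

/-- `Y'` is the (entrywise) derivative process of `Y`: almost every path of `Y` is locally
absolutely continuous with density the path of `Y'`, and at each time `t`, almost surely, `Y` is
differentiable at `t` with derivative `Y'_t`. -/
structure IsDerivativeProcess {n : ℕ} (P : Measure Ω) (Y Y' : ℝ → Ω → Fin n → ℝ) : Prop where
  measurable : IsMeasurableProcess Y'
  absCont : ∀ᵐ ω ∂P, ∀ (k : Fin n) (s t : ℝ),
    IntervalIntegrable (fun u => Y' u ω k) volume s t ∧
      Y t ω k - Y s ω k = ∫ u in s..t, Y' u ω k
  hasDeriv : ∀ t : ℝ, ∀ᵐ ω ∂P, ∀ k : Fin n, HasDerivAt (fun u => Y u ω k) (Y' t ω k) t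

/-- `X` satisfies the `m`-th order equation
`dX^{(m-1)}_t = ∑_{j<m} (ϖ_j * X^{(j)})(t) dt + dZ_t`.
Here `Y j` is the `j`-th derivative of `X`; for each `s < t`, almost surely, the double integrals
in the integrated equation converge absolutely and the equation holds. -/
structure IsSolution {m n : ℕ} (P : Measure Ω) (ϖ : Fin m → MatrixMeasure (Fin n))
    (Z X : ℝ → Ω → Fin n → ℝ) : Prop where
  measurable : IsMeasurableProcess X
  integrable : IsIntegrableProcess P X
  stationary : IsStationary P X
  equation : ∃ Y : ℕ → ℝ → Ω → Fin n → ℝ, Y 0 = X ∧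
    (∀ j, j + 1 < m → IsDerivativeProcess P (Y j) (Y (j + 1))) ∧
    ∀ s t : ℝ, s < t → ∀ᵐ ω ∂P,
      (∀ (j : Fin m) (k l : Fin n), Integrable (fun p : ℝ × ℝ => Y j (p.1 - p.2) ω l)
        ((volume.restrict (Set.Ioc s t)).prod (ϖ j k l).totalVariation)) ∧
      ∀ k : Fin n, Y (m - 1) t ω k - Y (m - 1) s ω k =
        (∑ j : Fin m, ∑ l : Fin n,
          ∫ u in s..t, sIntegral (ϖ j k l) fun v => Y j (u - v) ω l) + (Z t ω k - Z s ω k)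

/-- The `σ`-algebra `σ(Z_t - Z_s : s < t)`. -/
@[reducible] def pastIncrements {n : ℕ} (Z : ℝ → Ω → Fin n → ℝ) (t : ℝ) : MeasurableSpace Ω :=
  ⨆ s : Set.Iio t, MeasurableSpace.comap (fun ω => Z t ω - Z s ω) inferInstance

/-- `X` is causal with respect to `Z`: for each `t`, `X_t` is (up to a null set) measurable with
respect to `σ(Z_t - Z_s : s < t)`. -/
def IsCausal {n : ℕ} (P : Measure Ω) (Z X : ℝ → Ω → Fin n → ℝ) : Prop :=
  ∀ t : ℝ, ∃ ξ : Ω → Fin n → ℝ, Measurable[pastIncrements Z t] ξ ∧ X t =ᵐ[P] ξ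

end Processes

end

end MSDDE

namespace MSDDE

noncomputable section

/-! ### Integration against a signed measure -/

/-! The equation is embedded into a first-order system with delay measure η, and everything is read
off the kernel g with transform h(iy)⁻¹. Claim 1 is a determinant identity for block companion
matrices (`det_blockCompanion`); the same algebra identifies block (1, m) of the inverse
(`topRightBlock_inv_blockCompanion`).

Kernel. On the imaginary axis h(z)⁻¹ = O(1/|z|), which is not integrable. Subtracting (1 - z)⁻¹ I,
the transform of e^{-u} I on [0, ∞), leaves a remainder of order 1/|z|²; second moments of η make it
twice differentiable along the axis, with equally decaying derivatives. Fourier inversion and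
Plancherel give a continuous inverse transform in L¹ ∩ L² with first moment, hence g
(`exists_kernel`). If h is invertible on the whole closed left half-plane, shifting the contour to
Re z → -∞ shows that g vanishes on (-∞, 0).

Pathwise form. Put φ = η * g. The identity h h⁻¹ = I says that the distributional derivative of g is
φ + I δ_0, and at y = 0 that ∫ φ = -I. Therefore g = ∫ f_r φ(r) dr almost everywhere
(`IsKernel.ae_eq_stepPrimitive`), and the Fubini property of the integrator turns the integral of
g(t - ·) into the ordinary integral ∫ (Z_{t-r} - Z_t) φ(r) dr
(`IsRegularIntegral.integ_eq_incrConv`). It converges because φ has a first moment and E|Z_t - Z_s|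
≤ C(1 + |t - s|), which follows from stationary increments and joint measurability.

Existence. These moving averages are stationary, being limits in mean of finite combinations of
increments. To verify the first-order equation, both sides are integrated over an arbitrary event A:
Z is replaced by u ↦ E[1_A Z_u], which is continuous with increments of linear growth, and the claim
reduces to Fubini and integration by parts (`IsKernel.sum_integral_sIntegral_incrConv`,
`IsKernel.ae_sub_eq`). The block rows with δ_0 say that each block is a primitive of the next.
Differentiability at a fixed time comes from Lebesgue's theorem at almost every time and shift
invariance of the law of the difference quotients
(`HasStationaryIncrements.ae_hasDerivAt_integral`).

Uniqueness. The derivatives of a competing solution are not known to be integrable over Ω, so the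
equation is tested against a smooth compactly supported ρ, which takes over all derivatives. For two
solutions, e(u) = E[1_A (X_u - X'_u)] is bounded, and the smoothings e * ρ^{(j)} form a bounded
solution of the homogeneous system V' = η * V. Computing g * V' once by parts and once by
associativity with g * η = η * g gives V = 0 (`IsKernel.eq_zero_of_bounded_solution`), whence e = 0
for every A.

Causality. If g vanishes on (-∞, 0), so does φ, and the moving average involves Z_{t-r} - Z_t for r
≥ 0 only. -/

instance (μ : SignedMeasure ℝ) : IsFiniteMeasure μ.totalVariation := by
  unfold SignedMeasure.totalVariation; infer_instance

/-- The density of a signed measure with respect to its variation measure. -/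
def polarSign (μ : SignedMeasure ℝ) : ℝ → ℝ :=
  open Classical in
  fun u => if u ∈ μ.toJordanDecomposition.mutuallySingular.nullSet then -1 else 1

lemma measurable_polarSign (μ : SignedMeasure ℝ) : Measurable (polarSign μ) :=
  Measurable.ite μ.toJordanDecomposition.mutuallySingular.measurableSet_nullSet
    measurable_const measurable_const

lemma abs_polarSign (μ : SignedMeasure ℝ) (u : ℝ) : |polarSign μ u| = 1 := by
  unfold polarSign; split_ifs <;> simp

lemma norm_polarSign_smul {E : Type*} [NormedAddCommGroup E] [NormedSpace ℝ E]
    (μ : SignedMeasure ℝ) (u : ℝ) (x : E) : ‖polarSign μ u • x‖ = ‖x‖ := by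
  rw [norm_smul, Real.norm_eq_abs, abs_polarSign, one_mul]

lemma polarSign_ae_pos (μ : SignedMeasure ℝ) :
    ∀ᵐ u ∂μ.toJordanDecomposition.posPart, polarSign μ u = 1 := by
  have h := μ.toJordanDecomposition.mutuallySingular.measure_nullSet
  rw [← compl_compl (Measure.MutuallySingular.nullSet _)] at h
  filter_upwards [mem_ae_iff.2 h] with u hu
  simp only [polarSign, if_neg hu]

lemma polarSign_ae_neg (μ : SignedMeasure ℝ) :
    ∀ᵐ u ∂μ.toJordanDecomposition.negPart, polarSign μ u = -1 := by
  have h := μ.toJordanDecomposition.mutuallySingular.measure_compl_nullSet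
  filter_upwards [mem_ae_iff.2 h] with u hu
  simp only [polarSign, if_pos hu]

section
variable {E : Type*} [NormedAddCommGroup E]

lemma integrable_posPart {μ : SignedMeasure ℝ} {f : ℝ → E}
    (h : Integrable f μ.totalVariation) : Integrable f μ.toJordanDecomposition.posPart :=
  (integrable_add_measure.1 h).1

lemma integrable_negPart {μ : SignedMeasure ℝ} {f : ℝ → E}
    (h : Integrable f μ.totalVariation) : Integrable f μ.toJordanDecomposition.negPart :=
  (integrable_add_measure.1 h).2

variable [NormedSpace ℝ E]

lemma integrable_polarSign_smul {μ : SignedMeasure ℝ} {f : ℝ → E}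
    (h : Integrable f μ.totalVariation) :
    Integrable (fun u => polarSign μ u • f u) μ.totalVariation :=
  h.mono ((measurable_polarSign μ).aestronglyMeasurable.smul h.1)
    (Filter.Eventually.of_forall fun u => (norm_polarSign_smul μ u _).le)

/-- The polar form trades a difference of two integrals for one Bochner integral against the
variation measure, so norm bounds, dominated convergence and Fubini apply directly. -/
lemma sIntegral_eq {μ : SignedMeasure ℝ} {f : ℝ → E} (h : Integrable f μ.totalVariation) :
    sIntegral μ f = ∫ u, polarSign μ u • f u ∂μ.totalVariation := by
  have h' := integrable_polarSign_smul h
  unfold SignedMeasure.totalVariation sIntegral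
  rw [integral_add_measure (integrable_posPart h') (integrable_negPart h'), sub_eq_add_neg,
    ← integral_neg]
  congr 1
  · exact integral_congr_ae ((polarSign_ae_pos μ).mono fun u hu => by simp [hu])
  · exact integral_congr_ae ((polarSign_ae_neg μ).mono fun u hu => by simp [hu])

lemma norm_sIntegral_le {μ : SignedMeasure ℝ} {f : ℝ → E} (h : Integrable f μ.totalVariation) :
    ‖sIntegral μ f‖ ≤ ∫ u, ‖f u‖ ∂μ.totalVariation := by
  rw [sIntegral_eq h]
  refine (norm_integral_le_integral_norm _).trans_eq ?_
  simp only [norm_polarSign_smul]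

lemma sIntegral_congr_ae {μ : SignedMeasure ℝ} {f g : ℝ → E}
    (h : f =ᵐ[μ.totalVariation] g) : sIntegral μ f = sIntegral μ g := by
  unfold SignedMeasure.totalVariation at h
  rw [Filter.EventuallyEq, ae_add_measure_iff] at h
  unfold sIntegral
  rw [integral_congr_ae h.1, integral_congr_ae h.2]

lemma sIntegral_const_smul {𝕜 : Type*} [RCLike 𝕜] [NormedSpace 𝕜 E] [SMulCommClass ℝ 𝕜 E]
    (μ : SignedMeasure ℝ) (c : 𝕜) (f : ℝ → E) :
    sIntegral μ (fun u => c • f u) = c • sIntegral μ f := by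
  unfold sIntegral
  rw [integral_smul, integral_smul, smul_sub]

lemma sIntegral_sub {μ : SignedMeasure ℝ} {f g : ℝ → E} (hf : Integrable f μ.totalVariation)
    (hg : Integrable g μ.totalVariation) :
    sIntegral μ (fun u => f u - g u) = sIntegral μ f - sIntegral μ g := by
  unfold sIntegral
  rw [integral_sub (integrable_posPart hf) (integrable_posPart hg),
    integral_sub (integrable_negPart hf) (integrable_negPart hg)]
  abel

lemma sIntegral_finset_sum {κ : Type*} {μ : SignedMeasure ℝ} (s : Finset κ) {f : κ → ℝ → E}
    (hf : ∀ i ∈ s, Integrable (f i) μ.totalVariation) :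
    sIntegral μ (fun u => ∑ i ∈ s, f i u) = ∑ i ∈ s, sIntegral μ (f i) := by
  unfold sIntegral
  rw [integral_finsetSum _ fun i hi => integrable_posPart (hf i hi),
    integral_finsetSum _ fun i hi => integrable_negPart (hf i hi), Finset.sum_sub_distrib]

lemma stronglyMeasurable_sIntegral {α : Type*} [MeasurableSpace α] (μ : SignedMeasure ℝ)
    {f : α → ℝ → E} (hf : StronglyMeasurable (Function.uncurry f)) :
    StronglyMeasurable fun x => sIntegral μ (f x) := by
  unfold sIntegral
  exact hf.integral_prod_right.sub hf.integral_prod_right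

/-- Fubini's theorem for a signed measure and a `σ`-finite measure. -/
lemma integral_sIntegral_swap {α : Type*} [MeasurableSpace α] {ν : Measure α} [SFinite ν]
    {μ : SignedMeasure ℝ} {f : α → ℝ → E}
    (hf : Integrable (Function.uncurry f) (ν.prod μ.totalVariation)) :
    ∫ x, sIntegral μ (f x) ∂ν = sIntegral μ fun u => ∫ x, f x u ∂ν := by
  have h1 : ∀ᵐ x ∂ν, sIntegral μ (f x) = ∫ u, polarSign μ u • f x u ∂μ.totalVariation :=
    hf.prod_right_ae.mono fun x hx => sIntegral_eq hx
  have h2 : Integrable (Function.uncurry fun x u => polarSign μ u • f x u)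
      (ν.prod μ.totalVariation) :=
    hf.mono (((measurable_polarSign μ).comp measurable_snd).aestronglyMeasurable.smul hf.1)
      (Filter.Eventually.of_forall fun p => (norm_polarSign_smul μ p.2 _).le)
  have h3 := sIntegral_eq (μ := μ) (f := fun u => ∫ x, f x u ∂ν) hf.integral_prod_right
  rw [integral_congr_ae h1, integral_integral_swap h2, h3]
  simp only [integral_smul]

lemma integrable_sIntegral {α : Type*} [MeasurableSpace α] {ν : Measure α} [SFinite ν]
    {μ : SignedMeasure ℝ} {f : α → ℝ → E}
    (hf : Integrable (Function.uncurry f) (ν.prod μ.totalVariation)) :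
    Integrable (fun x => sIntegral μ (f x)) ν := by
  have h1 : ∀ᵐ x ∂ν, ∫ u, polarSign μ u • f x u ∂μ.totalVariation = sIntegral μ (f x) :=
    hf.prod_right_ae.mono fun x hx => (sIntegral_eq hx).symm
  have h2 : Integrable (Function.uncurry fun x u => polarSign μ u • f x u)
      (ν.prod μ.totalVariation) :=
    hf.mono (((measurable_polarSign μ).comp measurable_snd).aestronglyMeasurable.smul hf.1)
      (Filter.Eventually.of_forall fun p => (norm_polarSign_smul μ p.2 _).le)
  exact h2.integral_prod_left.congr h1

end

/-! ### The signed measure attached to a finite measure -/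

lemma toJordanDecomposition_toSignedMeasure (ν : Measure ℝ) [IsFiniteMeasure ν] :
    ν.toSignedMeasure.toJordanDecomposition =
      { posPart := ν, negPart := 0, mutuallySingular := Measure.MutuallySingular.zero_right } :=
  SignedMeasure.toJordanDecomposition_eq (by simp [JordanDecomposition.toSignedMeasure])

lemma totalVariation_toSignedMeasure (ν : Measure ℝ) [IsFiniteMeasure ν] :
    ν.toSignedMeasure.totalVariation = ν := by
  simp [SignedMeasure.totalVariation, toJordanDecomposition_toSignedMeasure]

lemma sIntegral_toSignedMeasure {E : Type*} [NormedAddCommGroup E] [NormedSpace ℝ E]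
    (ν : Measure ℝ) [IsFiniteMeasure ν] (f : ℝ → E) :
    sIntegral ν.toSignedMeasure f = ∫ u, f u ∂ν := by
  simp [sIntegral, toJordanDecomposition_toSignedMeasure]

lemma totalVariation_zero : (0 : SignedMeasure ℝ).totalVariation = 0 := by
  simp [SignedMeasure.totalVariation, SignedMeasure.toJordanDecomposition_zero]

lemma sIntegral_zero {E : Type*} [NormedAddCommGroup E] [NormedSpace ℝ E] (f : ℝ → E) :
    sIntegral 0 f = 0 := by
  simp [sIntegral, SignedMeasure.toJordanDecomposition_zero]

/-! ### Convolution of a function with a signed measure -/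

/-- The convolution `(μ * f)(w) = ∫ f(w - v) μ(dv)`. -/
def sConv (μ : SignedMeasure ℝ) (f : ℝ → ℝ) (w : ℝ) : ℝ := sIntegral μ fun v => f (w - v)

lemma measurable_sConv (μ : SignedMeasure ℝ) {f : ℝ → ℝ} (hf : Measurable f) :
    Measurable (sConv μ f) :=
  (stronglyMeasurable_sIntegral μ
    (f := fun w v => f (w - v)) (hf.comp (measurable_fst.sub measurable_snd)).stronglyMeasurable
    ).measurable

/-- By translation invariance ∫ |f(w - v)| dw does not depend on v, so finiteness of `ν` and
boundedness of `k` give joint integrability. -/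
lemma integrable_prod_translate {E : Type*} [NormedAddCommGroup E] [NormedSpace ℝ E]
    (ν : Measure ℝ) [IsFiniteMeasure ν] {f : ℝ → ℝ}
    (hf : Measurable f) (hfi : Integrable f) {k : ℝ → E} (hk : StronglyMeasurable k) {C : ℝ}
    (hC : ∀ w, ‖k w‖ ≤ C) :
    Integrable (Function.uncurry fun w v => f (w - v) • k w) (volume.prod ν) := by
  have hm : AEStronglyMeasurable (Function.uncurry fun w v => f (w - v) • k w)
      (volume.prod ν) :=
    ((hf.comp (measurable_fst.sub measurable_snd)).aestronglyMeasurable.smul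
      (hk.comp_measurable measurable_fst).aestronglyMeasurable)
  have hb : Integrable (Function.uncurry fun w v => C * f (w - v)) (volume.prod ν) := by
    refine (integrable_prod_iff' ?_).2 ⟨Filter.Eventually.of_forall fun v => ?_, ?_⟩
    · exact ((hf.comp (measurable_fst.sub measurable_snd)).const_mul C).aestronglyMeasurable
    · exact (hfi.comp_sub_right v).const_mul C
    · simp only [Function.uncurry_apply_pair, norm_mul]
      have : ∀ v, ∫ w, ‖C‖ * ‖f (w - v)‖ = ‖C‖ * ∫ w, ‖f w‖ := fun v => by
        rw [integral_const_mul, integral_sub_right_eq_self (fun w => ‖f w‖) v]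
      simp only [this]
      exact integrable_const _
  refine hb.mono hm (Filter.Eventually.of_forall fun p => ?_)
  simp only [Function.uncurry, norm_smul, norm_mul]
  rw [mul_comm]
  gcongr
  exact (hC p.1).trans (le_abs_self C)

lemma integrable_sConv (μ : SignedMeasure ℝ) {f : ℝ → ℝ} (hf : Measurable f)
    (hfi : Integrable f) : Integrable (sConv μ f) := by
  have h := integrable_prod_translate μ.totalVariation hf hfi (k := fun _ => (1 : ℝ))
    stronglyMeasurable_const (C := 1) (by simp)
  simp only [smul_eq_mul, mul_one] at h
  exact integrable_sIntegral h

/-- Fubini and a shift of variable move the convolution onto the test function. With `k` an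
exponential this is the convolution theorem; with `k` a bounded path or increment it serves in the
delay equation. -/
lemma integral_sConv_smul {E : Type*} [NormedAddCommGroup E] [NormedSpace ℝ E] [CompleteSpace E]
    (μ : SignedMeasure ℝ) {f : ℝ → ℝ} (hf : Measurable f)
    (hfi : Integrable f) {k : ℝ → E} (hk : StronglyMeasurable k) {C : ℝ}
    (hC : ∀ w, ‖k w‖ ≤ C) :
    ∫ w, sConv μ f w • k w = sIntegral μ fun v => ∫ w, f w • k (w + v) := by
  have h := integrable_prod_translate μ.totalVariation hf hfi hk hC
  have h1 := integrable_prod_translate μ.totalVariation hf hfi (k := fun _ => (1 : ℝ))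
    stronglyMeasurable_const (C := 1) (by simp)
  simp only [smul_eq_mul, mul_one] at h1
  have h2 : ∀ᵐ w, sConv μ f w • k w = sIntegral μ fun v => f (w - v) • k w := by
    filter_upwards [h.prod_right_ae, h1.prod_right_ae] with w hw hw1
    simp only [Function.uncurry_apply_pair] at hw hw1
    rw [sConv, sIntegral_eq hw, sIntegral_eq hw1, ← integral_smul_const]
    simp only [smul_smul, smul_eq_mul]
  rw [integral_congr_ae h2, integral_sIntegral_swap h]
  congr 1
  ext v
  rw [← integral_add_right_eq_self (fun w => f (w - v) • k w) v]
  simp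

/-- Since |w + v| ≤ |w| + |v|, a first moment of `f` survives convolution with a measure that has
one itself. It carries the first moment of the kernel over to `η * g`. -/
lemma integrable_abs_mul_sConv (μ : SignedMeasure ℝ) (hμ : Integrable (fun u => |u|) μ.totalVariation)
    {f : ℝ → ℝ} (hf : Measurable f) (hfi : Integrable f) (hfm : Integrable fun u => |u| * f u) :
    Integrable fun w => |w| * sConv μ f w := by
  have hm : AEStronglyMeasurable (Function.uncurry fun w v : ℝ => |w| * f (w - v))
      (volume.prod μ.totalVariation) :=
    (measurable_fst.norm.mul (hf.comp (measurable_fst.sub measurable_snd))).aestronglyMeasurable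
  have hb : Integrable (Function.uncurry fun w v : ℝ => |w| * f (w - v))
      (volume.prod μ.totalVariation) := by
    have key : ∀ v, Integrable fun w => |w| * f (w - v) := fun v => by
      have : Integrable fun w => |w + v| * f w := by
        refine (hfm.norm.add (hfi.norm.const_mul |v|)).mono
          ((measurable_id.add_const v).norm.mul hf).aestronglyMeasurable
          (Filter.Eventually.of_forall fun w => ?_)
        simp only [Pi.add_apply, norm_mul, Real.norm_eq_abs, abs_abs]
        refine le_trans ?_ (le_abs_self _)
        rw [← add_mul]
        gcongr
        exact abs_add_le w v
      simpa using this.comp_sub_right v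
    refine (integrable_prod_iff' hm).2 ⟨Filter.Eventually.of_forall key, ?_⟩
    refine Integrable.mono' (g := fun v => (∫ w, ‖|w| * f w‖) + |v| * ∫ w, ‖f w‖)
      ((integrable_const _).add (hμ.mul_const _)) ?_ (Filter.Eventually.of_forall fun v => ?_)
    · exact (StronglyMeasurable.integral_prod_left'
          (f := fun p : ℝ × ℝ => ‖Function.uncurry (fun w v : ℝ => |w| * f (w - v)) p‖)
          (measurable_fst.norm.mul
            (hf.comp (measurable_fst.sub measurable_snd))).norm.stronglyMeasurable
          ).aestronglyMeasurable
    · rw [Real.norm_of_nonneg (integral_nonneg fun _ => norm_nonneg _)]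
      rw [← integral_add_right_eq_self _ v, ← integral_const_mul, ← integral_add hfm.norm
        (hfi.norm.const_mul |v|)]
      refine integral_mono ?_ (hfm.norm.add (hfi.norm.const_mul |v|)) fun w => ?_
      · exact (key v).norm.comp_add_right v
      · simp only [Function.uncurry_apply_pair, norm_mul, Real.norm_eq_abs, abs_abs,
          add_sub_cancel_right]
        rw [← add_mul]
        gcongr
        exact abs_add_le w v
  refine (integrable_sIntegral hb).congr (Filter.Eventually.of_forall fun w => ?_)
  exact sIntegral_const_smul μ |w| fun v => f (w - v)

/-! ### Fourier analysis on the line -/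

open FourierTransform in
lemma continuous_fourier {f : ℝ → ℂ} (hf : Integrable f) : Continuous (𝓕 f) :=
  VectorFourier.fourierIntegral_continuous (μ := volume) (L := innerₗ ℝ)
    Real.continuous_fourierChar continuous_inner hf

open FourierTransform in
/-- Plancherel's theorem on `L¹ ∩ L²`: the Fourier integral is square integrable. -/
lemma memLp_two_fourier {f : ℝ → ℂ} (hf : Integrable f) (hf2 : MemLp f 2) :
    MemLp (𝓕 f) 2 := by
  have hc : Continuous (𝓕 f) := continuous_fourier hf
  set F : Lp ℂ 2 (volume : Measure ℝ) := 𝓕 (hf2.toLp f) with hF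
  have hFf : (F : ℝ → ℂ) =ᵐ[volume] 𝓕 f := by
    -- The L² transform and the Fourier integral are compared by testing. Against a smooth compactly
    -- supported function both move the transform onto the test function, one as a tempered
    -- distribution, the other by Fubini.
    refine ae_eq_of_integral_contDiff_smul_eq
      ((Lp.memLp F).locallyIntegrable (by norm_num)) hc.locallyIntegrable fun g hg hgc => ?_
    have hg1 : HasCompactSupport fun x => (g x : ℂ) :=
      hgc.comp_left (g := fun x : ℝ => (x : ℂ)) Complex.ofReal_zero
    have hg2 : ContDiff ℝ (⊤ : ℕ∞) fun x => (g x : ℂ) := Complex.ofRealCLM.contDiff.comp hg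
    let φ : SchwartzMap ℝ ℂ := hg1.toSchwartzMap hg2
    have hφ : ∀ x, φ x = (g x : ℂ) := fun x => rfl
    have h1 := Lp.toTemperedDistribution_apply F φ
    rw [hF, ← Lp.fourier_toTemperedDistribution_eq, TemperedDistribution.fourier_apply,
      Lp.toTemperedDistribution_apply] at h1
    have h2 : ∫ x, (𝓕 φ) x • (hf2.toLp f : ℝ → ℂ) x = ∫ x, (𝓕 φ) x • f x :=
      integral_congr_ae (hf2.coeFn_toLp.mono fun x hx => by simp only [hx])
    have h3 : ∫ ξ, (𝓕 (φ : ℝ → ℂ)) ξ • f ξ = ∫ x, φ x • (𝓕 f) x := by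
      have := VectorFourier.integral_fourierIntegral_smul_eq_flip (L := innerₗ ℝ)
        Real.continuous_fourierChar continuous_inner (φ.integrable (μ := volume)) hf
      rwa [flip_innerₗ] at this
    rw [h2, SchwartzMap.fourier_coe, h3] at h1
    simpa [hφ, ← hF] using h1.symm
  exact (memLp_congr_ae hFf).1 (Lp.memLp F)

open FourierTransform in
-- Up to a constant the transform of f'' is u² times that of f. Boundedness of both makes 𝓕 f
-- integrable; square integrability of u² 𝓕 f, from Plancherel, and of 1/u at infinity gives the
-- first moment.
lemma integrable_fourier_of_deriv2 {f f' f'' : ℝ → ℂ} (h0 : ∀ x, HasDerivAt f (f' x) x)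
    (h1 : ∀ x, HasDerivAt f' (f'' x) x) (hf : Integrable f) (hf' : Integrable f')
    (hf'' : Integrable f'') (hf2 : MemLp f'' 2) :
    Continuous (𝓕 f) ∧ Integrable (𝓕 f) ∧ MemLp (𝓕 f) 2 ∧
      Integrable fun u => |u| * ‖𝓕 f u‖ := by
  have hc : Continuous (𝓕 f) := continuous_fourier hf
  have e0 : deriv f = f' := funext fun x => (h0 x).deriv
  have e1 : deriv f' = f'' := funext fun x => (h1 x).deriv
  have hd : ∀ u, ‖𝓕 f'' u‖ = (2 * Real.pi) ^ 2 * (u ^ 2 * ‖𝓕 f u‖) := fun u => by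
    rw [← e1, Real.fourier_deriv hf' (fun x => (h1 x).differentiableAt) (e1 ▸ hf''), ← e0,
      Real.fourier_deriv hf (fun x => (h0 x).differentiableAt) (e0 ▸ hf')]
    simp only [norm_smul, norm_mul, Complex.norm_I, Complex.norm_real, Complex.norm_ofNat,
      Real.norm_eq_abs, abs_of_pos Real.pi_pos]
    rw [← sq_abs u]; ring
  have hpi : 1 ≤ (2 * Real.pi) ^ 2 := by nlinarith [Real.pi_gt_three]
  have hle : ∀ u, u ^ 2 * ‖𝓕 f u‖ ≤ ‖𝓕 f'' u‖ := fun u => by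
    rw [hd]; exact le_mul_of_one_le_left (by positivity) hpi
  have hb : ∀ u, ‖𝓕 f u‖ ≤ ∫ x, ‖f x‖ := fun u =>
    VectorFourier.norm_fourierIntegral_le_integral_norm _ _ _ _ _
  have hb2 : ∀ u, ‖𝓕 f'' u‖ ≤ ∫ x, ‖f'' x‖ := fun u =>
    VectorFourier.norm_fourierIntegral_le_integral_norm _ _ _ _ _
  have hi : Integrable (𝓕 f) := by
    refine (integrable_inv_one_add_sq.const_mul ((∫ x, ‖f x‖) + ∫ x, ‖f'' x‖)).mono'
      hc.aestronglyMeasurable (Filter.Eventually.of_forall fun u => ?_)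
    rw [← div_eq_mul_inv, le_div_iff₀ (by positivity)]
    nlinarith [hb u, hb2 u, hle u]
  have h2 : MemLp (𝓕 f) 2 := by
    rw [memLp_two_iff_integrable_sq_norm hc.aestronglyMeasurable]
    refine (hi.norm.const_mul (∫ x, ‖f x‖)).mono' (hc.norm.pow 2).aestronglyMeasurable
      (Filter.Eventually.of_forall fun u => ?_)
    rw [Real.norm_of_nonneg (by positivity), sq]
    exact mul_le_mul_of_nonneg_right (hb u) (norm_nonneg _)
  refine ⟨hc, hi, h2, ?_⟩
  have h3 := memLp_two_fourier hf'' hf2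
  rw [memLp_two_iff_integrable_sq_norm h3.1] at h3
  refine ((hi.norm.add h3).add (integrable_inv_one_add_sq.const_mul 2)).mono'
    (continuous_abs.mul hc.norm).aestronglyMeasurable (Filter.Eventually.of_forall fun u => ?_)
  rw [Real.norm_of_nonneg (by positivity)]
  simp only [Pi.add_apply]
  have hx := norm_nonneg (𝓕 f u)
  have hp : (0 : ℝ) < (1 + u ^ 2)⁻¹ := by positivity
  rcases le_total |u| 1 with hu | hu
  · nlinarith [sq_nonneg ‖𝓕 f'' u‖, mul_le_mul_of_nonneg_right hu hx]
  -- The inequality ab ≤ a² + b² with a = u²‖𝓕 f u‖ and b = 1/|u|; for |u| ≥ 1 the square of b is at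
  -- most 2/(1 + u²).
  · have h4 : |u| * ‖𝓕 f u‖ ≤ (u ^ 2 * ‖𝓕 f u‖) ^ 2 + 2 * (1 + u ^ 2)⁻¹ := by
      have hu0 : 0 < |u| := by linarith
      have h5 : |u|⁻¹ ^ 2 ≤ 2 * (1 + u ^ 2)⁻¹ := by
        rw [inv_pow, sq_abs, ← div_eq_mul_inv, inv_eq_one_div, div_le_div_iff₀] <;>
        nlinarith [sq_abs u, sq_nonneg u]
      have h6 : |u| * ‖𝓕 f u‖ = (u ^ 2 * ‖𝓕 f u‖) * |u|⁻¹ := by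
        rw [← sq_abs]; field_simp
      rw [h6]
      nlinarith [sq_nonneg (u ^ 2 * ‖𝓕 f u‖ - |u|⁻¹), sq_nonneg (u ^ 2 * ‖𝓕 f u‖),
        sq_nonneg |u|⁻¹]
    have h7 := pow_le_pow_left₀ (by positivity) (hle u) 2
    linarith

lemma memLp_two_of_bound {f : ℝ → ℂ} (hc : Continuous f) {C : ℝ}
    (hC : ∀ y, ‖f y‖ ≤ C * (1 + y ^ 2)⁻¹) : Integrable f ∧ MemLp f 2 := by
  have hi : Integrable f := (integrable_inv_one_add_sq.const_mul C).mono'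
      hc.aestronglyMeasurable (Filter.Eventually.of_forall hC)
  refine ⟨hi, ?_⟩
  rw [memLp_two_iff_integrable_sq_norm hc.aestronglyMeasurable]
  have hC0 : 0 ≤ C := by have := (norm_nonneg _).trans (hC 0); simpa using this
  refine (hi.norm.const_mul C).mono' (hc.norm.pow 2).aestronglyMeasurable
      (Filter.Eventually.of_forall fun u => ?_)
  rw [Real.norm_of_nonneg (by positivity), sq]
  refine mul_le_mul_of_nonneg_right ((hC u).trans ?_) (norm_nonneg _)
  refine mul_le_of_le_one_right hC0 (inv_le_one_of_one_le₀ ?_)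
  nlinarith [sq_nonneg u]

/-- Inversion of a twice differentiable function that decays quadratically together with its
derivatives. -/
lemma exists_fourier_preimage {F F' F'' : ℝ → ℂ} (h0 : ∀ x, HasDerivAt F (F' x) x)
    (h1 : ∀ x, HasDerivAt F' (F'' x) x) (hc : Continuous F'') {C : ℝ}
    (hF : ∀ y, ‖F y‖ ≤ C * (1 + y ^ 2)⁻¹) (hF' : ∀ y, ‖F' y‖ ≤ C * (1 + y ^ 2)⁻¹)
    (hF'' : ∀ y, ‖F'' y‖ ≤ C * (1 + y ^ 2)⁻¹) (hs : ∀ y, F (-y) = starRingEnd ℂ (F y)) :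
    ∃ r : ℝ → ℝ, Continuous r ∧ Integrable r ∧ MemLp r 2 ∧ (Integrable fun u => |u| * r u) ∧
      (∀ y : ℝ, ∫ u : ℝ, Complex.exp (Complex.I * y * u) * (r u : ℂ) = F y) ∧
      ∀ u : ℝ, (r u : ℂ) =
        (2 * Real.pi)⁻¹ * ∫ y : ℝ, Complex.exp (-(Complex.I * y * u)) * F y := by
  have hp : 2 * Real.pi ≠ 0 := by positivity
  have i0 := (memLp_two_of_bound (continuous_iff_continuousAt.2 fun x => (h0 x).continuousAt) hF)
  have i1 := (memLp_two_of_bound (continuous_iff_continuousAt.2 fun x => (h1 x).continuousAt) hF')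
  have i2 := memLp_two_of_bound hc hF''
  -- The rescaling reconciles the 2π in the exponent of `𝓕` with the normalisation used here.
  set f : ℝ → ℂ := fun x => F (2 * Real.pi * x) with hf
  have hd : ∀ (G G' : ℝ → ℂ), (∀ x, HasDerivAt G (G' x) x) → ∀ x,
      HasDerivAt (fun x => G (2 * Real.pi * x)) ((2 * Real.pi) • G' (2 * Real.pi * x)) x := by
    intro G G' h x
    exact (h (2 * Real.pi * x)).scomp x (by simpa using (hasDerivAt_id x).const_mul (2 * Real.pi))
  have hd0 := hd _ _ h0
  have hd1 : ∀ x, HasDerivAt (fun x => (2 * Real.pi) • F' (2 * Real.pi * x))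
      ((2 * Real.pi) • (2 * Real.pi) • F'' (2 * Real.pi * x)) x :=
    fun x => (hd _ _ h1 x).const_smul (2 * Real.pi)
  have hm : MemLp (fun x => (2 * Real.pi) • (2 * Real.pi) • F'' (2 * Real.pi * x)) 2 := by
    refine MemLp.const_smul (MemLp.const_smul ?_ (2 * Real.pi)) (2 * Real.pi)
    have hc' : Continuous fun x => F'' (2 * Real.pi * x) := hc.comp (by fun_prop)
    rw [memLp_two_iff_integrable_sq_norm hc'.aestronglyMeasurable]
    exact ((memLp_two_iff_integrable_sq_norm hc.aestronglyMeasurable).1 i2.2).comp_mul_left' hp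
  obtain ⟨k1, k2, k3, k4⟩ := integrable_fourier_of_deriv2 hd0 hd1 (i0.1.comp_mul_left' hp)
    ((i1.1.comp_mul_left' hp).smul (2 * Real.pi))
    (((i2.1.comp_mul_left' hp).smul (2 * Real.pi)).smul (2 * Real.pi)) hm
  have hform : ∀ u : ℝ, FourierTransform.fourier f u =
        (2 * Real.pi)⁻¹ * ∫ y : ℝ, Complex.exp (-(Complex.I * y * u)) * F y := by
    intro u
    rw [Real.fourier_eq']
    have := Measure.integral_comp_mul_left
      (fun y : ℝ => Complex.exp (-(Complex.I * y * u)) * F y) (2 * Real.pi)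
    rw [abs_of_pos (by positivity)] at this
    rw [← Complex.real_smul, ← this]
    congr 1; ext x
    simp only [f, smul_eq_mul]
    congr 2
    simp; ring
  -- Hermitian symmetry of `F` makes its inverse transform real, so taking the real part loses
  -- nothing.
  have hreal : ∀ u : ℝ, starRingEnd ℂ (FourierTransform.fourier f u) =
      FourierTransform.fourier f u := by
    intro u
    rw [hform]
    simp only [map_mul, Complex.conj_ofReal]
    congr 1
    rw [← integral_conj, ← integral_neg_eq_self]
    congr 1; ext y
    rw [map_mul, ← hs, ← Complex.exp_conj]
    simp
  have hre : ∀ u, (((FourierTransform.fourier f u).re : ℝ) : ℂ) = FourierTransform.fourier f u :=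
    fun u => Complex.conj_eq_iff_re.1 (hreal u)
  refine ⟨fun u => (FourierTransform.fourier f u).re, Complex.continuous_re.comp k1, k2.re,
    k3.re, ?_, fun y => ?_, fun u => ?_⟩
  · refine k4.mono' (continuous_abs.mul (Complex.continuous_re.comp k1)).aestronglyMeasurable
      (Filter.Eventually.of_forall fun u => ?_)
    rw [norm_mul, Real.norm_eq_abs, abs_abs, Real.norm_eq_abs]
    gcongr
    exact Complex.abs_re_le_norm _
  · simp only [hre]
    have hfc : Continuous f := continuous_iff_continuousAt.2 fun x => (hd0 x).continuousAt
    have := congrFun (hfc.fourierInv_fourier_eq (i0.1.comp_mul_left' hp) k2) ((2 * Real.pi)⁻¹ * y)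
    rw [Real.fourierInv_eq'] at this
    simp only [hf] at this
    rw [mul_inv_cancel_left₀ hp] at this
    rw [← this]
    congr 1; ext u
    simp only [smul_eq_mul]
    congr 2
    have : (Real.pi : ℂ) ≠ 0 := by exact_mod_cast Real.pi_ne_zero
    simp; field_simp
  · simp only [hre]; rw [hform]

/-- A real integrable function whose Fourier transform vanishes is zero almost everywhere. -/
lemma ae_eq_zero_of_fourier_eq_zero {f : ℝ → ℝ} (hf : Integrable f)
    (h : ∀ y : ℝ, ∫ u : ℝ, Complex.exp (Complex.I * y * u) * (f u : ℂ) = 0) : f =ᵐ[volume] 0 := by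
  have key : ∀ f : ℝ → ℝ, Integrable f → ∀ y : ℝ,
      charFun (volume.withDensity fun u => ENNReal.ofReal (f u)) y =
        ∫ u : ℝ, Complex.exp (Complex.I * y * u) * (max (f u) 0 : ℝ) := by
    intro f hf y
    rw [charFun_apply_real, integral_withDensity_eq_integral_toReal_smul₀
      hf.1.aemeasurable.ennreal_ofReal (Filter.Eventually.of_forall fun _ => ENNReal.ofReal_lt_top)]
    congr 1; ext u
    rw [ENNReal.toReal_ofReal', Complex.real_smul, mul_comm]
    congr 2; ring
  have hb : ∀ f : ℝ → ℝ, Integrable f → ∀ y : ℝ,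
      Integrable fun u : ℝ => Complex.exp (Complex.I * y * u) * (f u : ℂ) := by
    intro f hf y
    refine hf.ofReal.bdd_mul (c := 1) (by fun_prop) (Filter.Eventually.of_forall fun u => ?_)
    rw [show Complex.I * y * u = ((y * u : ℝ) : ℂ) * Complex.I by push_cast; ring,
      Complex.norm_exp_ofReal_mul_I]
  have hfin : ∀ f : ℝ → ℝ, Integrable f →
      IsFiniteMeasure (volume.withDensity fun u => ENNReal.ofReal (f u)) := fun f hf =>
    isFiniteMeasure_withDensity_ofReal hf.2
  have := hfin f hf
  have := hfin _ hf.neg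
  -- The measures with densities f⁺ and f⁻ have the same characteristic function, because the
  -- difference of the two is the vanishing transform of `f`; hence they coincide and f⁺ = f⁻ almost
  -- everywhere.
  have he : (volume.withDensity fun u => ENNReal.ofReal (f u)) =
      volume.withDensity fun u => ENNReal.ofReal ((-f) u) := by
    refine Measure.ext_of_charFun (funext fun y => ?_)
    rw [key f hf, key _ hf.neg, ← sub_eq_zero, ← integral_sub (hb _ hf.pos_part y)
      (hb _ hf.neg.pos_part y), ← h y]
    congr 1; ext u
    rw [← mul_sub, ← Complex.ofReal_sub]
    congr 2
    simp only [Pi.neg_apply]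
    rcases le_total (f u) 0 with h | h
    · rw [max_eq_right h, max_eq_left (by linarith)]; ring
    · rw [max_eq_left h, max_eq_right (by linarith)]; ring
  rw [withDensity_eq_iff hf.1.aemeasurable.ennreal_ofReal
    hf.neg.1.aemeasurable.ennreal_ofReal (by
      rw [← withDensity_apply _ MeasurableSet.univ |>.trans (setLIntegral_univ _)]
      exact measure_ne_top _ _)] at he
  filter_upwards [he] with u hu
  simp only [Pi.neg_apply, Pi.zero_apply] at hu ⊢
  rcases le_total (f u) 0 with h | h
  · rw [ENNReal.ofReal_of_nonpos h, eq_comm, ENNReal.ofReal_eq_zero] at hu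
    linarith
  · rw [ENNReal.ofReal_of_nonpos (p := -f u) (by linarith), ENNReal.ofReal_eq_zero] at hu
    linarith

/-! ### The characteristic matrix on the closed left half-plane -/

section Laplace
variable {ι : Type*} {η : MatrixMeasure ι}

lemma ae_nonneg (hη : ConcentratedOnNonneg η) (a b : ι) :
    ∀ᵐ u ∂(η a b).totalVariation, 0 ≤ u := by
  have h : (Set.Iio (0 : ℝ))ᶜ ∈ ae (η a b).totalVariation := by
    rw [mem_ae_iff, compl_compl]; exact hη a b
  exact Filter.mem_of_superset h fun u hu => by simpa using hu

lemma norm_cexp_mul_le_one {z : ℂ} (hz : z.re ≤ 0) {u : ℝ} (hu : 0 ≤ u) :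
    ‖Complex.exp (z * u)‖ ≤ 1 := by
  rw [Complex.norm_exp]
  simpa using mul_nonpos_of_nonpos_of_nonneg hz hu

lemma integrable_cexp_mul (hη : ConcentratedOnNonneg η) (a b : ι) {z : ℂ} (hz : z.re ≤ 0) :
    Integrable (fun u : ℝ => Complex.exp (z * u)) (η a b).totalVariation :=
  (integrable_const (1 : ℝ)).mono' (by fun_prop)
    ((ae_nonneg hη a b).mono fun _ hu => norm_cexp_mul_le_one hz hu)

lemma norm_laplace_le (hη : ConcentratedOnNonneg η) (a b : ι) {z : ℂ} (hz : z.re ≤ 0) :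
    ‖laplace η z a b‖ ≤ (η a b).totalVariation.real Set.univ := by
  refine (norm_sIntegral_le (integrable_cexp_mul hη a b hz)).trans ?_
  refine (integral_mono_ae (integrable_cexp_mul hη a b hz).norm (integrable_const 1)
    ((ae_nonneg hη a b).mono fun _ hu => norm_cexp_mul_le_one hz hu)).trans_eq ?_
  simp

lemma continuousOn_laplace (hη : ConcentratedOnNonneg η) (a b : ι) :
    ContinuousOn (fun z => laplace η z a b) {z | z.re ≤ 0} := by
  have : ∀ z ∈ {z : ℂ | z.re ≤ 0}, laplace η z a b =
      ∫ u, polarSign (η a b) u • Complex.exp (z * u) ∂(η a b).totalVariation :=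
    fun z hz => sIntegral_eq (integrable_cexp_mul hη a b hz)
  refine ContinuousOn.congr ?_ this
  refine continuousOn_of_dominated (bound := fun _ => 1) (fun z hz =>
    (integrable_polarSign_smul (integrable_cexp_mul hη a b hz)).1)
    (fun z hz => (ae_nonneg hη a b).mono fun u hu => ?_) (integrable_const _)
    (Filter.Eventually.of_forall fun u => by fun_prop)
  rw [norm_polarSign_smul]
  exact norm_cexp_mul_le_one hz hu

/-- Each Jordan part contributes a complex moment generating function, holomorphic over the interior
of its integrability set; for a finite measure on [0, ∞) that interior contains (-∞, 0). -/
lemma differentiableOn_laplace (hη : ConcentratedOnNonneg η) (a b : ι) :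
    DifferentiableOn ℂ (fun z => laplace η z a b) {z | z.re < 0} := by
  have key : ∀ ν : Measure ℝ, (∀ᵐ u ∂ν, 0 ≤ u) → IsFiniteMeasure ν →
      DifferentiableOn ℂ (ProbabilityTheory.complexMGF id ν) {z | z.re < 0} := by
    intro ν hν _
    refine ProbabilityTheory.differentiableOn_complexMGF.mono fun z hz => ?_
    refine interior_mono (s := Set.Iio 0) (fun t ht => ?_) (by rwa [interior_Iio])
    refine (integrable_const (1 : ℝ)).mono' (by fun_prop) (hν.mono fun u hu => ?_)
    rw [Real.norm_of_nonneg (Real.exp_nonneg _)]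
    simpa using mul_nonpos_of_nonpos_of_nonneg (le_of_lt ht) hu
  have h := ae_nonneg hη a b
  unfold SignedMeasure.totalVariation at h
  rw [ae_add_measure_iff] at h
  exact (key _ h.1 inferInstance).sub (key _ h.2 inferInstance)

/-- The `k`-th derivative of the Fourier transform of the entries. -/
def fourierDeriv (η : MatrixMeasure ι) (k : ℕ) (y : ℝ) : Matrix ι ι ℂ :=
  Matrix.of fun a b => sIntegral (η a b) fun u : ℝ =>
    (Complex.I * u) ^ k * Complex.exp (Complex.I * y * u)

lemma norm_cexp_I_mul (y u : ℝ) : ‖Complex.exp (Complex.I * y * u)‖ = 1 := by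
  rw [show Complex.I * y * u = ((y * u : ℝ) : ℂ) * Complex.I by push_cast; ring,
      Complex.norm_exp_ofReal_mul_I]

lemma norm_fourierDeriv_integrand (k : ℕ) (y u : ℝ) :
    ‖(Complex.I * u) ^ k * Complex.exp (Complex.I * y * u)‖ = |u| ^ k := by
  rw [norm_mul, norm_cexp_I_mul, norm_pow, norm_mul]; simp

lemma HasMoment.mono {k l : ℕ} (h : HasMoment η l) (hkl : k ≤ l) : HasMoment η k := by
  intro a b
  refine ((integrable_const (1 : ℝ)).add (h a b)).mono' (by fun_prop)
    (Filter.Eventually.of_forall fun u => ?_)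
  rw [Real.norm_of_nonneg (by positivity)]
  simp only [Pi.add_apply]
  rcases le_total |u| 1 with hu | hu
  · have := pow_le_one₀ (n := k) (abs_nonneg u) hu
    have : 0 ≤ |u| ^ l := by positivity
    linarith
  · have := pow_le_pow_right₀ hu hkl
    linarith

lemma integrable_fourierDeriv_integrand {k : ℕ} (h : HasMoment η k) (a b : ι) (y : ℝ) :
    Integrable (fun u : ℝ => (Complex.I * u) ^ k * Complex.exp (Complex.I * y * u))
      (η a b).totalVariation :=
  (h a b).mono' (by fun_prop)
    (Filter.Eventually.of_forall fun u => (norm_fourierDeriv_integrand k y u).le)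

lemma norm_fourierDeriv_le {k : ℕ} (h : HasMoment η k) (a b : ι) (y : ℝ) :
    ‖fourierDeriv η k y a b‖ ≤ ∫ u, |u| ^ k ∂(η a b).totalVariation := by
  refine (norm_sIntegral_le (integrable_fourierDeriv_integrand h a b y)).trans_eq ?_
  simp only [norm_fourierDeriv_integrand]

lemma fourierDeriv_eq {k : ℕ} (h : HasMoment η k) (a b : ι) (y : ℝ) :
    fourierDeriv η k y a b = ∫ u, polarSign (η a b) u •
      ((Complex.I * u) ^ k * Complex.exp (Complex.I * y * u)) ∂(η a b).totalVariation :=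
  sIntegral_eq (integrable_fourierDeriv_integrand h a b y)

lemma continuous_fourierDeriv {k : ℕ} (h : HasMoment η k) (a b : ι) :
    Continuous fun y => fourierDeriv η k y a b := by
  simp only [fourierDeriv_eq h]
  refine continuous_of_dominated (bound := fun u => |u| ^ k) (fun y =>
    (integrable_polarSign_smul (integrable_fourierDeriv_integrand h a b y)).1)
    (fun y => Filter.Eventually.of_forall fun u => ?_) (h a b)
    (Filter.Eventually.of_forall fun u => by fun_prop)
  rw [norm_polarSign_smul, norm_fourierDeriv_integrand]

/-- Differentiation under the integral sign, dominated by |u|^(k+1): each derivative consumes one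
moment. -/
lemma hasDerivAt_fourierDeriv {k : ℕ} (h : HasMoment η (k + 1)) (a b : ι) (y : ℝ) :
    HasDerivAt (fun y => fourierDeriv η k y a b) (fourierDeriv η (k + 1) y a b) y := by
  have hk : HasMoment η k := h.mono k.le_succ
  have hd : ∀ u y : ℝ, HasDerivAt (fun y : ℝ => polarSign (η a b) u •
      ((Complex.I * u) ^ k * Complex.exp (Complex.I * y * u))) (polarSign (η a b) u •
      ((Complex.I * u) ^ (k + 1) * Complex.exp (Complex.I * y * u))) y := by
    intro u y
    have h1 : HasDerivAt (fun y : ℝ => Complex.I * y * u) (Complex.I * u) y := by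
      simpa using ((hasDerivAt_id y).ofReal_comp.const_mul Complex.I).mul_const (u : ℂ)
    have h2 := ((h1.cexp).const_mul ((Complex.I * u) ^ k)).const_smul (polarSign (η a b) u)
    rwa [show (Complex.I * u) ^ k * (Complex.exp (Complex.I * y * u) * (Complex.I * u)) =
      (Complex.I * u) ^ (k + 1) * Complex.exp (Complex.I * y * u) by rw [pow_succ]; ring] at h2
  have := (hasDerivAt_integral_of_dominated_loc_of_deriv_le
    (μ := (η a b).totalVariation) (x₀ := y)
    (F := fun (y : ℝ) u => polarSign (η a b) u •
      ((Complex.I * u) ^ k * Complex.exp (Complex.I * y * u)))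
    (F' := fun (y : ℝ) u => polarSign (η a b) u •
      ((Complex.I * u) ^ (k + 1) * Complex.exp (Complex.I * y * u)))
    (bound := fun u => |u| ^ (k + 1))
    (s := Set.univ) Filter.univ_mem
    (Filter.Eventually.of_forall fun y =>
      (integrable_polarSign_smul (integrable_fourierDeriv_integrand hk a b y)).1)
    (integrable_polarSign_smul (integrable_fourierDeriv_integrand hk a b y))
    (integrable_polarSign_smul (integrable_fourierDeriv_integrand h a b y)).1
    (Filter.Eventually.of_forall fun u y _ => by
      rw [norm_polarSign_smul, norm_fourierDeriv_integrand]) (h a b)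
    (Filter.Eventually.of_forall fun u y _ => hd u y)).2
  rw [← fourierDeriv_eq h] at this
  exact this.congr_of_eventuallyEq (Filter.Eventually.of_forall fun y => fourierDeriv_eq hk a b y)

lemma fourierDeriv_zero (y : ℝ) : fourierDeriv η 0 y = laplace η (Complex.I * y) := by
  ext a b; simp [fourierDeriv, laplace]

end Laplace

/-! ### Calculus and estimates for matrix functions, entry by entry -/

section Entrywise
variable {ι : Type*} [Fintype ι]

lemma hasDerivAt_matrix_mul {A B : ℝ → Matrix ι ι ℂ} {A' B' : Matrix ι ι ℂ} {y : ℝ}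
    (hA : ∀ a b, HasDerivAt (fun y => A y a b) (A' a b) y)
    (hB : ∀ a b, HasDerivAt (fun y => B y a b) (B' a b) y) (a b : ι) :
    HasDerivAt (fun y => (A y * B y) a b) ((A' * B y + A y * B') a b) y := by
  simp only [Matrix.add_apply, Matrix.mul_apply, ← Finset.sum_add_distrib]
  exact HasDerivAt.fun_sum fun c _ => (hA a c).mul (hB c b)

lemma norm_matrix_mul_le {A B : Matrix ι ι ℂ} {α β : ℝ} (hA : ∀ a b, ‖A a b‖ ≤ α)
    (hB : ∀ a b, ‖B a b‖ ≤ β) (a b : ι) : ‖(A * B) a b‖ ≤ Fintype.card ι * (α * β) := by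
  rw [Matrix.mul_apply]
  refine (norm_sum_le _ _).trans ((Finset.sum_le_sum fun c _ => (norm_mul_le _ _).trans
    (mul_le_mul (hA a c) (hB c b) (norm_nonneg _) ((norm_nonneg _).trans (hA a c)))).trans_eq ?_)
  simp

variable [DecidableEq ι]

/-- The identity A(x)⁻¹ - A(y)⁻¹ = -A(x)⁻¹ (A(x) - A(y)) A(y)⁻¹ is read entry by entry in the
difference quotient, with continuity of the inverse as input. -/
lemma hasDerivAt_matrix_inv {A : ℝ → Matrix ι ι ℂ} {A' : Matrix ι ι ℂ} {y : ℝ}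
    (hA : ∀ a b, HasDerivAt (fun y => A y a b) (A' a b) y) (hdet : ∀ y, (A y).det ≠ 0)
    (hc : ∀ a b, ContinuousAt (fun y => (A y)⁻¹ a b) y) (a b : ι) :
    HasDerivAt (fun y => (A y)⁻¹ a b) ((-((A y)⁻¹ * A' * (A y)⁻¹)) a b) y := by
  rw [hasDerivAt_iff_tendsto_slope]
  have h1 : ∀ x, slope (fun y => (A y)⁻¹ a b) y x =
      -∑ d, (∑ c, (A x)⁻¹ a c * slope (fun y => A y c d) y x) * (A y)⁻¹ d b := by
    intro x
    have h2 : (A x)⁻¹ - (A y)⁻¹ = -((A x)⁻¹ * (A x - A y) * (A y)⁻¹) := by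
      rw [mul_sub, Matrix.nonsing_inv_mul _ (isUnit_iff_ne_zero.2 (hdet x)), sub_mul, one_mul,
        mul_assoc, Matrix.mul_nonsing_inv _ (isUnit_iff_ne_zero.2 (hdet y)), mul_one, neg_sub]
    have h3 := congrFun (congrFun h2 a) b
    simp only [Matrix.sub_apply, Matrix.neg_apply, Matrix.mul_apply] at h3
    simp only [slope, vsub_eq_sub]
    rw [h3, smul_neg, Finset.smul_sum]
    congr 1
    refine Finset.sum_congr rfl fun d _ => ?_
    rw [← smul_mul_assoc, Finset.smul_sum]
    congr 1
    refine Finset.sum_congr rfl fun c _ => ?_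
    rw [mul_smul_comm]
  refine Filter.Tendsto.congr (fun x => (h1 x).symm) ?_
  simp only [Matrix.neg_apply, Matrix.mul_apply]
  refine Filter.Tendsto.neg (tendsto_finsetSum _ fun d _ => Filter.Tendsto.mul_const _
    (tendsto_finsetSum _ fun c _ => Filter.Tendsto.mul ?_ ?_))
  · exact (hc a c).tendsto.mono_left nhdsWithin_le_nhds
  · exact hasDerivAt_iff_tendsto_slope.1 (hA c d)

/-- A matrix function `(-z - N(z))⁻¹` with continuous bounded `N` decays like `1/(1 + |z|)` on a
closed set on which it is defined. -/
lemma exists_bound_inv {S : Set ℂ} (hS : IsClosed S) {N : ℂ → Matrix ι ι ℂ} {B : ℝ}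
    (hN : ∀ a b, ContinuousOn (fun z => N z a b) S) (hB : ∀ z ∈ S, ∀ a b, ‖N z a b‖ ≤ B)
    (hdet : ∀ z ∈ S, (-(z • (1 : Matrix ι ι ℂ)) - N z).det ≠ 0) :
    (∀ a b, ContinuousOn (fun z => (-(z • (1 : Matrix ι ι ℂ)) - N z)⁻¹ a b) S) ∧
    ∃ C, 0 ≤ C ∧ ∀ z ∈ S, ∀ a b,
      ‖(-(z • (1 : Matrix ι ι ℂ)) - N z)⁻¹ a b‖ ≤ C * (1 + ‖z‖)⁻¹ := by
  set H : ℂ → Matrix ι ι ℂ := fun z => -(z • (1 : Matrix ι ι ℂ)) - N z with hH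
  have hHc : ContinuousOn H S := by
    refine continuousOn_pi.2 fun a => continuousOn_pi.2 fun b => ?_
    simp only [hH, Matrix.sub_apply, Matrix.neg_apply, Matrix.smul_apply]
    exact ((continuousOn_id.smul continuousOn_const).neg).sub (hN a b)
  have hdc : ContinuousOn (fun z => (H z).det) S := by
    rw [continuousOn_iff_continuous_domRestrict] at hHc ⊢
    exact hHc.matrix_det
  have hac : ContinuousOn (fun z => (H z).adjugate) S := by
    rw [continuousOn_iff_continuous_domRestrict] at hHc ⊢
    exact hHc.matrix_adjugate
  have hKc : ∀ a b, ContinuousOn (fun z => (H z)⁻¹ a b) S := by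
    intro a b
    simp only [Matrix.inv_def, Matrix.smul_apply, Ring.inverse_eq_inv', smul_eq_mul]
    exact (hdc.inv₀ hdet).mul (continuousOn_pi.1 (continuousOn_pi.1 hac a) b)
  refine ⟨hKc, ?_⟩
  set s : ℂ → ℝ := fun z => ∑ a, ∑ b, ‖(H z)⁻¹ a b‖ with hs
  have hsc : ContinuousOn s S :=
    continuousOn_finsetSum _ fun a _ => continuousOn_finsetSum _ fun b _ => (hKc a b).norm
  have hs0 : ∀ z, 0 ≤ s z := fun z => Finset.sum_nonneg fun a _ =>
    Finset.sum_nonneg fun b _ => norm_nonneg _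
  set c : ℝ := (Fintype.card ι : ℝ) with hcdef
  have hc0 : 0 ≤ c := Nat.cast_nonneg _
  -- From H⁻¹H = 1 one gets z H⁻¹ = -(1 + H⁻¹N); summing the norms of all entries gives this.
  have hmain : ∀ z ∈ S, ‖z‖ * s z ≤ c + c * |B| * s z := by
    intro z hz
    have h1 : (H z)⁻¹ * H z = 1 := Matrix.nonsing_inv_mul _ (isUnit_iff_ne_zero.2 (hdet z hz))
    have h2 : z • (H z)⁻¹ = -(1 + (H z)⁻¹ * N z) := by
      rw [← h1]; simp only [hH]; rw [mul_sub, mul_neg, mul_smul_comm, mul_one]; abel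
    have h3 : ∀ a b, ‖z‖ * ‖(H z)⁻¹ a b‖ ≤
        ‖(1 : Matrix ι ι ℂ) a b‖ + ∑ d, ‖(H z)⁻¹ a d‖ * |B| := by
      intro a b
      have h4 := congrFun (congrFun h2 a) b
      rw [Matrix.smul_apply, Matrix.neg_apply, Matrix.add_apply, Matrix.mul_apply] at h4
      rw [← norm_mul, ← smul_eq_mul, h4, norm_neg]
      refine (norm_add_le _ _).trans (add_le_add le_rfl ((norm_sum_le _ _).trans
        (Finset.sum_le_sum fun d _ => ?_)))
      rw [norm_mul]
      exact mul_le_mul_of_nonneg_left ((hB z hz d b).trans (le_abs_self B)) (norm_nonneg _)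
    calc ‖z‖ * s z = ∑ a, ∑ b, ‖z‖ * ‖(H z)⁻¹ a b‖ := by simp only [hs, Finset.mul_sum]
      _ ≤ ∑ a, ∑ b, (‖(1 : Matrix ι ι ℂ) a b‖ + ∑ d, ‖(H z)⁻¹ a d‖ * |B|) :=
        Finset.sum_le_sum fun a _ => Finset.sum_le_sum fun b _ => h3 a b
      _ = c + c * |B| * s z := by
        simp only [Finset.sum_add_distrib, ← Finset.sum_mul]
        congr 1
        · have : ∀ a b : ι, ‖(1 : Matrix ι ι ℂ) a b‖ = if a = b then 1 else 0 := fun a b => by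
            rw [Matrix.one_apply]; split_ifs <;> simp
          simp [this, hcdef]
        · simp only [Finset.sum_const, Finset.card_univ, nsmul_eq_mul, hs, ← Finset.mul_sum,
            ← hcdef]
          ring
  -- Inside this radius compactness bounds `s`. Outside it c|B| ≤ (‖z‖ - 1)/2, so the last term of
  -- `hmain` is absorbed on the left.
  obtain ⟨D, hD⟩ := ((isCompact_closedBall (0 : ℂ) (2 * c * |B| + 1)).inter_left hS
    ).exists_bound_of_continuousOn (hsc.mono Set.inter_subset_left)
  refine ⟨|D| * (2 * c * |B| + 2) + 4 * c, by positivity, fun z hz a b => ?_⟩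
  have hle : ‖(H z)⁻¹ a b‖ ≤ s z :=
    (Finset.single_le_sum (f := fun b => ‖(H z)⁻¹ a b‖) (fun b _ => norm_nonneg _)
      (Finset.mem_univ b)).trans
    (Finset.single_le_sum (f := fun a => ∑ b, ‖(H z)⁻¹ a b‖)
      (fun a _ => Finset.sum_nonneg fun b _ => norm_nonneg _) (Finset.mem_univ a))
  refine hle.trans ?_
  rw [← div_eq_mul_inv, le_div_iff₀ (by positivity)]
  have hcB : 0 ≤ c * |B| := by positivity
  rcases le_total ‖z‖ (2 * c * |B| + 1) with h | h
  · have h5 := hD z ⟨hz, by simpa using h⟩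
    rw [Real.norm_of_nonneg (hs0 z)] at h5
    have h6 : s z * (1 + ‖z‖) ≤ |D| * (2 * c * |B| + 2) :=
      mul_le_mul (h5.trans (le_abs_self D)) (by linarith) (by positivity) (abs_nonneg D)
    linarith
  · have h7 := hmain z hz
    have h8 : c * |B| * s z ≤ (‖z‖ - 1) / 2 * s z :=
      mul_le_mul_of_nonneg_right (by linarith) (hs0 z)
    have h9 : 0 ≤ |D| * (2 * c * |B| + 2) := by positivity
    nlinarith [hs0 z]

end Entrywise

/-! ### The kernel -/

section Kernel
variable {ι : Type*} {η : MatrixMeasure ι}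

lemma isClosed_re_nonpos : IsClosed {z : ℂ | z.re ≤ 0} :=
  isClosed_le Complex.continuous_re continuous_const

lemma conj_laplace (z : ℂ) (a b : ι) :
    laplace η (starRingEnd ℂ z) a b = starRingEnd ℂ (laplace η z a b) := by
  simp only [laplace, Matrix.of_apply, sIntegral, map_sub, ← integral_conj, ← Complex.exp_conj,
    map_mul, Complex.conj_ofReal]

variable [Fintype ι]

lemma exists_laplace_bound (hη : ConcentratedOnNonneg η) :
    ∃ B : ℝ, ∀ z : ℂ, z.re ≤ 0 → ∀ a b, ‖laplace η z a b‖ ≤ B := by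
  refine ⟨∑ a, ∑ b, (η a b).totalVariation.real Set.univ, fun z hz a b =>
    (norm_laplace_le hη a b hz).trans ?_⟩
  exact (Finset.single_le_sum (f := fun b => (η a b).totalVariation.real Set.univ)
      (fun b _ => measureReal_nonneg) (Finset.mem_univ b)).trans
    (Finset.single_le_sum (f := fun a => ∑ b, (η a b).totalVariation.real Set.univ)
      (fun a _ => Finset.sum_nonneg fun b _ => measureReal_nonneg) (Finset.mem_univ a))

variable [DecidableEq ι]

lemma exists_charMatrix_inv_bound (hη : ConcentratedOnNonneg η) {S : Set ℂ} (hS : IsClosed S)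
    (hS0 : S ⊆ {z | z.re ≤ 0}) (hdet : ∀ z ∈ S, (charMatrix η z).det ≠ 0) :
    (∀ a b, ContinuousOn (fun z => (charMatrix η z)⁻¹ a b) S) ∧
    ∃ C, 0 ≤ C ∧ ∀ z ∈ S, ∀ a b, ‖(charMatrix η z)⁻¹ a b‖ ≤ C * (1 + ‖z‖)⁻¹ := by
  obtain ⟨B, hB⟩ := exists_laplace_bound hη
  exact exists_bound_inv hS (fun a b => (continuousOn_laplace hη a b).mono hS0)
    (fun z hz => hB z (hS0 hz)) hdet

/-- The inverse of the characteristic matrix minus the transform of `u ↦ e^{-u} 1_{u ≥ 0} I`. -/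
def charRemainder (η : MatrixMeasure ι) (z : ℂ) : Matrix ι ι ℂ :=
  (charMatrix η z)⁻¹ - (1 - z)⁻¹ • (1 : Matrix ι ι ℂ)

lemma one_sub_ne_zero {z : ℂ} (hz : z.re ≤ 0) : 1 - z ≠ 0 := by
  intro h
  have := congrArg Complex.re h
  simp at this
  linarith

lemma norm_inv_one_sub_le {z : ℂ} (hz : z.re ≤ 0) : ‖(1 - z)⁻¹‖ ≤ 2 * (1 + ‖z‖)⁻¹ := by
  rw [norm_inv, ← one_div, ← div_eq_mul_inv, div_le_div_iff₀
    (norm_pos_iff.2 (one_sub_ne_zero hz)) (by positivity), one_mul]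
  have h1 : 1 ≤ ‖1 - z‖ := by
    refine le_trans ?_ (Complex.re_le_norm _)
    simp; linarith
  have h2 : ‖z‖ ≤ ‖1 - z‖ := by
    rw [Complex.norm_eq_sqrt_sq_add_sq, Complex.norm_eq_sqrt_sq_add_sq]
    apply Real.sqrt_le_sqrt
    simp
    nlinarith
  linarith

/-- Both h(z)⁻¹ and (1 - z)⁻¹ I behave like -z⁻¹ I at infinity. Writing 1 + L[η] = (1 - z) I - h
exhibits their difference as a product with two factors of order 1/|z|. -/
lemma charRemainder_eq {z : ℂ} (hz : z.re ≤ 0) (hdet : (charMatrix η z).det ≠ 0) :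
    charRemainder η z = (1 - z)⁻¹ • ((charMatrix η z)⁻¹ * (1 + laplace η z)) := by
  have h1 : (charMatrix η z)⁻¹ * charMatrix η z = 1 :=
    Matrix.nonsing_inv_mul _ (isUnit_iff_ne_zero.2 hdet)
  have h2 : (1 : Matrix ι ι ℂ) + laplace η z = (1 - z) • 1 - charMatrix η z := by
    rw [charMatrix, sub_smul, one_smul]; abel
  rw [h2, mul_sub, h1, smul_sub, mul_smul_comm, mul_one, smul_smul,
    inv_mul_cancel₀ (one_sub_ne_zero hz), one_smul, charRemainder]

lemma exists_charRemainder_bound (hη : ConcentratedOnNonneg η) {S : Set ℂ} (hS : IsClosed S)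
    (hS0 : S ⊆ {z | z.re ≤ 0}) (hdet : ∀ z ∈ S, (charMatrix η z).det ≠ 0) :
    ∃ C, 0 ≤ C ∧ ∀ z ∈ S, ∀ a b, ‖charRemainder η z a b‖ ≤ C * (1 + ‖z‖)⁻¹ ^ 2 := by
  obtain ⟨B, hB⟩ := exists_laplace_bound hη
  obtain ⟨-, C, hC0, hC⟩ := exists_charMatrix_inv_bound hη hS hS0 hdet
  refine ⟨2 * (Fintype.card ι * (C * (1 + |B|))), by positivity, fun z hz a b => ?_⟩
  rw [charRemainder_eq (hS0 hz) (hdet z hz), Matrix.smul_apply, norm_smul]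
  have h1 : ∀ a b, ‖(1 + laplace η z) a b‖ ≤ 1 + |B| := fun a b => by
    refine (norm_add_le _ _).trans (add_le_add ?_ ((hB z (hS0 hz) a b).trans (le_abs_self B)))
    rw [Matrix.one_apply]; split_ifs <;> simp
  refine (mul_le_mul (norm_inv_one_sub_le (hS0 hz)) (norm_matrix_mul_le (hC z hz) h1 a b)
    (norm_nonneg _) (by positivity)).trans_eq ?_
  ring

lemma conj_charMatrix_inv {z : ℂ} (hdet : (charMatrix η z).det ≠ 0) :
    (charMatrix η (starRingEnd ℂ z))⁻¹ = (charMatrix η z)⁻¹.map (starRingEnd ℂ) := by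
  have h : charMatrix η (starRingEnd ℂ z) = (charMatrix η z).map (starRingEnd ℂ) := by
    ext a b
    simp only [charMatrix, Matrix.sub_apply, Matrix.neg_apply, Matrix.smul_apply, Matrix.map_apply,
      conj_laplace, map_sub, map_neg, smul_eq_mul, map_mul, Matrix.one_apply]
    split_ifs <;> simp
  refine Matrix.inv_eq_right_inv ?_
  rw [h, ← Matrix.map_mul, Matrix.mul_nonsing_inv _ (isUnit_iff_ne_zero.2 hdet),
    Matrix.map_one _ (map_zero _) (map_one _)]

lemma norm_I_mul_ofReal (y : ℝ) : ‖Complex.I * (y : ℂ)‖ = |y| := by simp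

lemma I_mul_ofReal_re (y : ℝ) : (Complex.I * (y : ℂ)).re = 0 := by simp

lemma sq_inv_one_add_abs_le (y : ℝ) : (1 + |y|)⁻¹ ^ 2 ≤ (1 + y ^ 2)⁻¹ := by
  rw [inv_pow]
  refine inv_anti₀ (by positivity) ?_
  nlinarith [sq_abs y, abs_nonneg y]

/-- Along the imaginary axis the derivatives of K = h⁻¹ are sums of products with at least two
factors K and otherwise bounded factors, controlled by the first two moments of `η`. The remainder
and its first two derivatives are thus of order 1/y² at infinity, as `exists_fourier_preimage`
requires. -/
lemma charRemainder_fourier_preimage (hη : ConcentratedOnNonneg η) (hm : HasMoment η 2)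
    (hdet : ∀ y : ℝ, (charMatrix η (Complex.I * y)).det ≠ 0) (a b : ι) :
    ∃ r : ℝ → ℝ, Continuous r ∧ Integrable r ∧ MemLp r 2 ∧ (Integrable fun u => |u| * r u) ∧
      (∀ y : ℝ, ∫ u : ℝ, Complex.exp (Complex.I * y * u) * (r u : ℂ) =
        charRemainder η (Complex.I * y) a b) ∧
      ∀ u : ℝ, (r u : ℂ) = (2 * Real.pi)⁻¹ *
        ∫ y : ℝ, Complex.exp (-(Complex.I * y * u)) * charRemainder η (Complex.I * y) a b := by
  have hcl : IsClosed {z : ℂ | z.re = 0} := isClosed_eq Complex.continuous_re continuous_const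
  have hsub : {z : ℂ | z.re = 0} ⊆ {z | z.re ≤ 0} := fun z hz => le_of_eq hz
  have hdet' : ∀ z ∈ {z : ℂ | z.re = 0}, (charMatrix η z).det ≠ 0 := by
    intro z hz
    have : z = Complex.I * (z.im : ℝ) := by
      apply Complex.ext <;> simp; exact hz
    rw [this]; exact hdet _
  obtain ⟨hKc, C, hC0, hC⟩ := exists_charMatrix_inv_bound hη hcl hsub hdet'
  obtain ⟨C', hC'0, hC'⟩ := exists_charRemainder_bound hη hcl hsub hdet'
  have hmem : ∀ y : ℝ, Complex.I * (y : ℂ) ∈ {z : ℂ | z.re = 0} := I_mul_ofReal_re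
  have hmem' : ∀ y : ℝ, (Complex.I * (y : ℂ)).re ≤ 0 := fun y => (I_mul_ofReal_re y).le
  set K : ℝ → Matrix ι ι ℂ := fun y => (charMatrix η (Complex.I * y))⁻¹ with hK
  set H1 : ℝ → Matrix ι ι ℂ := fun y =>
    -(Complex.I • (1 : Matrix ι ι ℂ)) - fourierDeriv η 1 y with hH1
  set H2 : ℝ → Matrix ι ι ℂ := fun y => -fourierDeriv η 2 y with hH2
  have hm0 : HasMoment η 0 := hm.mono (by norm_num)
  have hm1 : HasMoment η 1 := hm.mono (by norm_num)
  have hKcont : ∀ a b, Continuous fun y => K y a b := fun a b =>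
    (hKc a b).comp_continuous (f := fun y : ℝ => Complex.I * (y : ℂ)) (by fun_prop) hmem
  have dH : ∀ y a b, HasDerivAt (fun y : ℝ => charMatrix η (Complex.I * y) a b) (H1 y a b) y := by
    intro y a b
    simp only [charMatrix, ← fourierDeriv_zero, Matrix.sub_apply, Matrix.neg_apply,
      Matrix.smul_apply, hH1]
    refine HasDerivAt.sub (HasDerivAt.neg ?_) (hasDerivAt_fourierDeriv hm1 a b y)
    have : HasDerivAt (fun y : ℝ => Complex.I * (y : ℂ)) Complex.I y := by
      simpa using (hasDerivAt_id y).ofReal_comp.const_mul Complex.I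
    exact this.mul_const _
  have dH1 : ∀ y a b, HasDerivAt (fun y => H1 y a b) (H2 y a b) y := by
    intro y a b
    simp only [Matrix.sub_apply, Matrix.neg_apply, hH1, hH2]
    exact (hasDerivAt_fourierDeriv hm a b y).const_sub _
  set K1 : ℝ → Matrix ι ι ℂ := fun y => -(K y * H1 y * K y) with hK1
  have dK : ∀ y a b, HasDerivAt (fun y => K y a b) (K1 y a b) y := fun y a b =>
    hasDerivAt_matrix_inv (dH y) hdet (fun a b => (hKcont a b).continuousAt) a b
  set K2 : ℝ → Matrix ι ι ℂ := fun y =>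
    -((K1 y * H1 y + K y * H2 y) * K y + K y * H1 y * K1 y) with hK2
  have dK1 : ∀ y a b, HasDerivAt (fun y => K1 y a b) (K2 y a b) y := fun y a b =>
    (hasDerivAt_matrix_mul (hasDerivAt_matrix_mul (dK y) (dH1 y)) (dK y) a b).neg
  set k : ℝ → ℂ := fun y => (1 - Complex.I * y)⁻¹ with hk
  have dk : ∀ y, HasDerivAt k (Complex.I * k y ^ 2) y := by
    intro y
    have h1 : HasDerivAt (fun y : ℝ => 1 - Complex.I * (y : ℂ)) (-Complex.I) y := by
      simpa using ((hasDerivAt_id y).ofReal_comp.const_mul Complex.I).const_sub 1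
    refine (h1.fun_inv (one_sub_ne_zero (hmem' y))).congr_deriv ?_
    rw [hk, neg_neg, div_eq_mul_inv, inv_pow]
  have dk1 : ∀ y, HasDerivAt (fun y => Complex.I * k y ^ 2) (-2 * k y ^ 3) y := by
    intro y
    refine (((dk y).fun_pow 2).const_mul Complex.I).congr_deriv ?_
    push_cast
    linear_combination (2 * k y ^ 3) * Complex.I_mul_I
  have bK : ∀ y a b, ‖K y a b‖ ≤ C * (1 + |y|)⁻¹ := fun y a b => by
    simpa [norm_I_mul_ofReal] using hC _ (hmem y) a b
  have bk : ∀ y, ‖k y‖ ≤ 2 * (1 + |y|)⁻¹ := fun y => by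
    simpa only [norm_I_mul_ofReal] using norm_inv_one_sub_le (hmem' y)
  obtain ⟨B, hB0, hB1, hB2⟩ : ∃ B : ℝ, 0 ≤ B ∧ (∀ y a b, ‖H1 y a b‖ ≤ B) ∧
      ∀ y a b, ‖H2 y a b‖ ≤ B := by
    have hs : ∀ (j : ℕ) (a b : ι), ∫ u, |u| ^ j ∂(η a b).totalVariation ≤
        ∑ a, ∑ b, ∫ u, |u| ^ j ∂(η a b).totalVariation := fun j a b =>
      have hnn : ∀ a b, 0 ≤ ∫ u, |u| ^ j ∂(η a b).totalVariation := fun a b =>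
        integral_nonneg fun u => by positivity
      (Finset.single_le_sum (f := fun b => ∫ u, |u| ^ j ∂(η a b).totalVariation)
        (fun b _ => hnn a b) (Finset.mem_univ b)).trans
      (Finset.single_le_sum (f := fun a => ∑ b, ∫ u, |u| ^ j ∂(η a b).totalVariation)
        (fun a _ => Finset.sum_nonneg fun b _ => hnn a b) (Finset.mem_univ a))
    have hnn : ∀ j : ℕ, 0 ≤ ∑ a, ∑ b, ∫ u, |u| ^ j ∂(η a b).totalVariation := fun j =>
      Finset.sum_nonneg fun a _ => Finset.sum_nonneg fun b _ =>
        integral_nonneg fun u => by positivity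
    -- The 1 bounds the entries of iI; the sums of first and second absolute moments bound the
    -- derivatives of the transform of `η`.
    refine ⟨1 + (∑ a, ∑ b, ∫ u, |u| ^ 1 ∂(η a b).totalVariation) +
      ∑ a, ∑ b, ∫ u, |u| ^ 2 ∂(η a b).totalVariation, ?_, fun y a b => ?_, fun y a b => ?_⟩
    · have := hnn 1; have := hnn 2; linarith
    · refine (norm_sub_le _ _).trans ?_
      have h1 : ‖(-(Complex.I • (1 : Matrix ι ι ℂ))) a b‖ ≤ 1 := by
        rw [Matrix.neg_apply, norm_neg, Matrix.smul_apply, norm_smul, Complex.norm_I, one_mul,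
          Matrix.one_apply]
        split_ifs <;> simp
      have := (norm_fourierDeriv_le hm1 a b y).trans (hs 1 a b)
      have := hnn 2
      linarith
    · change ‖(-fourierDeriv η 2 y) a b‖ ≤ _
      rw [Matrix.neg_apply, norm_neg]
      have := (norm_fourierDeriv_le hm a b y).trans (hs 2 a b)
      have := hnn 1
      linarith
  set c : ℝ := (Fintype.card ι : ℝ) with hc
  have hc0 : 0 ≤ c := Nat.cast_nonneg _
  have hw0 : ∀ y : ℝ, 0 ≤ (1 + |y|)⁻¹ := fun y => by positivity
  have hw1 : ∀ y : ℝ, (1 + |y|)⁻¹ ≤ 1 := fun y =>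
    inv_le_one_of_one_le₀ (by linarith [abs_nonneg y])
  have bK1 : ∀ y a b, ‖K1 y a b‖ ≤ (c * (c * (C * B) * C)) * (1 + |y|)⁻¹ ^ 2 := by
    intro y a b
    change ‖(-(K y * H1 y * K y)) a b‖ ≤ _
    rw [Matrix.neg_apply, norm_neg]
    refine (norm_matrix_mul_le (norm_matrix_mul_le (bK y) (hB1 y)) (bK y) a b).trans_eq ?_
    rw [← hc]; ring
  set D : ℝ := c * (c * (C * B) * C) with hD
  have hD0 : 0 ≤ D := by positivity
  -- One power of decay of K' may be given away, because every product in K'' that contains K'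
  -- contains a further factor K.
  have bK1' : ∀ y a b, ‖K1 y a b‖ ≤ D * (1 + |y|)⁻¹ := fun y a b =>
    (bK1 y a b).trans (mul_le_mul_of_nonneg_left (by nlinarith [hw0 y, hw1 y]) hD0)
  have bK2 : ∀ y a b, ‖K2 y a b‖ ≤
      (c * (c * (D * B) * C) + D + c * (c * (C * B) * D)) * (1 + |y|)⁻¹ ^ 2 := by
    intro y a b
    change ‖(-((K1 y * H1 y + K y * H2 y) * K y + K y * H1 y * K1 y)) a b‖ ≤ _
    rw [Matrix.neg_apply, norm_neg, add_mul, Matrix.add_apply, Matrix.add_apply]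
    refine (norm_add₃_le).trans ((add_le_add (add_le_add
      (norm_matrix_mul_le (norm_matrix_mul_le (bK1' y) (hB1 y)) (bK y) a b)
      (norm_matrix_mul_le (norm_matrix_mul_le (bK y) (hB2 y)) (bK y) a b))
      (norm_matrix_mul_le (norm_matrix_mul_le (bK y) (hB1 y)) (bK1' y) a b)).trans_eq ?_)
    rw [← hc, hD]; ring
  set δ : ℂ := (1 : Matrix ι ι ℂ) a b with hδ
  have hδ1 : ‖δ‖ ≤ 1 := by rw [hδ, Matrix.one_apply]; split_ifs <;> simp
  have dR : ∀ y : ℝ, HasDerivAt (fun y : ℝ => charRemainder η (Complex.I * y) a b)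
      (K1 y a b - (Complex.I * k y ^ 2) * δ) y := fun y => by
    simp only [charRemainder, Matrix.sub_apply, Matrix.smul_apply]
    exact (dK y a b).sub ((dk y).mul_const δ)
  have dR1 : ∀ y : ℝ, HasDerivAt (fun y : ℝ => K1 y a b - (Complex.I * k y ^ 2) * δ)
      (K2 y a b - (-2 * k y ^ 3) * δ) y := fun y => (dK1 y a b).sub ((dk1 y).mul_const δ)
  have hkc : Continuous k := continuous_iff_continuousAt.2 fun y => (dk y).continuousAt
  have hmulc : ∀ A A' : ℝ → Matrix ι ι ℂ, (∀ a b, Continuous fun y => A y a b) →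
      (∀ a b, Continuous fun y => A' y a b) → ∀ a b, Continuous fun y => (A y * A' y) a b := by
    intro A A' h h' a b
    simp only [Matrix.mul_apply]
    exact continuous_finsetSum _ fun c _ => (h a c).mul (h' c b)
  have hH1c : ∀ a b, Continuous fun y => H1 y a b := fun a b =>
    continuous_iff_continuousAt.2 fun y => (dH1 y a b).continuousAt
  have hK1c : ∀ a b, Continuous fun y => K1 y a b := fun a b =>
    continuous_iff_continuousAt.2 fun y => (dK1 y a b).continuousAt
  have hH2c : ∀ a b, Continuous fun y => H2 y a b := fun a b =>
    (continuous_fourierDeriv hm a b).neg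
  have hK2c : ∀ a b, Continuous fun y => K2 y a b := fun a b => by
    refine Continuous.neg (Continuous.add (hmulc _ _ ?_ hKcont a b)
      (hmulc _ _ (hmulc _ _ hKcont hH1c) hK1c a b))
    exact fun a b => (hmulc _ _ hK1c hH1c a b).add (hmulc _ _ hKcont hH2c a b)
  set E : ℝ := C' + D + (c * (c * (D * B) * C) + D + c * (c * (C * B) * D)) + 16 with hE
  have hE0 : 0 ≤ c * (c * (D * B) * C) + D + c * (c * (C * B) * D) := by positivity
  have hEle : ∀ (y : ℝ) (x : ℂ), ‖x‖ ≤ E * (1 + |y|)⁻¹ ^ 2 → ‖x‖ ≤ E * (1 + y ^ 2)⁻¹ :=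
    fun y x hx => hx.trans (mul_le_mul_of_nonneg_left (sq_inv_one_add_abs_le y)
      (by rw [hE]; positivity))
  refine exists_fourier_preimage (C := E) dR dR1
    ((hK2c a b).sub ((continuous_const.mul (hkc.pow 3)).mul continuous_const))
    (fun y => hEle y _ ?_) (fun y => hEle y _ ?_) (fun y => hEle y _ ?_) fun y => ?_
  · refine (hC' _ (hmem y) a b).trans ?_
    rw [norm_I_mul_ofReal]
    gcongr
    linarith
  · refine (norm_sub_le _ _).trans ?_
    have h1 : ‖Complex.I * k y ^ 2 * δ‖ ≤ 4 * (1 + |y|)⁻¹ ^ 2 := by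
      rw [norm_mul, norm_mul, Complex.norm_I, one_mul, norm_pow]
      have := pow_le_pow_left₀ (norm_nonneg _) (bk y) 2
      nlinarith [norm_nonneg δ, sq_nonneg ‖k y‖]
    have h2 := bK1 y a b
    have h3 : 0 ≤ (1 + |y|)⁻¹ ^ 2 := by positivity
    rw [hE]
    nlinarith
  · refine (norm_sub_le _ _).trans ?_
    have h1 : ‖-2 * k y ^ 3 * δ‖ ≤ 16 * (1 + |y|)⁻¹ ^ 2 := by
      rw [norm_mul, norm_mul, norm_neg, Complex.norm_ofNat, norm_pow]
      have h4 := pow_le_pow_left₀ (norm_nonneg _) (bk y) 3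
      have h5 : 2 * ‖k y‖ ^ 3 * ‖δ‖ ≤ 2 * ‖k y‖ ^ 3 :=
        mul_le_of_le_one_right (by positivity) hδ1
      have h6 : (1 + |y|)⁻¹ ^ 3 ≤ (1 + |y|)⁻¹ ^ 2 := pow_le_pow_of_le_one (hw0 y) (hw1 y) (by norm_num)
      rw [mul_pow] at h4
      linarith
    have h2 := bK2 y a b
    have h3 : 0 ≤ (1 + |y|)⁻¹ ^ 2 := by positivity
    rw [hE]
    nlinarith
  · have h1 : Complex.I * ((-y : ℝ) : ℂ) = starRingEnd ℂ (Complex.I * y) := by simp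
    have h2 := congrFun (congrFun (conj_charMatrix_inv (hdet y)) a) b
    rw [h1]
    rw [charRemainder, charRemainder, Matrix.sub_apply, Matrix.sub_apply, h2, Matrix.map_apply,
      map_sub]
    congr 1
    simp only [Matrix.smul_apply, Matrix.one_apply]
    split_ifs <;> simp

/-- The inverse Fourier transform of boundary values of a holomorphic function on the left
half-plane that decays quadratically vanishes on the negative half-line. -/
lemma integral_boundary_eq_zero {G : ℂ → ℂ} (hc : ContinuousOn G {z | z.re ≤ 0})
    (hd : DifferentiableOn ℂ G {z | z.re < 0}) {C : ℝ}
    (hC : ∀ z : ℂ, z.re ≤ 0 → ‖G z‖ ≤ C * (1 + ‖z‖)⁻¹ ^ 2) {u : ℝ} (hu : u < 0) :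
    ∫ y : ℝ, Complex.exp (-(Complex.I * y * u)) * G (Complex.I * y) = 0 := by
  set f : ℂ → ℂ := fun z => Complex.exp (-(z * u)) * G z with hf
  have hC0 : 0 ≤ C := by simpa using (norm_nonneg _).trans (hC 0 (by simp))
  have hnorm : ∀ z : ℂ, z.re ≤ 0 → ‖f z‖ ≤ Real.exp (-z.re * u) * (C * (1 + z.im ^ 2)⁻¹) := by
    intro z hz
    rw [hf, norm_mul, Complex.norm_exp]
    gcongr
    · simp
    · refine (hC z hz).trans (mul_le_mul_of_nonneg_left ?_ hC0)
      refine le_trans ?_ (sq_inv_one_add_abs_le z.im)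
      gcongr
      exact Complex.abs_im_le_norm z
  have hfc : ContinuousOn f {z | z.re ≤ 0} := by
    refine ContinuousOn.mul (Continuous.continuousOn (by fun_prop)) hc
  have hfd : DifferentiableOn ℂ f {z | z.re < 0} := by
    refine DifferentiableOn.mul (Differentiable.differentiableOn (by fun_prop)) hd
  have hre : ∀ x y : ℝ, ((x : ℂ) + y * Complex.I).re = x := by simp
  have him : ∀ x y : ℝ, ((x : ℂ) + y * Complex.I).im = y := by simp
  have hline : ∀ x : ℝ, x ≤ 0 → Integrable fun y : ℝ => f (x + y * Complex.I) := by
    intro x hx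
    refine (integrable_inv_one_add_sq.const_mul (Real.exp (-x * u) * C)).mono'
      (hfc.comp_continuous (by fun_prop) fun y => by simpa using hx).aestronglyMeasurable
      (Filter.Eventually.of_forall fun y => ?_)
    have := hnorm _ ((hre x y).trans_le hx)
    rwa [hre, him, ← mul_assoc] at this
  -- Cauchy's theorem on the rectangles [x, 0] × [-T, T]; as T → ∞ the horizontal edges vanish by
  -- the quadratic decay of `G`.
  have hshift : ∀ x : ℝ, x ≤ 0 →
      ∫ y : ℝ, f ((0 : ℝ) + y * Complex.I) = ∫ y : ℝ, f (x + y * Complex.I) := by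
    intro x hx
    have hrect : ∀ T : ℝ, (∫ s : ℝ in x..0, f (s + (-T : ℝ) * Complex.I)) -
        (∫ s : ℝ in x..0, f (s + T * Complex.I)) +
        Complex.I • (∫ y : ℝ in (-T)..T, f ((0 : ℝ) + y * Complex.I)) -
        Complex.I • (∫ y : ℝ in (-T)..T, f (x + y * Complex.I)) = 0 := by
      intro T
      have := Complex.integral_boundary_rect_eq_zero_of_continuousOn_of_differentiableOn f
        ((x : ℂ) + (-T : ℝ) * Complex.I) ((0 : ℝ) + (T : ℝ) * Complex.I) (hfc.mono ?_)
        (hfd.mono ?_)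
      · simpa only [hre, him] using this
      · intro z hz
        rw [Complex.mem_reProdIm, hre, hre, Set.uIcc_of_le hx] at hz
        exact hz.1.2
      · intro z hz
        rw [Complex.mem_reProdIm, hre, hre, max_eq_right hx] at hz
        exact hz.1.2
    have hedge : ∀ T : ℝ, ‖∫ s : ℝ in x..0, f (s + T * Complex.I)‖ ≤
        C * (1 + T ^ 2)⁻¹ * |0 - x| := by
      intro T
      refine intervalIntegral.norm_integral_le_of_norm_le_const fun s hs => ?_
      rw [Set.uIoc_of_le hx] at hs
      have := hnorm _ ((hre s T).trans_le hs.2)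
      rw [hre, him] at this
      refine this.trans (mul_le_of_le_one_left (by positivity) ?_)
      rw [Real.exp_le_one_iff]
      nlinarith [hs.2]
    have hlim : Filter.Tendsto (fun T : ℝ => C * (1 + T ^ 2)⁻¹ * |0 - x|) Filter.atTop
        (nhds 0) := by
      have h1 : Filter.Tendsto (fun T : ℝ => (1 + T ^ 2)⁻¹) Filter.atTop (nhds 0) :=
        tendsto_inv_atTop_zero.comp (Filter.tendsto_atTop_add_const_left _ _
          (Filter.tendsto_pow_atTop (by norm_num)))
      simpa using (h1.const_mul C).mul_const |0 - x|
    have e1 := squeeze_zero_norm hedge hlim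
    have e2 : Filter.Tendsto (fun T : ℝ => ∫ s : ℝ in x..0, f (s + (-T : ℝ) * Complex.I))
        Filter.atTop (nhds 0) :=
      squeeze_zero_norm (fun T => (hedge (-T)).trans_eq (by rw [neg_sq])) hlim
    have e3 := intervalIntegral_tendsto_integral (hline 0 le_rfl)
      Filter.tendsto_neg_atTop_atBot Filter.tendsto_id
    have e4 := intervalIntegral_tendsto_integral (hline x hx)
      Filter.tendsto_neg_atTop_atBot Filter.tendsto_id
    have e5 := ((e2.sub e1).add (e3.const_smul Complex.I)).sub (e4.const_smul Complex.I)
    have e6 := tendsto_nhds_unique (e5.congr hrect) tendsto_const_nhds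
    rw [sub_zero, zero_add, ← smul_sub, smul_eq_zero, sub_eq_zero] at e6
    exact e6.resolve_left Complex.I_ne_zero
  have hbound : ∀ x : ℝ, x ≤ 0 → ‖∫ y : ℝ, f ((0 : ℝ) + y * Complex.I)‖ ≤
      Real.exp (-x * u) * ∫ y : ℝ, C * (1 + y ^ 2)⁻¹ := by
    intro x hx
    rw [hshift x hx, ← integral_const_mul]
    refine norm_integral_le_of_norm_le
      ((integrable_inv_one_add_sq.const_mul C).const_mul _) (Filter.Eventually.of_forall fun y => ?_)
    have := hnorm _ ((hre x y).trans_le hx)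
    rwa [hre, him] at this
  -- For u < 0 the factor e^{-xu} tends to 0 as x → -∞, while the shifted integral does not depend
  -- on x.
  have hlim : Filter.Tendsto (fun x : ℝ => Real.exp (-x * u) * ∫ y : ℝ, C * (1 + y ^ 2)⁻¹)
      Filter.atBot (nhds 0) := by
    have h1 : Filter.Tendsto (fun x : ℝ => -x * u) Filter.atBot Filter.atBot :=
      Filter.tendsto_neg_atBot_atTop.atTop_mul_const_of_neg hu
    simpa using (Real.tendsto_exp_atBot.comp h1).mul_const (∫ y : ℝ, C * (1 + y ^ 2)⁻¹)
  have h0 : ‖∫ y : ℝ, f ((0 : ℝ) + y * Complex.I)‖ ≤ 0 :=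
    ge_of_tendsto hlim ((Filter.eventually_le_atBot 0).mono hbound)
  have h1 := norm_le_zero_iff.1 h0
  rw [← h1]
  congr 1; ext y
  simp only [hf]
  rw [Complex.ofReal_zero, zero_add, mul_comm (y : ℂ)]

/-- The function `u ↦ e^{-u} 1_{u ≥ 0}`. -/
def expKernel (u : ℝ) : ℝ := (Set.Ici (0 : ℝ)).indicator (fun u => Real.exp (-u)) u

lemma measurable_expKernel : Measurable expKernel :=
  (Real.measurable_exp.comp measurable_neg).indicator measurableSet_Ici

lemma integrable_expKernel : Integrable expKernel := by
  refine (integrable_indicator_iff measurableSet_Ici).2 ?_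
  rw [integrableOn_Ici_iff_integrableOn_Ioi]
  simpa using exp_neg_integrableOn_Ioi 0 one_pos

lemma abs_expKernel_le (u : ℝ) : |expKernel u| ≤ 1 := by
  unfold expKernel
  by_cases h : u ∈ Set.Ici (0 : ℝ)
  · rw [Set.indicator_of_mem h, abs_of_nonneg (Real.exp_nonneg _), Real.exp_le_one_iff]
    simpa using h
  · rw [Set.indicator_of_notMem h]; simp

lemma memLp_expKernel_two : MemLp expKernel 2 := by
  rw [memLp_two_iff_integrable_sq measurable_expKernel.aestronglyMeasurable]
  refine integrable_expKernel.norm.mono' (measurable_expKernel.pow_const 2).aestronglyMeasurable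
    (Filter.Eventually.of_forall fun u => ?_)
  rw [norm_pow, sq]
  exact mul_le_of_le_one_left (norm_nonneg _) (abs_expKernel_le u)

lemma integrable_abs_mul_expKernel : Integrable fun u => |u| * expKernel u := by
  have h : IntegrableOn (fun u : ℝ => u ^ (1 : ℝ) * Real.exp (-1 * u)) (Set.Ioi 0) := by
    simpa using integrableOn_rpow_mul_exp_neg_mul_rpow (s := 1) (p := 1) (b := 1)
      (by norm_num) one_pos one_pos
  have h2 := (integrable_indicator_iff measurableSet_Ioi).2 h
  refine h2.congr (Filter.Eventually.of_forall fun u => ?_)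
  simp only [expKernel, Set.indicator, Set.mem_Ioi, Set.mem_Ici]
  rcases lt_trichotomy u 0 with hu | hu | hu
  · rw [if_neg (by linarith), if_neg (by linarith), mul_zero]
  · simp [hu]
  · rw [if_pos hu, if_pos hu.le, abs_of_pos hu, Real.rpow_one, neg_one_mul]

lemma fourier_expKernel (y : ℝ) :
    ∫ u : ℝ, Complex.exp (Complex.I * y * u) * (expKernel u : ℂ) = (1 - Complex.I * y)⁻¹ := by
  have h1 : ∀ u : ℝ, Complex.exp (Complex.I * y * u) * (expKernel u : ℂ) =
      (Set.Ici (0 : ℝ)).indicator (fun u : ℝ => Complex.exp ((Complex.I * y - 1) * u)) u := by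
    intro u
    unfold expKernel
    by_cases h : u ∈ Set.Ici (0 : ℝ)
    · rw [Set.indicator_of_mem h, Set.indicator_of_mem h, Complex.ofReal_exp, ← Complex.exp_add]
      congr 1; push_cast; ring
    · rw [Set.indicator_of_notMem h, Set.indicator_of_notMem h]; simp
  simp only [h1]
  rw [integral_indicator measurableSet_Ici, integral_Ici_eq_integral_Ioi,
    integral_exp_mul_complex_Ioi (by simp)]
  simp only [Complex.ofReal_zero, mul_zero, Complex.exp_zero]
  rw [← neg_sub, neg_div_neg_eq, one_div]

/-- The kernel with Fourier transform `h(iy)⁻¹`. -/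
theorem exists_kernel (hη : ConcentratedOnNonneg η) (hm : HasMoment η 2)
    (hdet : ∀ y : ℝ, (charMatrix η (Complex.I * y)).det ≠ 0) :
    ∃ g : ℝ → Matrix ι ι ℝ, (∀ a b, Measurable fun u => g u a b) ∧
      EntriesMemLp g 1 ∧ EntriesMemLp g 2 ∧ (∀ a b, Integrable fun u => |u| * g u a b) ∧
      (∀ y : ℝ, fourierFun g y = (charMatrix η (Complex.I * y))⁻¹) ∧
      ((∀ z : ℂ, z.re ≤ 0 → (charMatrix η z).det ≠ 0) → ∀ u < 0, ∀ a b, g u a b = 0) := by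
  choose r hrc hri hr2 hrm hrF hrI using
    fun a b => charRemainder_fourier_preimage hη hm hdet a b
  set δ : ι → ι → ℝ := fun a b => (1 : Matrix ι ι ℝ) a b with hδ
  refine ⟨fun u => Matrix.of fun a b => r a b u + δ a b * expKernel u, fun a b => ?_,
    fun a b => ?_, fun a b => ?_, fun a b => ?_, fun y => ?_, fun hd u hu a b => ?_⟩
  · exact (hrc a b).measurable.add (measurable_expKernel.const_mul _)
  · exact memLp_one_iff_integrable.2 ((hri a b).add (integrable_expKernel.const_mul _))
  · exact (hr2 a b).add (memLp_expKernel_two.const_mul _)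
  · refine ((hrm a b).add (integrable_abs_mul_expKernel.const_mul (δ a b))).congr
      (Filter.Eventually.of_forall fun u => ?_)
    simp only [Pi.add_apply, Matrix.of_apply]; ring
  · ext a b
    have hint : ∀ f : ℝ → ℝ, Integrable f →
        Integrable fun u : ℝ => Complex.exp (Complex.I * y * u) * (f u : ℂ) := fun f hf =>
      hf.ofReal.bdd_mul (c := 1) (by fun_prop)
        (Filter.Eventually.of_forall fun u => (norm_cexp_I_mul y u).le)
    simp only [fourierFun, Matrix.of_apply, Complex.ofReal_add, mul_add]
    rw [integral_add (hint _ (hri a b)) (hint _ (integrable_expKernel.const_mul _)), hrF]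
    have : ∀ u : ℝ, Complex.exp (Complex.I * y * u) * ((δ a b * expKernel u : ℝ) : ℂ) =
        (δ a b : ℂ) * (Complex.exp (Complex.I * y * u) * (expKernel u : ℂ)) := fun u => by
      push_cast; ring
    simp only [this]
    rw [integral_const_mul, fourier_expKernel]
    simp only [charRemainder, Matrix.sub_apply, Matrix.smul_apply, hδ, Matrix.one_apply]
    split_ifs <;> simp
  · have hexp : expKernel u = 0 := Set.indicator_of_notMem (by simpa using hu) _
    have hcl := isClosed_re_nonpos
    obtain ⟨hKc, -⟩ := exists_charMatrix_inv_bound hη hcl subset_rfl hd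
    obtain ⟨C, hC0, hC⟩ := exists_charRemainder_bound hη hcl subset_rfl hd
    -- The inversion formula holds at every point, so the contour shift gives pointwise vanishing,
    -- not merely almost everywhere.
    have hz : r a b u = 0 := by
      rw [← Complex.ofReal_eq_zero, hrI, integral_boundary_eq_zero
        (G := fun z => charRemainder η z a b) ?_ ?_ (fun z hz => hC z hz a b) hu, mul_zero]
      · simp only [charRemainder, Matrix.sub_apply, Matrix.smul_apply]
        refine (hKc a b).sub (ContinuousOn.fun_smul ?_ continuousOn_const)
        exact ContinuousOn.inv₀ (by fun_prop) fun z hz => one_sub_ne_zero hz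
      · simp only [charRemainder, Matrix.sub_apply, Matrix.smul_apply]
        have hHd : ∀ a b, DifferentiableOn ℂ (fun z => charMatrix η z a b) {z | z.re < 0} := by
          intro a b
          simp only [charMatrix, Matrix.sub_apply, Matrix.neg_apply, Matrix.smul_apply]
          refine DifferentiableOn.sub (DifferentiableOn.neg ?_) (differentiableOn_laplace hη a b)
          exact DifferentiableOn.smul_const differentiableOn_id _
        refine DifferentiableOn.sub ?_ (DifferentiableOn.smul_const ?_ _)
        · simp only [Matrix.inv_def, Matrix.smul_apply, Ring.inverse_eq_inv', smul_eq_mul,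
            Matrix.adjugate_apply, Matrix.det_apply]
          -- Determinants are polynomials in the entries. This serves both for det h and for the
          -- adjugate, whose entries are determinants with one row replaced by a constant one.
          have hdetd : ∀ M : ℂ → Matrix ι ι ℂ,
              (∀ a b, DifferentiableOn ℂ (fun z => M z a b) {z | z.re < 0}) →
              DifferentiableOn ℂ (fun z => ∑ σ : Equiv.Perm ι,
                Equiv.Perm.sign σ • ∏ i, M z (σ i) i) {z | z.re < 0} := fun M hM =>
            DifferentiableOn.fun_sum fun σ _ => (DifferentiableOn.fun_finsetProd fun i _ => hM _ _).const_smul _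
          refine DifferentiableOn.mul (DifferentiableOn.inv (hdetd _ hHd) fun z hz => ?_)
            (hdetd _ fun c d => ?_)
          · rw [← Matrix.det_apply]; exact hd z (le_of_lt hz)
          · simp only [Matrix.updateRow_apply]
            split_ifs
            · exact differentiableOn_const _
            · exact hHd _ _
        · exact DifferentiableOn.inv (by fun_prop) fun z hz => one_sub_ne_zero (le_of_lt hz)
    simp [hz, hexp]

end Kernel

/-! ### Primitives -/

lemma stepDiff_of_nonneg {r : ℝ} (hr : 0 ≤ r) (v : ℝ) :
    stepDiff r v = -(Set.Ico 0 r).indicator 1 v := by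
  unfold stepDiff
  simp only [Set.indicator, Set.mem_Ici, Set.mem_Ico, Pi.one_apply, sub_nonneg]
  split_ifs <;> grind

lemma stepDiff_of_nonpos {r : ℝ} (hr : r ≤ 0) (v : ℝ) :
    stepDiff r v = (Set.Ico r 0).indicator 1 v := by
  unfold stepDiff
  simp only [Set.indicator, Set.mem_Ici, Set.mem_Ico, Pi.one_apply, sub_nonneg]
  split_ifs <;> grind

lemma measurable_stepDiff : Measurable fun p : ℝ × ℝ => stepDiff p.2 p.1 := by
  unfold stepDiff
  refine Measurable.sub ?_ ?_
  · exact (measurable_one.indicator measurableSet_Ici).comp (measurable_fst.sub measurable_snd)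
  · exact (measurable_one.indicator measurableSet_Ici).comp measurable_fst

/-- Up to the sign -1, f_r is the indicator between 0 and r with the orientation of the interval
integral; hence one formula for both signs of r. -/
lemma integral_stepDiff_smul {E : Type*} [NormedAddCommGroup E] [NormedSpace ℝ E]
    (r : ℝ) (k : ℝ → E) : ∫ v, stepDiff r v • k v = -∫ v in (0 : ℝ)..r, k v := by
  have hind : ∀ (s : Set ℝ) (v : ℝ), s.indicator (1 : ℝ → ℝ) v • k v = s.indicator k v := by
    intro s v
    by_cases h : v ∈ s <;> simp [h]
  rcases le_total 0 r with hr | hr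
  · simp only [stepDiff_of_nonneg hr, neg_smul, hind]
    rw [integral_neg, integral_indicator measurableSet_Ico, intervalIntegral.integral_of_le hr,
      integral_Ico_eq_integral_Ioo, integral_Ioc_eq_integral_Ioo]
  · simp only [stepDiff_of_nonpos hr, hind]
    rw [integral_indicator measurableSet_Ico, intervalIntegral.integral_symm, neg_neg,
      intervalIntegral.integral_of_le hr, integral_Ico_eq_integral_Ioo,
      integral_Ioc_eq_integral_Ioo]

lemma integrable_stepDiff (r : ℝ) : Integrable (stepDiff r) := by
  rcases le_total 0 r with hr | hr
  · rw [funext (stepDiff_of_nonneg hr)]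
    exact ((integrable_indicator_iff measurableSet_Ico).2
      (integrableOn_const (by simp))).neg
  · rw [funext (stepDiff_of_nonpos hr)]
    exact ((integrable_indicator_iff measurableSet_Ico).2
      (integrableOn_const (by simp)))

lemma integral_abs_stepDiff (r : ℝ) : ∫ v, |stepDiff r v| = |r| := by
  have hind : ∀ (s : Set ℝ) (v : ℝ), |s.indicator (1 : ℝ → ℝ) v| = s.indicator 1 v := by
    intro s v
    by_cases h : v ∈ s <;> simp [h]
  rcases le_total 0 r with hr | hr
  · simp only [stepDiff_of_nonneg hr, abs_neg, hind]
    rw [integral_indicator_one measurableSet_Ico]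
    simp [abs_of_nonneg hr, hr]
  · simp only [stepDiff_of_nonpos hr, hind]
    rw [integral_indicator_one measurableSet_Ico]
    simp [abs_of_nonpos hr, hr]

/-- The function `v ↦ ∫ f_r(v) φ(r) dr`. -/
def stepPrimitive (φ : ℝ → ℝ) (v : ℝ) : ℝ := ∫ r, stepDiff r v * φ r

/-- Since ∫ |f_r(v)| dv = |r|, the first moment of `φ` is what makes the double integral converge.
-/
lemma integrable_stepDiff_mul_smul {E : Type*} [NormedAddCommGroup E] [NormedSpace ℝ E]
    {φ : ℝ → ℝ} (hφ : Measurable φ)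
    (hφm : Integrable fun r => |r| * φ r) {k : ℝ → E} (hk : StronglyMeasurable k) {C : ℝ}
    (hC : ∀ w, ‖k w‖ ≤ C) :
    Integrable (Function.uncurry fun v r => (stepDiff r v * φ r) • k v)
      (volume.prod volume) := by
  have hm : StronglyMeasurable (Function.uncurry fun v r => stepDiff r v * φ r) :=
    (measurable_stepDiff.mul (hφ.comp measurable_snd)).stronglyMeasurable
  have hb : Integrable (Function.uncurry fun v r => stepDiff r v * φ r)
      (volume.prod volume) := by
    refine (integrable_prod_iff' hm.aestronglyMeasurable).2
      ⟨Filter.Eventually.of_forall fun r => (integrable_stepDiff r).mul_const (φ r), ?_⟩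
    refine hφm.norm.congr (Filter.Eventually.of_forall fun r => ?_)
    simp only [Function.uncurry_apply_pair, norm_mul, Real.norm_eq_abs, abs_abs]
    rw [integral_mul_const, integral_abs_stepDiff]
  refine (hb.const_mul C).mono (hm.smul (hk.comp_measurable measurable_fst)).aestronglyMeasurable
    (Filter.Eventually.of_forall fun p => ?_)
  simp only [Function.uncurry, norm_smul, norm_mul]
  rw [mul_comm]
  gcongr
  exact (hC p.1).trans (le_abs_self C)

lemma integrable_stepPrimitive {φ : ℝ → ℝ} (hφ : Measurable φ)
    (hφm : Integrable fun r => |r| * φ r) : Integrable (stepPrimitive φ) := by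
  have := (integrable_stepDiff_mul_smul hφ hφm (k := fun _ => (1 : ℝ))
    stronglyMeasurable_const (C := 1) (by simp)).integral_prod_left
  simp only [Function.uncurry_apply_pair, smul_eq_mul, mul_one] at this
  exact this

/-- Integration by parts in the guise of Fubini: pairing the primitive of `φ` with `k` amounts to
pairing `φ` with the negative primitive of `k`. -/
lemma integral_stepPrimitive_smul {E : Type*} [NormedAddCommGroup E] [NormedSpace ℝ E]
    [CompleteSpace E] {φ : ℝ → ℝ} (hφ : Measurable φ)
    (hφm : Integrable fun r => |r| * φ r) {k : ℝ → E} (hk : StronglyMeasurable k) {C : ℝ}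
    (hC : ∀ w, ‖k w‖ ≤ C) :
    ∫ v, stepPrimitive φ v • k v = ∫ r, φ r • -∫ v in (0 : ℝ)..r, k v := by
  have h := integrable_stepDiff_mul_smul hφ hφm hk hC
  simp only [stepPrimitive, ← integral_smul_const]
  rw [integral_integral_swap h]
  congr 1; ext r
  rw [← integral_stepDiff_smul, ← integral_smul]
  congr 1; ext v
  rw [smul_smul, mul_comm]

lemma integrable_cexp_I_mul_ofReal {f : ℝ → ℝ} (hf : Integrable f) (y : ℝ) :
    Integrable fun u : ℝ => Complex.exp (Complex.I * y * u) * (f u : ℂ) :=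
  hf.ofReal.bdd_mul (c := 1) (by fun_prop)
    (Filter.Eventually.of_forall fun u => (norm_cexp_I_mul y u).le)

/-- Two real integrable functions are equal almost everywhere if their Fourier transforms agree
away from the origin. -/
lemma ae_eq_of_fourier_eq {f g : ℝ → ℝ} (hf : Integrable f) (hg : Integrable g)
    (h : ∀ y : ℝ, y ≠ 0 → ∫ u : ℝ, Complex.exp (Complex.I * y * u) * (f u : ℂ) =
      ∫ u : ℝ, Complex.exp (Complex.I * y * u) * (g u : ℂ)) : f =ᵐ[volume] g := by
  have hc : ∀ f : ℝ → ℝ, Integrable f →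
      Continuous fun y : ℝ => ∫ u : ℝ, Complex.exp (Complex.I * y * u) * (f u : ℂ) := by
    intro f hf
    refine continuous_of_dominated (bound := fun u => ‖f u‖)
      (fun y => (integrable_cexp_I_mul_ofReal hf y).1)
      (fun y => Filter.Eventually.of_forall fun u => ?_) hf.norm
      (Filter.Eventually.of_forall fun u => by fun_prop)
    rw [norm_mul, norm_cexp_I_mul, one_mul, Complex.norm_real]
  -- Transforms of integrable functions are continuous, so agreement off the origin, where one may
  -- divide by y, extends to the origin.
  have heq := (hc f hf).ext_on (dense_compl_singleton (0 : ℝ)) (hc g hg) fun y hy => h y hy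
  have h0 := ae_eq_zero_of_fourier_eq_zero (hf.sub hg) fun y => by
    have := congrFun heq y
    rw [← sub_eq_zero, ← integral_sub (integrable_cexp_I_mul_ofReal hf y)
      (integrable_cexp_I_mul_ofReal hg y)] at this
    rw [← this]
    congr 1; ext u
    simp [mul_sub]
  filter_upwards [h0] with u hu
  simpa [sub_eq_zero] using hu

lemma fourier_stepPrimitive {φ : ℝ → ℝ} (hφ : Measurable φ) (hφi : Integrable φ)
    (hφm : Integrable fun r => |r| * φ r) {y : ℝ} (hy : y ≠ 0) :
    ∫ u : ℝ, Complex.exp (Complex.I * y * u) * (stepPrimitive φ u : ℂ) =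
      ((∫ r, φ r : ℝ) - ∫ u : ℝ, Complex.exp (Complex.I * y * u) * (φ u : ℂ)) /
        (Complex.I * y) := by
  have hIy : Complex.I * (y : ℂ) ≠ 0 := mul_ne_zero Complex.I_ne_zero (by exact_mod_cast hy)
  have h := integral_stepPrimitive_smul hφ hφm (k := fun u : ℝ => Complex.exp (Complex.I * y * u))
    (Continuous.stronglyMeasurable (by fun_prop)) (C := 1) fun u => (norm_cexp_I_mul y u).le
  simp only [Complex.real_smul] at h
  simp only [mul_comm _ (stepPrimitive φ _ : ℂ)]
  have hi := integrable_cexp_I_mul_ofReal hφi y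
  simp only [mul_comm _ (φ _ : ℂ)] at hi ⊢
  have hφc : Integrable fun r => (φ r : ℂ) := hφi.ofReal
  rw [h, ← integral_complex_ofReal, ← integral_sub hφc hi, ← integral_div]
  congr 1; ext r
  rw [integral_exp_mul_complex hIy]
  simp
  ring

lemma fourier_sConv (μ : SignedMeasure ℝ) {f : ℝ → ℝ} (hf : Measurable f) (hfi : Integrable f)
    (y : ℝ) : ∫ u : ℝ, Complex.exp (Complex.I * y * u) * (sConv μ f u : ℂ) =
      (sIntegral μ fun v : ℝ => Complex.exp (Complex.I * y * v)) *
        ∫ u : ℝ, Complex.exp (Complex.I * y * u) * (f u : ℂ) := by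
  have h := integral_sConv_smul μ hf hfi (k := fun u : ℝ => Complex.exp (Complex.I * y * u))
    (Continuous.stronglyMeasurable (by fun_prop)) (C := 1) fun u => (norm_cexp_I_mul y u).le
  simp only [Complex.real_smul] at h
  simp only [mul_comm _ (sConv μ f _ : ℂ)]
  rw [h, mul_comm (sIntegral _ _), ← smul_eq_mul (a := ∫ u : ℝ, _), ← sIntegral_const_smul]
  congr 1; ext v
  rw [smul_eq_mul, ← integral_mul_const]
  congr 1; ext w
  push_cast
  rw [mul_add, Complex.exp_add]; ring

/-! ### The derivative of the kernel -/

section KernelDeriv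
variable {ι : Type*} [Fintype ι] [DecidableEq ι] {η : MatrixMeasure ι} {g : ℝ → Matrix ι ι ℝ}

/-- The kernel of the first-order equation: an integrable matrix function with first moment
whose Fourier transform is `h(iy)⁻¹`. -/
structure IsKernel (η : MatrixMeasure ι) (g : ℝ → Matrix ι ι ℝ) : Prop where
  det_ne_zero : ∀ y : ℝ, (charMatrix η (Complex.I * y)).det ≠ 0
  moment : HasMoment η 1
  measurable : ∀ a b, Measurable fun u => g u a b
  integrable : ∀ a b, Integrable fun u => g u a b
  integrable_abs_mul : ∀ a b, Integrable fun u => |u| * g u a b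
  fourier_eq : ∀ y : ℝ, fourierFun g y = (charMatrix η (Complex.I * y))⁻¹

/-- The absolutely continuous part `η * g` of the derivative of the kernel. -/
def kernelDeriv (η : MatrixMeasure ι) (g : ℝ → Matrix ι ι ℝ) (p q : ι) (w : ℝ) : ℝ :=
  ∑ k, sConv (η p k) (fun u => g u k q) w

/-- The convolution `g * η`. -/
def kernelDeriv' (η : MatrixMeasure ι) (g : ℝ → Matrix ι ι ℝ) (p q : ι) (w : ℝ) : ℝ :=
  ∑ k, sConv (η k q) (fun u => g u p k) w

namespace IsKernel
variable (hg : IsKernel η g)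
include hg

lemma abs_moment (a b : ι) : Integrable (fun u : ℝ => |u|) (η a b).totalVariation := by
  simpa using hg.moment a b

lemma measurable_deriv (p q : ι) : Measurable (kernelDeriv η g p q) :=
  Finset.measurable_fun_sum _ fun k _ => measurable_sConv _ (hg.measurable k q)

lemma integrable_deriv (p q : ι) : Integrable (kernelDeriv η g p q) :=
  integrable_finsetSum _ fun k _ => integrable_sConv _ (hg.measurable k q) (hg.integrable k q)

lemma integrable_deriv' (p q : ι) : Integrable (kernelDeriv' η g p q) :=
  integrable_finsetSum _ fun k _ => integrable_sConv _ (hg.measurable p k) (hg.integrable p k)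

lemma integrable_abs_mul_deriv (p q : ι) : Integrable fun w => |w| * kernelDeriv η g p q w := by
  simp only [kernelDeriv, Finset.mul_sum]
  exact integrable_finsetSum _ fun k _ => integrable_abs_mul_sConv _ (hg.abs_moment p k)
    (hg.measurable k q) (hg.integrable k q) (hg.integrable_abs_mul k q)

/-- A rearrangement of h(iy) h(iy)⁻¹ = I. It expresses that the distributional derivative of `g` is
`η * g` plus a jump I at the origin. -/
lemma fourier_deriv (p q : ι) (y : ℝ) :
    ∫ u : ℝ, Complex.exp (Complex.I * y * u) * (kernelDeriv η g p q u : ℂ) =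
      -(1 : Matrix ι ι ℂ) p q - Complex.I * y * (charMatrix η (Complex.I * y))⁻¹ p q := by
  have h1 : laplace η (Complex.I * y) * (charMatrix η (Complex.I * y))⁻¹ =
      -(1 : Matrix ι ι ℂ) - (Complex.I * y) • (charMatrix η (Complex.I * y))⁻¹ := by
    rw [← Matrix.mul_nonsing_inv _ (isUnit_iff_ne_zero.2 (hg.det_ne_zero y))]
    nth_rewrite 2 [charMatrix]
    rw [sub_mul, neg_mul, smul_mul_assoc, one_mul]; abel
  have h2 := congrFun (congrFun h1 p) q
  rw [Matrix.sub_apply, Matrix.neg_apply, Matrix.smul_apply, smul_eq_mul, Matrix.mul_apply] at h2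
  rw [← h2]
  simp only [kernelDeriv, Complex.ofReal_sum, Finset.mul_sum]
  rw [integral_finsetSum _ fun k _ => integrable_cexp_I_mul_ofReal
    (integrable_sConv _ (hg.measurable k q) (hg.integrable k q)) y]
  refine Finset.sum_congr rfl fun k _ => ?_
  rw [fourier_sConv _ (hg.measurable k q) (hg.integrable k q), ← hg.fourier_eq]
  rfl

lemma fourier_deriv' (p q : ι) (y : ℝ) :
    ∫ u : ℝ, Complex.exp (Complex.I * y * u) * (kernelDeriv' η g p q u : ℂ) =
      -(1 : Matrix ι ι ℂ) p q - Complex.I * y * (charMatrix η (Complex.I * y))⁻¹ p q := by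
  have h1 : (charMatrix η (Complex.I * y))⁻¹ * laplace η (Complex.I * y) =
      -(1 : Matrix ι ι ℂ) - (Complex.I * y) • (charMatrix η (Complex.I * y))⁻¹ := by
    rw [← Matrix.nonsing_inv_mul _ (isUnit_iff_ne_zero.2 (hg.det_ne_zero y))]
    nth_rewrite 3 [charMatrix]
    rw [mul_sub, mul_neg, mul_smul_comm, mul_one]; abel
  have h2 := congrFun (congrFun h1 p) q
  rw [Matrix.sub_apply, Matrix.neg_apply, Matrix.smul_apply, smul_eq_mul, Matrix.mul_apply] at h2
  rw [← h2]
  simp only [kernelDeriv', Complex.ofReal_sum, Finset.mul_sum]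
  rw [integral_finsetSum _ fun k _ => integrable_cexp_I_mul_ofReal
    (integrable_sConv _ (hg.measurable p k) (hg.integrable p k)) y]
  refine Finset.sum_congr rfl fun k _ => ?_
  rw [fourier_sConv _ (hg.measurable p k) (hg.integrable p k), ← hg.fourier_eq, mul_comm]
  rfl

/-- The two convolutions have the same transform because h(iy)⁻¹ is both a left and a right inverse.
The uniqueness argument rests on this commutation. -/
lemma deriv'_ae_eq (p q : ι) : kernelDeriv' η g p q =ᵐ[volume] kernelDeriv η g p q :=
  ae_eq_of_fourier_eq (hg.integrable_deriv' p q) (hg.integrable_deriv p q) fun y _ => by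
    rw [hg.fourier_deriv, hg.fourier_deriv']

/-- At y = 0 the term with the factor iy drops out. The mass -I balances the jump I of `g` at the
origin. -/
lemma integral_deriv (p q : ι) : ∫ u, kernelDeriv η g p q u = -(1 : Matrix ι ι ℝ) p q := by
  have h := hg.fourier_deriv p q 0
  simp only [Complex.ofReal_zero, mul_zero, zero_mul, Complex.exp_zero, one_mul, sub_zero] at h
  rw [integral_complex_ofReal] at h
  apply Complex.ofReal_injective
  rw [h, Matrix.one_apply, Matrix.one_apply]
  split_ifs <;> simp

/-- The transforms agree off the origin: the mass of the derivative cancels the term -I, and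
division by iy returns h(iy)⁻¹. This displays `g` as a mixture of the steps f_r, the form to which
the Fubini property of a regular integral applies. -/
lemma ae_eq_stepPrimitive (p q : ι) :
    (fun u => g u p q) =ᵐ[volume] stepPrimitive (kernelDeriv η g p q) := by
  refine ae_eq_of_fourier_eq (hg.integrable p q) (integrable_stepPrimitive (hg.measurable_deriv p q)
    (hg.integrable_abs_mul_deriv p q)) fun y hy => ?_
  have hIy : Complex.I * (y : ℂ) ≠ 0 := mul_ne_zero Complex.I_ne_zero (by exact_mod_cast hy)
  rw [fourier_stepPrimitive (hg.measurable_deriv p q) (hg.integrable_deriv p q)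
    (hg.integrable_abs_mul_deriv p q) hy, hg.fourier_deriv, hg.integral_deriv]
  have h1 : ∫ u : ℝ, Complex.exp (Complex.I * y * u) * (g u p q : ℂ) =
      (charMatrix η (Complex.I * y))⁻¹ p q := by rw [← hg.fourier_eq]; rfl
  rw [h1, eq_div_iff hIy, Matrix.one_apply, Matrix.one_apply]
  split_ifs <;> push_cast <;> ring

lemma integral_smul_eq {E : Type*} [NormedAddCommGroup E] [NormedSpace ℝ E]
    [CompleteSpace E] (p q : ι) {k : ℝ → E} (hk : StronglyMeasurable k) {C : ℝ}
    (hC : ∀ w, ‖k w‖ ≤ C) :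
    ∫ v, g v p q • k v = ∫ r, kernelDeriv η g p q r • -∫ v in (0 : ℝ)..r, k v := by
  rw [← integral_stepPrimitive_smul (hg.measurable_deriv p q) (hg.integrable_abs_mul_deriv p q)
    hk hC]
  exact integral_congr_ae ((hg.ae_eq_stepPrimitive p q).mono fun v hv => by simp only [hv])

end IsKernel

/-! ### The convolution equation for functions of linear growth -/

/-- `∫ (z(t - r) - z(t)) φ(r) dr`. -/
def incrConv (φ z : ℝ → ℝ) (t : ℝ) : ℝ := ∫ r, (z (t - r) - z t) * φ r

lemma integrable_one_add_abs_mul {φ : ℝ → ℝ} (hφi : Integrable φ)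
    (hφm : Integrable fun r => |r| * φ r) (C : ℝ) :
    Integrable fun r => C * (1 + |r|) * |φ r| := by
  refine ((hφi.norm.add hφm.norm).const_mul C).congr (Filter.Eventually.of_forall fun r => ?_)
  simp only [Pi.add_apply, norm_mul, Real.norm_eq_abs, abs_abs]; ring

lemma measurable_incrConv {φ z : ℝ → ℝ} (hφ : Measurable φ) (hz : Measurable z) :
    Measurable (incrConv φ z) :=
  (StronglyMeasurable.integral_prod_right (f := fun t r => (z (t - r) - z t) * φ r)
    (Measurable.stronglyMeasurable (((hz.comp (measurable_fst.sub measurable_snd)).sub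
      (hz.comp measurable_fst)).mul (hφ.comp measurable_snd)))).measurable

lemma norm_incr_mul_le {z : ℝ → ℝ} {C : ℝ} (hzC : ∀ s t, |z t - z s| ≤ C * (1 + |t - s|))
    (φ : ℝ → ℝ) (t r : ℝ) : ‖(z (t - r) - z t) * φ r‖ ≤ C * (1 + |r|) * |φ r| := by
  rw [norm_mul, Real.norm_eq_abs, Real.norm_eq_abs]
  refine mul_le_mul_of_nonneg_right ((hzC t (t - r)).trans_eq ?_) (abs_nonneg _)
  rw [sub_sub_cancel_left, abs_neg]

lemma integrable_incr_mul {φ z : ℝ → ℝ} (hφ : Measurable φ) (hφi : Integrable φ)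
    (hφm : Integrable fun r => |r| * φ r) (hz : Measurable z) {C : ℝ}
    (hzC : ∀ s t, |z t - z s| ≤ C * (1 + |t - s|)) (t : ℝ) :
    Integrable fun r => (z (t - r) - z t) * φ r :=
  (integrable_one_add_abs_mul hφi hφm C).mono'
    ((((hz.comp (measurable_const.sub measurable_id)).sub_const _).mul hφ).aestronglyMeasurable)
    (Filter.Eventually.of_forall fun r => norm_incr_mul_le hzC φ t r)

lemma abs_incrConv_le {φ z : ℝ → ℝ} (hφi : Integrable φ)
    (hφm : Integrable fun r => |r| * φ r) {C : ℝ}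
    (hzC : ∀ s t, |z t - z s| ≤ C * (1 + |t - s|)) (t : ℝ) :
    |incrConv φ z t| ≤ ∫ r, C * (1 + |r|) * |φ r| :=
  norm_integral_le_of_norm_le (integrable_one_add_abs_mul hφi hφm C)
    (Filter.Eventually.of_forall fun r => norm_incr_mul_le hzC φ t r)

namespace IsKernel
variable (hg : IsKernel η g)
include hg

/-- By Fubini the left side averages ∫_s^t (z(u - r) - z(u)) du over φ(r) dr. That inner integral
equals -∫_0^r (z(t - v) - z(s - v)) dv, so integration by parts turns φ back into `g`. The growth
bound keeps z(t - v) - z(s - v) bounded in v. -/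
lemma intervalIntegral_incrConv (q c : ι) {z : ℝ → ℝ} (hz : Continuous z) {C : ℝ}
    (hzC : ∀ s t, |z t - z s| ≤ C * (1 + |t - s|)) {s t : ℝ} (hst : s ≤ t) :
    ∫ u in s..t, incrConv (kernelDeriv η g q c) z u =
      ∫ v, g v q c * (z (t - v) - z (s - v)) := by
  set φ := kernelDeriv η g q c with hφ
  have hint : Integrable (Function.uncurry fun u r => (z (u - r) - z u) * φ r)
      ((volume.restrict (Set.Ioc s t)).prod volume) := by
    have hb : Integrable (fun p : ℝ × ℝ => C * (1 + |p.2|) * |φ p.2|)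
        ((volume.restrict (Set.Ioc s t)).prod volume) :=
      (integrable_one_add_abs_mul (hg.integrable_deriv q c)
        (hg.integrable_abs_mul_deriv q c) C).comp_snd _
    refine hb.mono' ?_ (Filter.Eventually.of_forall fun p => norm_incr_mul_le hzC φ p.1 p.2)
    exact (((hz.measurable.comp (measurable_fst.sub measurable_snd)).sub
      (hz.measurable.comp measurable_fst)).mul
        ((hg.measurable_deriv q c).comp measurable_snd)).aestronglyMeasurable
  have hk := hg.integral_smul_eq q c (k := fun v => z (t - v) - z (s - v))
    (Continuous.stronglyMeasurable (by fun_prop)) (C := C * (1 + |t - s|)) fun v => by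
      simpa using hzC (s - v) (t - v)
  simp only [smul_eq_mul] at hk
  rw [hk, intervalIntegral.integral_of_le hst]
  unfold incrConv
  rw [integral_integral_swap hint]
  refine integral_congr_ae (Filter.Eventually.of_forall fun r => ?_)
  simp only
  rw [integral_mul_const, ← intervalIntegral.integral_of_le hst, mul_comm]
  congr 1
  have hii : ∀ f : ℝ → ℝ, Continuous f → ∀ a b, IntervalIntegrable f volume a b :=
    fun f hf a b => hf.intervalIntegrable a b
  rw [intervalIntegral.integral_sub (hii _ (by fun_prop) _ _) (hii _ (by fun_prop) _ _),
    intervalIntegral.integral_sub (hii _ (by fun_prop) _ _) (hii _ (by fun_prop) _ _),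
    intervalIntegral.integral_comp_sub_right, intervalIntegral.integral_comp_sub_left,
    intervalIntegral.integral_comp_sub_left, sub_zero, sub_zero]
  have h1 := intervalIntegral.integral_add_adjacent_intervals (hii z hz (s - r) (t - r))
    (hii z hz (t - r) t)
  have h2 := intervalIntegral.integral_add_adjacent_intervals (hii z hz (s - r) s)
    (hii z hz s t)
  linarith

/-- The first-order equation for a deterministic driver: convolving `intervalIntegral_incrConv` with
`η` and summing over q replaces `g` by `η * g`. -/
lemma sum_integral_sIntegral_incrConv (p c : ι) {z : ℝ → ℝ} (hz : Continuous z) {C : ℝ}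
    (hzC : ∀ s t, |z t - z s| ≤ C * (1 + |t - s|)) {s t : ℝ} (hst : s ≤ t) :
    ∑ q, ∫ u in s..t, sIntegral (η p q) (fun v => incrConv (kernelDeriv η g q c) z (u - v)) =
      incrConv (kernelDeriv η g p c) z t - incrConv (kernelDeriv η g p c) z s -
        (1 : Matrix ι ι ℝ) p c * (z t - z s) := by
  have h1 : ∀ q, ∫ u in s..t,
      sIntegral (η p q) (fun v => incrConv (kernelDeriv η g q c) z (u - v)) =
      ∫ w, sConv (η p q) (fun u => g u q c) w * (z (t - w) - z (s - w)) := by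
    intro q
    have hm := measurable_incrConv (hg.measurable_deriv q c) hz.measurable
    have hint : Integrable (Function.uncurry fun u v : ℝ =>
        incrConv (kernelDeriv η g q c) z (u - v))
        ((volume.restrict (Set.Ioc s t)).prod (η p q).totalVariation) := by
      refine (integrable_const (∫ r, C * (1 + |r|) * |kernelDeriv η g q c r|)).mono'
        (hm.comp (measurable_fst.sub measurable_snd)).aestronglyMeasurable
        (Filter.Eventually.of_forall fun x => ?_)
      exact abs_incrConv_le (hg.integrable_deriv q c) (hg.integrable_abs_mul_deriv q c) hzC _
    rw [intervalIntegral.integral_of_le hst, integral_sIntegral_swap hint]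
    have hk := integral_sConv_smul (η p q) (hg.measurable q c) (hg.integrable q c)
      (k := fun v => z (t - v) - z (s - v))
      (Continuous.stronglyMeasurable (by fun_prop)) (C := C * (1 + |t - s|)) fun v => by
        simpa using hzC (s - v) (t - v)
    simp only [smul_eq_mul] at hk
    rw [hk]
    congr 1; ext v
    rw [← intervalIntegral.integral_of_le hst, intervalIntegral.integral_comp_sub_right
      (fun u => incrConv (kernelDeriv η g q c) z u), hg.intervalIntegral_incrConv q c hz hzC
      (by linarith)]
    simp only [sub_sub, add_comm v]
  have hb : ∀ v : ℝ, ‖z (t - v) - z (s - v)‖ ≤ C * (1 + |t - s|) := fun v => by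
    simpa using hzC (s - v) (t - v)
  have hi : ∀ q, Integrable fun w =>
      sConv (η p q) (fun u => g u q c) w * (z (t - w) - z (s - w)) := fun q =>
    (integrable_sConv _ (hg.measurable q c) (hg.integrable q c)).mul_bdd (c := C * (1 + |t - s|))
      (Continuous.aestronglyMeasurable (by fun_prop)) (Filter.Eventually.of_forall hb)
  simp only [h1]
  rw [← integral_finsetSum _ fun q _ => hi q]
  simp only [← Finset.sum_mul]
  have hii := fun t => integrable_incr_mul (hg.measurable_deriv p c) (hg.integrable_deriv p c)
    (hg.integrable_abs_mul_deriv p c) hz.measurable hzC t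
  -- Recentring at z(t) and z(s) produces the two moving averages; the leftover (z(t) - z(s)) ∫ φ is
  -- the driver term, as ∫ φ = -I.
  have h2 : ∀ w, (∑ q, sConv (η p q) (fun u => g u q c) w) * (z (t - w) - z (s - w)) =
      (z (t - w) - z t) * kernelDeriv η g p c w - (z (s - w) - z s) * kernelDeriv η g p c w +
        (z t - z s) * kernelDeriv η g p c w := fun w => by rw [kernelDeriv]; ring
  simp only [h2]
  have hsub : Integrable fun w => (z (t - w) - z t) * kernelDeriv η g p c w -
      (z (s - w) - z s) * kernelDeriv η g p c w := (hii t).sub (hii s)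
  rw [integral_add hsub ((hg.integrable_deriv p c).const_mul _),
    integral_sub (hii t) (hii s), integral_const_mul, hg.integral_deriv]
  unfold incrConv
  ring

/-- Bounded solutions of the homogeneous equation vanish. -/
lemma eq_zero_of_bounded_solution {V : ι → ℝ → ℝ} {B : ℝ} (hB : ∀ q t, |V q t| ≤ B)
    (hV : ∀ p t, HasDerivAt (V p) (∑ q, sIntegral (η p q) fun v => V q (t - v)) t)
    (p : ι) (t : ℝ) : V p t = 0 := by
  have hVc : ∀ q, Continuous (V q) := fun q =>
    continuous_iff_continuousAt.2 fun t => (hV q t).continuousAt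
  set W : ι → ℝ → ℝ := fun p t => ∑ q, sIntegral (η p q) fun v => V q (t - v) with hW
  have hsm : ∀ p q, Measurable fun t => sIntegral (η p q) fun v => V q (t - v) := fun p q =>
    (stronglyMeasurable_sIntegral (η p q) (f := fun t v => V q (t - v))
      (((hVc q).comp (by fun_prop : Continuous fun x : ℝ × ℝ => x.1 - x.2)
        ).stronglyMeasurable)).measurable
  have hWm : ∀ p, Measurable (W p) := fun p => Finset.measurable_fun_sum _ fun q _ => hsm p q
  have hVi : ∀ (p q : ι) t, Integrable (fun v => V q (t - v)) (η p q).totalVariation :=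
    fun p q t => (integrable_const B).mono'
      ((hVc q).comp (by fun_prop)).aestronglyMeasurable
      (Filter.Eventually.of_forall fun v => hB q (t - v))
  have hWb : ∀ p t, ‖W p t‖ ≤ ∑ q, (η p q).totalVariation.real Set.univ * B := by
    intro p t
    refine (norm_sum_le _ _).trans (Finset.sum_le_sum fun q _ => ?_)
    refine (norm_sIntegral_le (hVi p q t)).trans ((integral_mono (hVi p q t).norm
      (integrable_const B) fun v => hB q (t - v)).trans_eq ?_)
    simp
  -- Since V' = W, integrating `g` against W(t - ·) by parts gives φ * V plus the jump term.
  have e1 : ∀ c, ∫ v, g v p c * W c (t - v) =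
      (∫ r, kernelDeriv η g p c r * V c (t - r)) + (1 : Matrix ι ι ℝ) p c * V c t := by
    intro c
    have hk := hg.integral_smul_eq p c (k := fun v => W c (t - v))
      ((hWm c).comp (measurable_const.sub measurable_id)).stronglyMeasurable
      fun v => hWb c (t - v)
    simp only [smul_eq_mul] at hk
    rw [hk]
    have hWi : ∀ a b, IntervalIntegrable (W c) volume a b := fun a b =>
      (intervalIntegrable_const (c := ∑ q, (η c q).totalVariation.real Set.univ * B)).mono_fun'
        (hWm c).aestronglyMeasurable (Filter.Eventually.of_forall fun v => hWb c v)
    have hftc : ∀ r, -∫ v in (0 : ℝ)..r, W c (t - v) = V c (t - r) - V c t := by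
      intro r
      rw [intervalIntegral.integral_comp_sub_left, sub_zero,
        intervalIntegral.integral_eq_sub_of_hasDerivAt (fun x _ => hV c x) (hWi _ _)]
      ring
    simp only [hftc, mul_sub]
    rw [integral_sub, integral_mul_const, hg.integral_deriv]
    · ring
    · exact (hg.integrable_deriv p c).mul_bdd (c := B)
        ((hVc c).comp (by fun_prop)).aestronglyMeasurable
        (Filter.Eventually.of_forall fun r => hB c (t - r))
    · exact (hg.integrable_deriv p c).mul_const _
  have hVconv : ∀ c q, ∫ v, g v p c * sIntegral (η c q) (fun v' => V q (t - v - v')) =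
      ∫ w, sConv (η c q) (fun u => g u p c) w * V q (t - w) := by
    intro c q
    have hk := integral_sConv_smul (η c q) (hg.measurable p c) (hg.integrable p c)
      (k := fun v => V q (t - v)) ((hVc q).comp (by fun_prop)).stronglyMeasurable
      fun v => hB q (t - v)
    simp only [smul_eq_mul] at hk
    rw [hk]
    have hint : Integrable (Function.uncurry fun v v' : ℝ => g v p c * V q (t - (v + v')))
        (volume.prod (η c q).totalVariation) := by
      refine ((hg.integrable p c).comp_fst _).mul_bdd (c := B)
        (Measurable.aestronglyMeasurable ?_) (Filter.Eventually.of_forall fun x => hB q _)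
      exact (hVc q).measurable.comp (by fun_prop)
    rw [← integral_sIntegral_swap hint]
    congr 1; ext v
    rw [← smul_eq_mul, ← sIntegral_const_smul]
    simp only [smul_eq_mul, sub_sub]
  have hi1 : ∀ c q, Integrable fun v => g v p c * sIntegral (η c q) (fun v' => V q (t - v - v')) :=
    fun c q => (hg.integrable p c).mul_bdd (c := (η c q).totalVariation.real Set.univ * B)
      (((hsm c q).comp (measurable_const.sub measurable_id)).aestronglyMeasurable)
      (Filter.Eventually.of_forall fun v => by
        refine (norm_sIntegral_le (hVi c q _)).trans ((integral_mono (hVi c q _).norm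
          (integrable_const B) fun v' => hB q _).trans_eq ?_)
        simp)
  have hi2 : ∀ c q, Integrable fun w => sConv (η c q) (fun u => g u p c) w * V q (t - w) :=
    fun c q => (integrable_sConv _ (hg.measurable p c) (hg.integrable p c)).mul_bdd (c := B)
      ((hVc q).comp (by fun_prop)).aestronglyMeasurable
      (Filter.Eventually.of_forall fun r => hB q (t - r))
  -- Inserting W = η * V and regrouping gives (g * η) * V, and g * η = η * g almost everywhere.
  have e2 : ∑ c, ∫ v, g v p c * W c (t - v) =
      ∑ q, ∫ r, kernelDeriv η g p q r * V q (t - r) := by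
    have h1 : ∀ c, ∫ v, g v p c * W c (t - v) =
        ∑ q, ∫ w, sConv (η c q) (fun u => g u p c) w * V q (t - w) := by
      intro c
      simp only [hW, Finset.mul_sum]
      rw [integral_finsetSum _ fun q _ => hi1 c q]
      exact Finset.sum_congr rfl fun q _ => hVconv c q
    simp only [h1]
    rw [Finset.sum_comm]
    refine Finset.sum_congr rfl fun q _ => ?_
    rw [← integral_finsetSum _ fun c _ => hi2 c q]
    refine integral_congr_ae ((hg.deriv'_ae_eq p q).mono fun w hw => ?_)
    simp only [← hw, kernelDeriv', Finset.sum_mul]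
  -- Comparing the two evaluations leaves only the jump term, which is V p t.
  simp only [e1, Finset.sum_add_distrib] at e2
  have e3 := add_eq_left.1 e2
  simpa [Matrix.one_apply] using e3

end IsKernel
end KernelDeriv

/-! ### Block companion matrices -/

section Companion
variable {R : Type*} [CommRing R] {m n : ℕ}

/-- The matrix `w I - C` for the block companion matrix `C` with last block row `A`. -/
def blockCompanion (w : R) (A : Fin m → Matrix (Fin n) (Fin n) R) :
    Matrix (Fin m × Fin n) (Fin m × Fin n) R :=
  w • 1 - Matrix.of fun p q =>
    if (p.1 : ℕ) + 1 < m then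
      if (q.1 : ℕ) = (p.1 : ℕ) + 1 ∧ q.2 = p.2 then 1 else 0
    else A q.1 p.2 q.2

/-- The matrix polynomial `w^m - ∑_j w^j A_j`. -/
def blockPolynomial (w : R) (A : Fin m → Matrix (Fin n) (Fin n) R) : Matrix (Fin n) (Fin n) R :=
  w ^ m • 1 - ∑ j : Fin m, w ^ (j : ℕ) • A j

lemma blockCompanion_mul_apply_of_lt {κ : Type*} (w : R) (A : Fin m → Matrix (Fin n) (Fin n) R)
    (Y : Matrix (Fin m × Fin n) κ R) {i : Fin m} (hi : (i : ℕ) + 1 < m) (k : Fin n) (q : κ) :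
    (blockCompanion w A * Y) (i, k) q = w * Y (i, k) q - Y (⟨i + 1, hi⟩, k) q := by
  rw [blockCompanion, Matrix.sub_mul, Matrix.smul_mul, Matrix.one_mul, Matrix.sub_apply,
    Matrix.smul_apply, smul_eq_mul, Matrix.mul_apply]
  congr 1
  rw [Finset.sum_eq_single (⟨i + 1, hi⟩, k)]
  · simp [hi]
  · rintro ⟨j, l⟩ - hne
    have : ¬((j : ℕ) = (i : ℕ) + 1 ∧ l = k) := fun h => hne (Prod.ext (Fin.ext h.1) h.2)
    simp [hi, this]
  · simp

lemma blockCompanion_mul_apply_last {κ : Type*} (w : R) (A : Fin m → Matrix (Fin n) (Fin n) R)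
    (Y : Matrix (Fin m × Fin n) κ R) {i : Fin m} (hi : ¬(i : ℕ) + 1 < m) (k : Fin n) (q : κ) :
    (blockCompanion w A * Y) (i, k) q = w * Y (i, k) q - ∑ j, ∑ l, A j k l * Y (j, l) q := by
  rw [blockCompanion, Matrix.sub_mul, Matrix.smul_mul, Matrix.one_mul, Matrix.sub_apply,
    Matrix.smul_apply, smul_eq_mul, Matrix.mul_apply, Fintype.sum_prod_type]
  simp [hi]

/-- The unipotent matrix with blocks `w^{i - j}` on and below the diagonal. -/
def blockPowers (m n : ℕ) (w : R) : Matrix (Fin m × Fin n) (Fin m × Fin n) R :=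
  Matrix.of fun p q => if q.1 ≤ p.1 ∧ p.2 = q.2 then w ^ ((p.1 : ℕ) - q.1) else 0

lemma det_blockPowers (w : R) : (blockPowers m n w).det = 1 := by
  rw [← Matrix.det_submatrix_equiv_self (ofLex : Fin m ×ₗ Fin n ≃ Fin m × Fin n),
    Matrix.det_of_isLowerTriangular]
  · refine Finset.prod_eq_one fun p _ => ?_
    simp [blockPowers]
  · intro p q hpq
    have hpq' : p < q := hpq
    rw [Prod.Lex.lt_iff] at hpq'
    simp only [Matrix.submatrix_apply, blockPowers, Matrix.of_apply]
    rw [if_neg]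
    rintro ⟨h1, h2⟩
    rcases hpq' with h | ⟨-, h⟩
    · exact absurd h1 (not_le.2 h)
    · exact absurd h2 (ne_of_lt h)

/-- The lexicographic order makes this matrix unitriangular. It serves to calibrate the sign in
`det_blockCompanion`. -/
lemma det_blockCompanion_one_zero :
    (blockCompanion (1 : R) (0 : Fin m → Matrix (Fin n) (Fin n) R)).det = 1 := by
  rw [← Matrix.det_submatrix_equiv_self (ofLex : Fin m ×ₗ Fin n ≃ Fin m × Fin n),
    Matrix.det_of_isUpperTriangular]
  · refine Finset.prod_eq_one fun p _ => ?_
    simp [blockCompanion]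
  · intro p q hpq
    have hpq' : q < p := hpq
    have hne : ofLex p ≠ ofLex q := fun h => hpq'.ne' (ofLex.injective h)
    rw [Prod.Lex.lt_iff] at hpq'
    simp only [Matrix.submatrix_apply, blockCompanion, Matrix.sub_apply, Matrix.smul_apply,
      Matrix.of_apply, Matrix.one_apply_ne hne, smul_zero, zero_sub, neg_eq_zero, Pi.zero_apply,
      Matrix.zero_apply]
    split_ifs with h1 h2
    · rcases hpq' with h | ⟨h, -⟩
      · have : ((ofLex q).1 : ℕ) < (ofLex p).1 := h
        omega
      · have : ((ofLex q).1 : ℕ) = (ofLex p).1 := congrArg _ h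
        omega
    · rfl
    · rfl

lemma blockPolynomial_one_zero :
    blockPolynomial (1 : R) (0 : Fin m → Matrix (Fin n) (Fin n) R) = 1 := by
  simp [blockPolynomial]

/-- Right multiplication by `blockPowers` clears the diagonal w: in each block row but the last only
-I on the block superdiagonal survives, and the first block column keeps only the matrix polynomial
in its last block. Rotating the block columns cyclically makes this block triangular with diagonal
blocks -I and the polynomial. -/
lemma det_blockCompanion_aux (w : R) (A : Fin (m + 1) → Matrix (Fin n) (Fin n) R) :
    (Equiv.Perm.sign ((finRotate (m + 1)).prodCongr (Equiv.refl (Fin n))) : R) *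
      (blockCompanion w A).det =
    (-1) ^ Fintype.card {p : Fin (m + 1) × Fin n // ¬p.1 = Fin.last m} *
      (blockPolynomial w A).det := by
  set e := (finRotate (m + 1)).prodCongr (Equiv.refl (Fin n)) with he
  have h1 : ((blockCompanion w A * blockPowers (m + 1) n w).submatrix id e).det =
      (Equiv.Perm.sign e : R) * (blockCompanion w A).det := by
    rw [Matrix.det_permute', Matrix.det_mul, det_blockPowers, mul_one]
  rw [← h1, Matrix.twoBlockTriangular_det _ fun p => p.1 = Fin.last m]
  · rw [mul_comm]
    congr 1
    · have : ((blockCompanion w A * blockPowers (m + 1) n w).submatrix id e).toSquareBlockProp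
          (fun p => ¬p.1 = Fin.last m) = -1 := by
        ext ⟨⟨i, k⟩, hi⟩ ⟨⟨j, l⟩, hj⟩
        have hi' : (i : ℕ) + 1 < m + 1 := by
          have : (i : ℕ) < m := Fin.val_lt_last hi
          omega
        have hj' : ((finRotate (m + 1) j : Fin (m + 1)) : ℕ) = j + 1 := by
          rw [finRotate_apply, Fin.val_add_one, if_neg hj]
        rw [Matrix.toSquareBlockProp_def, Matrix.of_apply, Matrix.submatrix_apply, id,
          blockCompanion_mul_apply_of_lt _ _ _ hi', Matrix.neg_apply, Matrix.one_apply]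
        simp only [blockPowers, Matrix.of_apply, he, Equiv.prodCongr_apply, Prod.map_fst,
          Prod.map_snd, Equiv.refl_apply, Fin.le_def, hj', Subtype.mk.injEq, Prod.mk.injEq,
          Fin.ext_iff]
        by_cases hkl : (k : ℕ) = l
        · rcases lt_trichotomy (i : ℕ) j with h | h | h
          · rw [if_neg (by omega), if_neg (by omega), if_neg (by omega)]; ring
          · rw [if_neg (by omega), if_pos (by omega), if_pos (by omega), h]; simp
          · rw [if_pos (by omega), if_pos (by omega), if_neg (by omega),
              show (i : ℕ) + 1 - (j + 1) = (i - (j + 1)) + 1 by omega, pow_succ]; ring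
        · rw [if_neg (by tauto), if_neg (by tauto), if_neg (by tauto)]; ring
      rw [this, Matrix.det_neg, Matrix.det_one, mul_one]
    · have hlast : finRotate (m + 1) (Fin.last m) = 0 := by simp
      let f : Fin n ≃ {p : Fin (m + 1) × Fin n // p.1 = Fin.last m} :=
        { toFun := fun k => ⟨(Fin.last m, k), rfl⟩
          invFun := fun p => p.1.2
          left_inv := fun k => rfl
          right_inv := fun p => Subtype.ext (Prod.ext p.2.symm rfl) }
      rw [← Matrix.det_submatrix_equiv_self f]
      congr 1
      ext k l
      rw [Matrix.submatrix_apply, Matrix.toSquareBlockProp_def, Matrix.of_apply,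
        Matrix.submatrix_apply, id]
      change (blockCompanion w A * blockPowers (m + 1) n w) (Fin.last m, k) (finRotate _ _, l) = _
      rw [hlast, blockCompanion_mul_apply_last _ _ _ (by simp)]
      simp only [blockPowers, Matrix.of_apply, Fin.zero_le, true_and, Fin.val_last, Fin.val_zero,
        Nat.sub_zero, blockPolynomial, Matrix.sub_apply, Matrix.smul_apply, Matrix.sum_apply,
        smul_eq_mul, Matrix.one_apply, mul_ite, mul_zero, Finset.sum_ite_eq', Finset.mem_univ,
        if_true, mul_one]
      congr 1
      · split_ifs
        · rw [pow_succ]; ring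
        · rfl
      · exact Finset.sum_congr rfl fun j _ => mul_comm _ _
  · rintro ⟨i, k⟩ hi ⟨j, l⟩ hj
    have hi' : (i : ℕ) + 1 < m + 1 := by
      have : (i : ℕ) < m := Fin.val_lt_last hi
      omega
    simp only at hj
    subst hj
    have hlast : finRotate (m + 1) (Fin.last m) = 0 := by simp
    change (blockCompanion w A * blockPowers (m + 1) n w) (i, k) (finRotate _ _, l) = _
    rw [hlast, blockCompanion_mul_apply_of_lt _ _ _ hi']
    simp only [blockPowers, Matrix.of_apply, Fin.zero_le, true_and, Fin.val_zero, Nat.sub_zero]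
    split_ifs
    · rw [pow_succ]; ring
    · ring

/-- The two signs in `det_blockCompanion_aux` depend on m and n only. At w = 1, A = 0 both
determinants are 1, so the signs agree and cancel without being computed. -/
lemma det_blockCompanion (hm : 0 < m) (w : R) (A : Fin m → Matrix (Fin n) (Fin n) R) :
    (blockCompanion w A).det = (blockPolynomial w A).det := by
  obtain ⟨m, rfl⟩ := Nat.exists_eq_succ_of_ne_zero hm.ne'
  have h0 := det_blockCompanion_aux (1 : R) (0 : Fin (m + 1) → Matrix (Fin n) (Fin n) R)
  rw [det_blockCompanion_one_zero, blockPolynomial_one_zero, Matrix.det_one, mul_one, mul_one] at h0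
  have h1 := det_blockCompanion_aux w A
  rw [h0] at h1
  have h2 := congrArg
    (fun x => (-1) ^ Fintype.card {p : Fin (m + 1) × Fin n // ¬p.1 = Fin.last m} * x) h1
  simpa only [← mul_assoc, ← mul_pow, neg_mul_neg, one_mul, one_pow] using h2

/-- With Q the inverse of the polynomial, wI - C maps the block column (w^i Q)_i to the last unit
block column: the upper rows cancel and the last row is the polynomial times Q. So it is the last
block column of the inverse, with top block Q. -/
lemma topRightBlock_inv_blockCompanion (hm : 0 < m) (w : R)
    (A : Fin m → Matrix (Fin n) (Fin n) R) (hdet : IsUnit (blockCompanion w A).det) :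
    topRightBlock hm (blockCompanion w A)⁻¹ = (blockPolynomial w A)⁻¹ := by
  have hP : IsUnit (blockPolynomial w A).det := by rwa [← det_blockCompanion hm]
  set Q := (blockPolynomial w A)⁻¹ with hQ
  set X : Matrix (Fin m × Fin n) (Fin n) R := Matrix.of fun p l => w ^ (p.1 : ℕ) * Q p.2 l with hX
  set E : Matrix (Fin m × Fin n) (Fin n) R := Matrix.of fun p l =>
    if (p.1 : ℕ) + 1 < m then 0 else (1 : Matrix (Fin n) (Fin n) R) p.2 l with hE
  have h1 : blockCompanion w A * X = E := by
    ext ⟨i, k⟩ l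
    by_cases hi : (i : ℕ) + 1 < m
    · rw [blockCompanion_mul_apply_of_lt _ _ _ hi]
      simp only [hX, hE, Matrix.of_apply, if_pos hi]
      rw [pow_succ]; ring
    · have him : (i : ℕ) + 1 = m := by have := i.2; omega
      rw [blockCompanion_mul_apply_last _ _ _ hi]
      have h2 : blockPolynomial w A * Q = 1 := Matrix.mul_nonsing_inv _ hP
      have h3 := congrFun (congrFun h2 k) l
      simp only [hX, hE, Matrix.of_apply, if_neg hi]
      rw [← h3, blockPolynomial, Matrix.sub_mul, Matrix.smul_mul, Matrix.one_mul, Matrix.sub_apply,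
        Matrix.smul_apply, smul_eq_mul, ← mul_assoc, ← pow_succ', him, Matrix.sum_mul,
        Matrix.sum_apply]
      congr 1
      refine Finset.sum_congr rfl fun j _ => ?_
      rw [Matrix.smul_mul, Matrix.smul_apply, Matrix.mul_apply, smul_eq_mul, Finset.mul_sum]
      exact Finset.sum_congr rfl fun c _ => by ring
  have h2 : (blockCompanion w A)⁻¹ * E = X := by
    rw [← h1, ← Matrix.mul_assoc, Matrix.nonsing_inv_mul _ hdet, Matrix.one_mul]
  ext a b
  have h3 := congrFun (congrFun h2 (⟨0, hm⟩, a)) b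
  simp only [hX, Matrix.of_apply, pow_zero, one_mul] at h3
  rw [← h3, Matrix.mul_apply, Finset.sum_eq_single (⟨m - 1, Nat.sub_one_lt_of_lt hm⟩, b)]
  · rw [topRightBlock, Matrix.submatrix_apply]
    simp only [hE, Matrix.of_apply]
    rw [if_neg (by omega), Matrix.one_apply_eq, mul_one]
  · rintro ⟨i, k⟩ - hne
    simp only [hE, Matrix.of_apply]
    split_ifs with hi
    · rw [mul_zero]
    · rw [Matrix.one_apply_ne, mul_zero]
      rintro rfl
      exact hne (Prod.ext (Fin.ext (by have := i.2; simp only; omega)) rfl)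
  · simp

end Companion

/-! ### The companion measure -/

section CompanionMeasure
variable {m n : ℕ} {ϖ : Fin m → MatrixMeasure (Fin n)}

lemma companionMeasure_of_lt {i : Fin m} (hi : (i : ℕ) + 1 < m) (k : Fin n) (q : Fin m × Fin n) :
    companionMeasure ϖ (i, k) q =
      if q = (⟨i + 1, hi⟩, k) then (Measure.dirac (0 : ℝ)).toSignedMeasure else 0 := by
  simp only [companionMeasure, Matrix.of_apply, hi, if_true]
  refine if_congr ?_ rfl rfl
  rw [Prod.ext_iff, Fin.ext_iff (a := q.1)]

lemma companionMeasure_last {i : Fin m} (hi : ¬(i : ℕ) + 1 < m) (k : Fin n) (q : Fin m × Fin n) :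
    companionMeasure ϖ (i, k) q = ϖ q.1 k q.2 := by
  simp only [companionMeasure, Matrix.of_apply, hi, if_false]

lemma concentratedOnNonneg_companionMeasure (h : ∀ j, ConcentratedOnNonneg (ϖ j)) :
    ConcentratedOnNonneg (companionMeasure ϖ) := by
  rintro ⟨i, k⟩ q
  by_cases hi : (i : ℕ) + 1 < m
  · rw [companionMeasure_of_lt hi]
    split_ifs
    · rw [totalVariation_toSignedMeasure, Measure.dirac_apply' _ measurableSet_Iio]
      simp
    · rw [totalVariation_zero]; rfl
  · rw [companionMeasure_last hi]; exact h _ _ _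

lemma hasMoment_companionMeasure {p : ℕ} (h : ∀ j, HasMoment (ϖ j) p) :
    HasMoment (companionMeasure ϖ) p := by
  rintro ⟨i, k⟩ q
  by_cases hi : (i : ℕ) + 1 < m
  · rw [companionMeasure_of_lt hi]
    split_ifs
    · rw [totalVariation_toSignedMeasure]
      exact integrable_dirac (by simp)
    · rw [totalVariation_zero]; exact integrable_zero_measure
  · rw [companionMeasure_last hi]; exact h _ _ _

lemma charMatrix_companionMeasure (z : ℂ) :
    charMatrix (companionMeasure ϖ) z = blockCompanion (-z) fun j => laplace (ϖ j) z := by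
  rw [charMatrix, blockCompanion, neg_smul]
  congr 1
  ext ⟨i, k⟩ q
  simp only [laplace, Matrix.of_apply]
  by_cases hi : (i : ℕ) + 1 < m
  · rw [companionMeasure_of_lt hi, if_pos hi]
    by_cases hq : q = (⟨i + 1, hi⟩, k)
    · rw [if_pos hq, if_pos (by rw [hq]; simp), sIntegral_toSignedMeasure, integral_dirac]
      simp
    · rw [if_neg hq, if_neg (by rw [Prod.ext_iff, Fin.ext_iff (a := q.1)] at hq; exact hq), sIntegral_zero]
  · rw [companionMeasure_last hi, if_neg hi]

lemma sum_sIntegral_companionMeasure_of_lt {i : Fin m} (hi : (i : ℕ) + 1 < m) (k : Fin n)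
    (V : Fin m × Fin n → ℝ → ℝ) (t : ℝ) :
    ∑ q, sIntegral (companionMeasure ϖ (i, k) q) (fun v => V q (t - v)) =
      V (⟨i + 1, hi⟩, k) t := by
  rw [Finset.sum_eq_single (⟨i + 1, hi⟩, k)]
  · rw [companionMeasure_of_lt hi, if_pos rfl, sIntegral_toSignedMeasure, integral_dirac, sub_zero]
  · intro q _ hq
    rw [companionMeasure_of_lt hi, if_neg hq, sIntegral_zero]
  · simp

end CompanionMeasure

/-! ### Processes whose increments are stationary in mean -/

open Filter Topology

lemma tendsto_integral_abs_translate_sub {f : ℝ → ℝ} (hf : Integrable f) :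
    Tendsto (fun t => ∫ u, |f (u + t) - f u|) (𝓝 0) (𝓝 0) := by
  have hm : MemLp f 1 volume := memLp_one_iff_integrable.2 hf
  have : Fact ((1 : ENNReal) ≠ ⊤) := ⟨ENNReal.one_ne_top⟩
  set F : Lp ℝ 1 (volume : Measure ℝ) := hm.toLp f with hF
  have hc : Tendsto (fun t : ℝ => ‖(DomAddAct.mk t +ᵥ F : Lp ℝ 1 (volume : Measure ℝ)) - F‖)
      (𝓝 0) (𝓝 0) := by
    have h : Continuous fun t : ℝ =>
        ‖(DomAddAct.mk t +ᵥ F : Lp ℝ 1 (volume : Measure ℝ)) - F‖ := by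
      have h1 : Continuous fun t : ℝ => (DomAddAct.mk t +ᵥ F : Lp ℝ 1 (volume : Measure ℝ)) :=
        DomAddAct.continuous_mk.vadd continuous_const
      exact (h1.sub continuous_const).norm
    simpa using h.tendsto 0
  refine hc.congr fun t => ?_
  have h1 : (DomAddAct.mk t +ᵥ F : Lp ℝ 1 (volume : Measure ℝ)) =
      (hm.comp_measurePreserving (measurePreserving_vadd t volume)).toLp _ :=
    DomAddAct.mk_vadd_toLp t hm
  rw [h1, hF, ← MemLp.toLp_sub, Lp.norm_toLp, eLpNorm_one_eq_lintegral_enorm,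
    ← integral_norm_eq_lintegral_enorm]
  · simp [Function.comp_def, add_comm]
  · exact (hm.comp_measurePreserving (measurePreserving_vadd t volume)).1.sub hm.1

section
variable {Ω : Type*} [MeasurableSpace Ω] {P : Measure Ω}

/-- A measurable and integrable real process with `E|ζ_t - ζ_s|` depending on `t - s` only. -/
structure HasL1Increments (P : Measure Ω) (ζ : ℝ → Ω → ℝ) : Prop where
  measurable : Measurable fun p : ℝ × Ω => ζ p.1 p.2
  integrable : ∀ t, Integrable (ζ t) P
  integral_abs_eq : ∀ s t, ∫ ω, |ζ t ω - ζ s ω| ∂P = ∫ ω, |ζ (t - s) ω - ζ 0 ω| ∂P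

lemma IsMeasurableProcess.eval {n : ℕ} {W : ℝ → Ω → Fin n → ℝ} (hW : IsMeasurableProcess W)
    (t : ℝ) : Measurable (W t) :=
  hW.comp (measurable_const.prodMk measurable_id)

lemma HasStationaryIncrements.hasL1Increments {n : ℕ} {W : ℝ → Ω → Fin n → ℝ}
    (hm : IsMeasurableProcess W) (hi : IsIntegrableProcess P W)
    (hs : HasStationaryIncrements P W) (k : Fin n) :
    HasL1Increments P fun t ω => W t ω k where
  measurable := (measurable_pi_apply k).comp hm
  integrable t := (hi t).eval k
  integral_abs_eq s t := by
    set T : Finset ℝ := {t - s}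
    have hT : t - s ∈ T := by simp [T]
    have h := hs s T
    set F : (T → Fin n → ℝ) → ℝ := fun x => |x ⟨t - s, hT⟩ k|
    have hF : Measurable F := by fun_prop
    have hmeas : ∀ a : ℝ → ℝ, ∀ b : ℝ, Measurable fun ω (u : T) => W (a u) ω - W b ω := by
      intro a b
      exact measurable_pi_lambda _ fun u => (hm.eval _).sub (hm.eval _)
    have h2 : ∫ x, F x ∂P.map (fun ω (u : T) => W (u + s) ω - W s ω) =
        ∫ x, F x ∂P.map (fun ω (u : T) => W u ω - W 0 ω) := by rw [h]
    rw [integral_map (hmeas (fun u => u + s) s).aemeasurable hF.aestronglyMeasurable,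
      integral_map (hmeas (fun u => u) 0).aemeasurable hF.aestronglyMeasurable] at h2
    simpa [F] using h2

namespace HasL1Increments
variable {ζ : ℝ → Ω → ℝ} (hζ : HasL1Increments P ζ)
include hζ

lemma measurable_eval (t : ℝ) : Measurable (ζ t) :=
  hζ.measurable.comp (measurable_const.prodMk measurable_id)

lemma measurable_path (ω : Ω) : Measurable fun t => ζ t ω :=
  hζ.measurable.comp (measurable_id.prodMk measurable_const)

lemma integrable_abs_sub (s t : ℝ) : Integrable (fun ω => |ζ t ω - ζ s ω|) P :=
  ((hζ.integrable t).sub (hζ.integrable s)).abs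

lemma measurable_integral_abs [SFinite P] : Measurable fun t => ∫ ω, |ζ t ω - ζ 0 ω| ∂P :=
  (StronglyMeasurable.integral_prod_right (f := fun t ω => |ζ t ω - ζ 0 ω|)
    (Measurable.stronglyMeasurable (hζ.measurable.sub
      ((hζ.measurable_eval 0).comp measurable_snd)).abs)).measurable

lemma integral_abs_triangle (s t u : ℝ) :
    ∫ ω, |ζ u ω - ζ s ω| ∂P ≤ ∫ ω, |ζ t ω - ζ s ω| ∂P + ∫ ω, |ζ u ω - ζ t ω| ∂P := by
  rw [← integral_add (hζ.integrable_abs_sub s t) (hζ.integrable_abs_sub t u)]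
  refine integral_mono (hζ.integrable_abs_sub s u)
    ((hζ.integrable_abs_sub s t).add (hζ.integrable_abs_sub t u)) fun ω => ?_
  simp only
  rw [add_comm]
  exact abs_sub_le _ _ _

lemma integral_abs_nat_mul_le (t : ℝ) (N : ℕ) :
    ∫ ω, |ζ (N * t) ω - ζ 0 ω| ∂P ≤ N * ∫ ω, |ζ t ω - ζ 0 ω| ∂P := by
  induction N with
  | zero => simp
  | succ N ih =>
    refine (hζ.integral_abs_triangle 0 (N * t) _).trans ?_
    rw [hζ.integral_abs_eq (N * t)]
    have : ((N + 1 : ℕ) : ℝ) * t - N * t = t := by push_cast; ring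
    rw [this]
    push_cast
    linarith

/-- A Steinhaus argument. φ(t) = E|ζ_t - ζ_0| is measurable and finite, hence bounded by some N on a
subset of [0, 1] of positive measure; the differences of that set fill a neighbourhood of 0, where φ
≤ 2N. Subadditivity spreads this to linear growth. -/
lemma exists_integral_abs_le [SFinite P] :
    ∃ C, 0 ≤ C ∧ ∀ s t, ∫ ω, |ζ t ω - ζ s ω| ∂P ≤ C * (1 + |t - s|) := by
  set φ : ℝ → ℝ := fun t => ∫ ω, |ζ t ω - ζ 0 ω| ∂P with hφ
  have hφ0 : ∀ t, 0 ≤ φ t := fun t => integral_nonneg fun ω => abs_nonneg _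
  obtain ⟨N, hN⟩ : ∃ N : ℕ, volume ({t | φ t ≤ N} ∩ Set.Icc 0 1) ≠ 0 := by
    by_contra! h
    have h1 : volume (⋃ N : ℕ, {t | φ t ≤ N} ∩ Set.Icc (0 : ℝ) 1) = 0 :=
      measure_iUnion_null h
    have h2 : (⋃ N : ℕ, {t | φ t ≤ N} ∩ Set.Icc (0 : ℝ) 1) = Set.Icc 0 1 := by
      rw [← Set.iUnion_inter]
      refine Set.inter_eq_right.2 fun t _ => Set.mem_iUnion.2 (exists_nat_ge (φ t))
    rw [h2] at h1
    simp at h1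
  have hE : MeasurableSet ({t | φ t ≤ N} ∩ Set.Icc (0 : ℝ) 1) :=
    (measurableSet_le hζ.measurable_integral_abs measurable_const).inter measurableSet_Icc
  have hnhds := Measure.sub_mem_nhds_zero_of_addHaar_pos_ne_top volume _ hE
    (pos_iff_ne_zero.2 hN) ((measure_mono Set.inter_subset_right).trans_lt (by simp)).ne
  obtain ⟨δ, hδ, hball⟩ := Metric.mem_nhds_iff.1 hnhds
  have hsmall : ∀ t, |t| < δ → φ t ≤ 2 * N := by
    intro t ht
    obtain ⟨a, ha, b, hb, hab⟩ := hball (by simpa using ht : t ∈ Metric.ball 0 δ)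
    have h1 : φ t = ∫ ω, |ζ a ω - ζ b ω| ∂P := by rw [hζ.integral_abs_eq b a, hφ, ← hab]
    rw [h1]
    refine (hζ.integral_abs_triangle b 0 a).trans ?_
    have h2 : ∫ ω, |ζ 0 ω - ζ b ω| ∂P = φ b := by simp only [hφ, abs_sub_comm]
    rw [h2]
    have h3 : φ b ≤ N := hb.1
    have h4 : φ a ≤ N := ha.1
    linarith
  have hgen : ∀ t, φ t ≤ (2 * N * (2 + 2 / δ)) * (1 + |t|) := by
    intro t
    -- The number of steps makes |t|/K smaller than δ and grows only linearly in |t|.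
    set K : ℕ := ⌈2 * |t| / δ⌉₊ + 1 with hK
    have hK0 : (0 : ℝ) < K := by positivity
    have hK1 : 2 * |t| / δ < K := by
      rw [hK]; push_cast
      exact (Nat.le_ceil _).trans_lt (lt_add_one _)
    have hK2 : (K : ℝ) ≤ 2 * |t| / δ + 2 := by
      have := (Nat.ceil_lt_add_one (by positivity : 0 ≤ 2 * |t| / δ)).le
      rw [hK]; push_cast; linarith
    have h1 := hζ.integral_abs_nat_mul_le (t / K) K
    rw [mul_div_cancel₀ _ hK0.ne'] at h1
    have h2 : φ (t / K) ≤ 2 * N := by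
      apply hsmall
      rw [abs_div, abs_of_pos hK0, div_lt_iff₀ hK0]
      rw [div_lt_iff₀ hδ] at hK1
      nlinarith [abs_nonneg t]
    calc φ t ≤ K * φ (t / K) := h1
      _ ≤ (2 * |t| / δ + 2) * (2 * N) :=
        mul_le_mul hK2 h2 (hφ0 _) (by positivity)
      _ ≤ _ := by
        have h3 : 2 * |t| / δ + 2 ≤ (2 + 2 / δ) * (1 + |t|) := by
          have : (2 + 2 / δ) * (1 + |t|) = 2 * |t| / δ + 2 + (2 * |t| + 2 / δ) := by ring
          rw [this]
          exact le_add_of_nonneg_right (by positivity)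
        calc _ ≤ (2 + 2 / δ) * (1 + |t|) * (2 * N) := by gcongr
          _ = _ := by ring
  refine ⟨2 * N * (2 + 2 / δ), by positivity, fun s t => ?_⟩
  rw [hζ.integral_abs_eq]
  exact hgen _

/-- Almost every path is locally integrable. -/
lemma ae_integrableOn [IsFiniteMeasure P] :
    ∀ᵐ ω ∂P, ∀ N : ℕ, IntegrableOn (fun t => ζ t ω) (Set.Icc (-N) N) := by
  obtain ⟨C, hC, hbound⟩ := hζ.exists_integral_abs_le
  refine ae_all_iff.2 fun N => ?_
  have hint : Integrable (Function.uncurry fun t ω => ζ t ω - ζ 0 ω)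
      ((volume.restrict (Set.Icc (-N : ℝ) N)).prod P) := by
    refine (integrable_prod_iff (Measurable.aestronglyMeasurable
      (hζ.measurable.sub ((hζ.measurable_eval 0).comp measurable_snd)))).2
      ⟨Eventually.of_forall fun t => (hζ.integrable t).sub (hζ.integrable 0), ?_⟩
    refine Integrable.mono' (g := fun t => C * (1 + |t|)) ?_
      (hζ.measurable_integral_abs.aestronglyMeasurable)
      (Eventually.of_forall fun t => ?_)
    · exact (Continuous.continuousOn (by fun_prop)).integrableOn_compact isCompact_Icc
    · rw [Real.norm_of_nonneg (integral_nonneg fun ω => norm_nonneg _)]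
      simpa using hbound 0 t
  filter_upwards [hint.prod_left_ae] with ω hω
  have := hω.add (integrable_const (ζ 0 ω))
  refine this.congr (Eventually.of_forall fun t => ?_)
  simp

/-- `E|ζ_t - ζ_0| → 0` as `t → 0`. -/
lemma tendsto_integral_abs [IsFiniteMeasure P] :
    Tendsto (fun t => ∫ ω, |ζ t ω - ζ 0 ω| ∂P) (𝓝 0) (𝓝 0) := by
  obtain ⟨C, hC, hbound⟩ := hζ.exists_integral_abs_le
  have hint : ∀ t, Integrable (Function.uncurry fun u ω => |ζ (u + t) ω - ζ u ω|)
      ((volume.restrict (Set.Ioc (0 : ℝ) 1)).prod P) := by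
    intro t
    have hm : Measurable (Function.uncurry fun u ω => |ζ (u + t) ω - ζ u ω|) :=
      ((hζ.measurable.comp ((measurable_fst.add_const t).prodMk measurable_snd)).sub
        hζ.measurable).abs
    refine (integrable_prod_iff hm.aestronglyMeasurable).2
      ⟨Eventually.of_forall fun u => hζ.integrable_abs_sub u (u + t), ?_⟩
    refine (integrable_const (∫ ω, |ζ t ω - ζ 0 ω| ∂P)).congr
      (Eventually.of_forall fun u => ?_)
    simp only [Function.uncurry_apply_pair, norm_abs_eq_norm, Real.norm_eq_abs]
    rw [hζ.integral_abs_eq u, add_sub_cancel_left]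
  -- The base point may be averaged over (0, 1], as the mean depends on the time difference only.
  -- This replaces continuity of paths, which is not assumed, by continuity of translations in L¹
  -- along each path.
  have heq : ∀ t, ∫ ω, |ζ t ω - ζ 0 ω| ∂P =
      ∫ ω, (∫ u in Set.Ioc (0 : ℝ) 1, |ζ (u + t) ω - ζ u ω|) ∂P := by
    intro t
    rw [← integral_integral_swap (hint t)]
    have : ∀ u, ∫ ω, |ζ (u + t) ω - ζ u ω| ∂P = ∫ ω, |ζ t ω - ζ 0 ω| ∂P := fun u => by
      rw [hζ.integral_abs_eq u, add_sub_cancel_left]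
    simp [this]
  simp only [heq]
  -- For |t| ≤ 1 and u in (0, 1] the points u and u + t lie in [-1, 2], so 2D dominates.
  set D : Ω → ℝ := fun ω => ∫ u in Set.Icc (-1 : ℝ) 2, |ζ u ω - ζ 0 ω| with hD
  have hDint : Integrable (Function.uncurry fun u ω => |ζ u ω - ζ 0 ω|)
      ((volume.restrict (Set.Icc (-1 : ℝ) 2)).prod P) := by
    have hm : Measurable (Function.uncurry fun u ω => |ζ u ω - ζ 0 ω|) :=
      (hζ.measurable.sub ((hζ.measurable_eval 0).comp measurable_snd)).abs
    refine (integrable_prod_iff hm.aestronglyMeasurable).2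
      ⟨Eventually.of_forall fun u => hζ.integrable_abs_sub 0 u, ?_⟩
    refine Integrable.mono' (g := fun t => C * (1 + |t|)) ?_
      hm.norm.stronglyMeasurable.integral_prod_right.aestronglyMeasurable
      (Eventually.of_forall fun t => ?_)
    · exact (Continuous.continuousOn (by fun_prop)).integrableOn_compact isCompact_Icc
    · rw [Real.norm_of_nonneg (integral_nonneg fun ω => norm_nonneg _)]
      simpa using hbound 0 t
  have h0 : Tendsto (fun t => ∫ ω, (∫ u in Set.Ioc (0 : ℝ) 1, |ζ (u + t) ω - ζ u ω|) ∂P) (𝓝 0)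
      (𝓝 (∫ _, (0 : ℝ) ∂P)) := ?_
  · rwa [integral_zero] at h0
  refine tendsto_integral_filter_of_dominated_convergence (fun ω => D ω + D ω) ?_ ?_
    (hDint.integral_prod_right.add hDint.integral_prod_right) ?_
  · exact Eventually.of_forall fun t => (hint t).integral_prod_right.1
  · have hball : ∀ᶠ t : ℝ in 𝓝 0, |t| ≤ 1 := by
      filter_upwards [Metric.closedBall_mem_nhds (0 : ℝ) one_pos] with t ht
      simpa using ht
    filter_upwards [hball] with t ht
    filter_upwards [hDint.prod_left_ae] with ω hω
    rw [Real.norm_of_nonneg (integral_nonneg fun u => abs_nonneg _)]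
    have hω' : IntegrableOn (fun u => |ζ u ω - ζ 0 ω|) (Set.Icc (-1 : ℝ) 2) := hω
    have hpre : IntegrableOn (fun u => |ζ (u + t) ω - ζ 0 ω|) (Set.Ioc (0 : ℝ) 1) := by
      have h := (measurePreserving_add_right volume t).integrableOn_comp_preimage
        (measurableEmbedding_addRight t) (f := fun u => |ζ u ω - ζ 0 ω|) (s := Set.Icc (-1 : ℝ) 2)
      refine (h.2 hω').mono_set fun u hu => ?_
      rw [abs_le] at ht
      exact ⟨by linarith [hu.1], by linarith [hu.2]⟩
    have h0 : IntegrableOn (fun u => |ζ u ω - ζ 0 ω|) (Set.Ioc (0 : ℝ) 1) :=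
      hω'.mono_set fun u hu => ⟨by linarith [hu.1], by linarith [hu.2]⟩
    calc ∫ u in Set.Ioc (0 : ℝ) 1, |ζ (u + t) ω - ζ u ω|
        ≤ ∫ u in Set.Ioc (0 : ℝ) 1, (|ζ (u + t) ω - ζ 0 ω| + |ζ u ω - ζ 0 ω|) := by
          refine integral_mono_of_nonneg (Eventually.of_forall fun u => abs_nonneg _)
            (hpre.add h0) (Eventually.of_forall fun u => ?_)
          have := abs_sub_le (ζ (u + t) ω) (ζ 0 ω) (ζ u ω)
          rwa [abs_sub_comm (ζ 0 ω)] at this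
      _ = (∫ u in Set.Ioc (0 : ℝ) 1, |ζ (u + t) ω - ζ 0 ω|) +
            ∫ u in Set.Ioc (0 : ℝ) 1, |ζ u ω - ζ 0 ω| := integral_add hpre h0
      _ ≤ D ω + D ω := by
          refine add_le_add ?_ ?_
          · rw [← intervalIntegral.integral_of_le zero_le_one,
              intervalIntegral.integral_comp_add_right (fun u => |ζ u ω - ζ 0 ω|),
              intervalIntegral.integral_of_le (by linarith)]
            refine setIntegral_mono_set hω' (Eventually.of_forall fun u => abs_nonneg _)
              (LE.le.eventuallyLE fun u hu => ?_)
            rw [abs_le] at ht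
            exact ⟨by linarith [hu.1], by linarith [hu.2]⟩
          · exact setIntegral_mono_set hω' (Eventually.of_forall fun u => abs_nonneg _)
              (LE.le.eventuallyLE fun u hu =>
                ⟨by linarith [hu.1], by linarith [hu.2]⟩)
  · filter_upwards [hDint.prod_left_ae] with ω hω
    set f : ℝ → ℝ := (Set.Icc (-1 : ℝ) 2).indicator fun u => ζ u ω - ζ 0 ω with hf
    have hfi : Integrable f := by
      refine (integrable_indicator_iff measurableSet_Icc).2 ?_
      exact (integrable_norm_iff ((hζ.measurable_path ω).sub_const _).aestronglyMeasurable).1 hω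
    have hball : ∀ᶠ t : ℝ in 𝓝 0, |t| ≤ 1 := by
      filter_upwards [Metric.closedBall_mem_nhds (0 : ℝ) one_pos] with t ht
      simpa using ht
    refine squeeze_zero' (Eventually.of_forall fun t => integral_nonneg fun u => abs_nonneg _) ?_
      (tendsto_integral_abs_translate_sub hfi)
    filter_upwards [hball] with t ht
    rw [abs_le] at ht
    calc ∫ u in Set.Ioc (0 : ℝ) 1, |ζ (u + t) ω - ζ u ω|
        = ∫ u in Set.Ioc (0 : ℝ) 1, |f (u + t) - f u| := by
          refine setIntegral_congr_fun measurableSet_Ioc fun u hu => ?_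
          have h1 : u + t ∈ Set.Icc (-1 : ℝ) 2 := ⟨by linarith [hu.1], by linarith [hu.2]⟩
          have h2 : u ∈ Set.Icc (-1 : ℝ) 2 := ⟨by linarith [hu.1], by linarith [hu.2]⟩
          simp [hf, h1, h2]
      _ ≤ _ := setIntegral_le_integral ((hfi.comp_add_right t).sub hfi).abs
          (Eventually.of_forall fun u => abs_nonneg _)

end HasL1Increments
end

/-! ### Moving averages of the increments of a process -/

/-- A measurable integrable function with first moment. -/
structure HasFirstMoment (φ : ℝ → ℝ) : Prop where
  measurable : Measurable φ
  integrable : Integrable φ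
  integrable_abs_mul : Integrable fun r => |r| * φ r

lemma HasFirstMoment.integrable_bound {φ : ℝ → ℝ} (hφ : HasFirstMoment φ) (C : ℝ) :
    Integrable fun r => C * (1 + |r|) * |φ r| :=
  integrable_one_add_abs_mul hφ.integrable hφ.integrable_abs_mul C

section
variable {Ω : Type*} [MeasurableSpace Ω] {P : Measure Ω} {ζ : ℝ → Ω → ℝ} {φ : ℝ → ℝ}

/-- `∫ (ζ(t - s(r)) - ζ(t)) φ(r) dr` for a simple function `s`, as a finite sum. -/
def simpleIncrConv (φ : ℝ → ℝ) (s : SimpleFunc ℝ ℝ) (ζ : ℝ → ℝ) (t : ℝ) : ℝ :=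
  ∑ c ∈ s.range, (ζ (t - c) - ζ t) * ∫ r in s ⁻¹' {c}, φ r

lemma integral_comp_simpleFunc_mul (hφ : Integrable φ) (s : SimpleFunc ℝ ℝ) (ζ : ℝ → ℝ) (t : ℝ) :
    ∫ r, (ζ (t - s r) - ζ t) * φ r = simpleIncrConv φ s ζ t := by
  have h : ∀ r, (ζ (t - s r) - ζ t) * φ r =
      ∑ c ∈ s.range, (ζ (t - c) - ζ t) * (s ⁻¹' {c}).indicator φ r := by
    intro r
    rw [Finset.sum_eq_single (s r)]
    · simp
    · intro c _ hc
      have : r ∉ s ⁻¹' {c} := fun h => hc h.symm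
      simp [this]
    · intro h
      exact absurd (SimpleFunc.mem_range_self s r) h
  simp only [h]
  rw [integral_finsetSum _ fun c _ => (hφ.indicator (s.measurableSet_preimage _)).const_mul _]
  unfold simpleIncrConv
  refine Finset.sum_congr rfl fun c _ => ?_
  rw [integral_const_mul, integral_indicator (s.measurableSet_preimage _)]

namespace HasL1Increments

lemma integral_norm_mul_le {C : ℝ}
    (hC : ∀ s t, ∫ ω, |ζ t ω - ζ s ω| ∂P ≤ C * (1 + |t - s|)) (hC0 : 0 ≤ C) {a b r x : ℝ}
    (hab : |a - b| ≤ |r|) :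
    ∫ ω, ‖(ζ a ω - ζ b ω) * x‖ ∂P ≤ C * (1 + |r|) * |x| := by
  simp only [norm_mul, Real.norm_eq_abs]
  rw [integral_mul_const]
  refine mul_le_mul_of_nonneg_right ((hC b a).trans ?_) (abs_nonneg _)
  gcongr

variable (hζ : HasL1Increments P ζ)
include hζ

lemma measurable_incrConv (hφ : Measurable φ) [SFinite P] :
    Measurable fun p : ℝ × Ω => incrConv φ (fun u => ζ u p.2) p.1 := by
  refine (StronglyMeasurable.integral_prod_right
    (f := fun (p : ℝ × Ω) r => (ζ (p.1 - r) p.2 - ζ p.1 p.2) * φ r)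
    (Measurable.stronglyMeasurable (Measurable.mul (Measurable.sub ?_ ?_) ?_))).measurable
  · exact hζ.measurable.comp (f := fun x : (ℝ × Ω) × ℝ => (x.1.1 - x.2, x.1.2)) (by fun_prop)
  · exact hζ.measurable.comp (f := fun x : (ℝ × Ω) × ℝ => x.1) (by fun_prop)
  · exact hφ.comp measurable_snd

lemma measurable_incrConv_eval (hφ : Measurable φ) [SFinite P] (t : ℝ) :
    Measurable fun ω => incrConv φ (fun u => ζ u ω) t :=
  (hζ.measurable_incrConv hφ).comp (measurable_const.prodMk measurable_id)

lemma integrable_prod_incr [IsFiniteMeasure P] (hφ : HasFirstMoment φ) {a b : ℝ → ℝ}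
    (ha : Measurable a) (hb : Measurable b) (hab : ∀ r, |a r - b r| ≤ |r|) :
    Integrable (Function.uncurry fun r ω => (ζ (a r) ω - ζ (b r) ω) * φ r)
      (volume.prod P) := by
  obtain ⟨C, hC0, hC⟩ := hζ.exists_integral_abs_le
  have hm : Measurable (Function.uncurry fun r ω => (ζ (a r) ω - ζ (b r) ω) * φ r) :=
    ((hζ.measurable.comp ((ha.comp measurable_fst).prodMk measurable_snd)).sub
      (hζ.measurable.comp ((hb.comp measurable_fst).prodMk measurable_snd))).mul
      (hφ.measurable.comp measurable_fst)
  refine (integrable_prod_iff hm.aestronglyMeasurable).2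
    ⟨Eventually.of_forall fun r =>
      ((hζ.integrable (a r)).sub (hζ.integrable (b r))).mul_const (φ r), ?_⟩
  refine (hφ.integrable_bound C).mono'
    hm.norm.stronglyMeasurable.integral_prod_right.aestronglyMeasurable
    (Eventually.of_forall fun r => ?_)
  rw [Real.norm_of_nonneg (integral_nonneg fun ω => norm_nonneg _)]
  exact integral_norm_mul_le hC hC0 (x := φ r) (hab r)

lemma integrable_prod_sub [IsFiniteMeasure P] (hφ : HasFirstMoment φ) (t : ℝ) :
    Integrable (Function.uncurry fun r ω => (ζ (t - r) ω - ζ t ω) * φ r) (volume.prod P) :=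
  hζ.integrable_prod_incr hφ (measurable_const.sub measurable_id) measurable_const
    fun r => by simp

lemma integrable_incrConv [IsFiniteMeasure P] (hφ : HasFirstMoment φ) (t : ℝ) :
    Integrable (fun ω => incrConv φ (fun u => ζ u ω) t) P :=
  (hζ.integrable_prod_sub hφ t).integral_prod_right

lemma exists_integral_abs_incrConv_le [IsFiniteMeasure P] (hφ : HasFirstMoment φ) :
    ∃ B, ∀ t, ∫ ω, |incrConv φ (fun u => ζ u ω) t| ∂P ≤ B := by
  obtain ⟨C, hC0, hC⟩ := hζ.exists_integral_abs_le
  refine ⟨∫ r, C * (1 + |r|) * |φ r|, fun t => ?_⟩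
  have hi := hζ.integrable_prod_sub hφ t
  calc ∫ ω, |incrConv φ (fun u => ζ u ω) t| ∂P
      ≤ ∫ ω, (∫ r, ‖(ζ (t - r) ω - ζ t ω) * φ r‖) ∂P :=
        integral_mono (hζ.integrable_incrConv hφ t).abs hi.norm.integral_prod_right
          fun ω => norm_integral_le_integral_norm fun r => (ζ (t - r) ω - ζ t ω) * φ r
    _ = ∫ r, (∫ ω, ‖(ζ (t - r) ω - ζ t ω) * φ r‖ ∂P) := (integral_integral_swap hi.norm).symm
    _ ≤ _ := integral_mono hi.norm.integral_prod_left (hφ.integrable_bound C)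
        fun r => integral_norm_mul_le hC hC0 (by simp)

/-- By Fubini the mean over an event passes through the moving average, which reduces statements
about `ζ` to the deterministic function u ↦ E[1_A ζ_u]. -/
lemma setIntegral_incrConv [IsFiniteMeasure P] (hφ : HasFirstMoment φ) (A : Set Ω) (t : ℝ) :
    ∫ ω in A, incrConv φ (fun u => ζ u ω) t ∂P = incrConv φ (fun u => ∫ ω in A, ζ u ω ∂P) t := by
  have hi : Integrable (Function.uncurry fun r ω => (ζ (t - r) ω - ζ t ω) * φ r)
      (volume.prod (P.restrict A)) :=
    (hζ.integrable_prod_sub hφ t).mono_measure (Measure.prod_mono le_rfl Measure.restrict_le_self)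
  unfold incrConv
  rw [← integral_integral_swap hi]
  congr 1; ext r
  rw [integral_mul_const, integral_sub (hζ.integrable _).integrableOn (hζ.integrable _).integrableOn]

lemma abs_setIntegral_sub_le [IsFiniteMeasure P] (A : Set Ω) (s t : ℝ) :
    |∫ ω in A, ζ t ω ∂P - ∫ ω in A, ζ s ω ∂P| ≤ ∫ ω, |ζ (t - s) ω - ζ 0 ω| ∂P := by
  rw [← integral_sub (hζ.integrable _).integrableOn (hζ.integrable _).integrableOn,
    ← hζ.integral_abs_eq]
  have h : ∫ ω in A, |ζ t ω - ζ s ω| ∂P ≤ ∫ ω, |ζ t ω - ζ s ω| ∂P :=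
    setIntegral_le_integral (hζ.integrable_abs_sub s t) (Eventually.of_forall fun ω => abs_nonneg _)
  exact (norm_integral_le_integral_norm fun ω => ζ t ω - ζ s ω).trans h

lemma exists_abs_setIntegral_le [IsFiniteMeasure P] (A : Set Ω) :
    ∃ C, ∀ s t, |∫ ω in A, ζ t ω ∂P - ∫ ω in A, ζ s ω ∂P| ≤ C * (1 + |t - s|) := by
  obtain ⟨C, hC0, hC⟩ := hζ.exists_integral_abs_le
  refine ⟨C, fun s t => (hζ.abs_setIntegral_sub_le A s t).trans ?_⟩
  rw [← hζ.integral_abs_eq]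
  exact hC s t

/-- Continuity in mean suffices; the paths of `ζ` need not be continuous. This is the regularity
that the deterministic convolution identities require. -/
lemma continuous_setIntegral [IsFiniteMeasure P] (A : Set Ω) :
    Continuous fun t => ∫ ω in A, ζ t ω ∂P := by
  refine continuous_iff_continuousAt.2 fun s => ?_
  refine tendsto_iff_norm_sub_tendsto_zero.2 (squeeze_zero (fun t => norm_nonneg _)
    (fun t => hζ.abs_setIntegral_sub_le A s t) ?_)
  refine hζ.tendsto_integral_abs.comp ?_
  have : Continuous fun t : ℝ => t - s := by fun_prop
  simpa using this.tendsto s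

/-- Moving averages of increments are limits in mean of finite linear combinations of
increments. -/
lemma tendsto_integral_abs_simpleIncrConv_sub [IsFiniteMeasure P] (hφ : HasFirstMoment φ)
    {S : Set ℝ} (h0 : (0 : ℝ) ∈ S) (hS : ∀ r ∉ S, φ r = 0) (t : ℝ) :
    Tendsto (fun N => ∫ ω, |simpleIncrConv φ (SimpleFunc.approxOn id measurable_id S 0 h0 N)
      (fun u => ζ u ω) t - incrConv φ (fun u => ζ u ω) t| ∂P) atTop (𝓝 0) := by
  set s : ℕ → SimpleFunc ℝ ℝ := fun N => SimpleFunc.approxOn id measurable_id S 0 h0 N with hs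
  -- `approxOn` never does worse than its base point 0, so the error stays within |r|; this gives a
  -- dominating function independent of N.
  have hsr : ∀ N r, |r - s N r| ≤ |r| := by
    intro N r
    have h := SimpleFunc.edist_approxOn_le (measurable_id (α := ℝ)) h0 r N
    rw [edist_dist, edist_dist, ENNReal.ofReal_le_ofReal_iff dist_nonneg] at h
    simpa [Real.dist_eq, abs_sub_comm] using h
  obtain ⟨C, hC0, hC⟩ := hζ.exists_integral_abs_le
  set ψ : ℝ → ℝ := fun u => ∫ ω, |ζ u ω - ζ 0 ω| ∂P with hψ
  have hψ0 : ∀ u, 0 ≤ ψ u := fun u => integral_nonneg fun ω => abs_nonneg _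
  have hle : ∀ N, ∫ ω, |simpleIncrConv φ (s N) (fun u => ζ u ω) t -
      incrConv φ (fun u => ζ u ω) t| ∂P ≤ ∫ r, ψ (r - s N r) * |φ r| := by
    intro N
    have hi1 := hζ.integrable_prod_incr hφ (a := fun r => t - s N r) (b := fun r => t - r)
      (measurable_const.sub (s N).measurable) (measurable_const.sub measurable_id)
      fun r => by simpa using hsr N r
    have hi2 := hζ.integrable_prod_sub hφ t
    calc _ ≤ ∫ ω, (∫ r, ‖(ζ (t - s N r) ω - ζ (t - r) ω) * φ r‖) ∂P := by
          refine integral_mono_of_nonneg (Eventually.of_forall fun ω => abs_nonneg _)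
            hi1.norm.integral_prod_right ?_
          filter_upwards [hi1.prod_left_ae, hi2.prod_left_ae] with ω h1 h2
          rw [← integral_comp_simpleFunc_mul hφ.integrable]
          simp only [Function.uncurry_apply_pair] at h1 h2
          have h3 : Integrable fun r => (ζ (t - s N r) ω - ζ t ω) * φ r :=
            (h1.add h2).congr (Eventually.of_forall fun r => by simp only [Pi.add_apply]; ring)
          unfold incrConv
          rw [← integral_sub h3 h2]
          refine (norm_integral_le_integral_norm (G := ℝ) _).trans_eq ?_
          congr 1; ext r; congr 1; ring
      _ = ∫ r, (∫ ω, ‖(ζ (t - s N r) ω - ζ (t - r) ω) * φ r‖ ∂P) :=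
          (integral_integral_swap hi1.norm).symm
      _ = _ := by
          congr 1; ext r
          simp only [norm_mul, Real.norm_eq_abs]
          rw [integral_mul_const, hζ.integral_abs_eq, sub_sub_sub_cancel_left]
  refine squeeze_zero (fun N => integral_nonneg fun ω => abs_nonneg _) hle ?_
  rw [show (0 : ℝ) = ∫ _ : ℝ, (0 : ℝ) by simp]
  refine tendsto_integral_of_dominated_convergence (fun r => C * (1 + |r|) * |φ r|) ?_
    (hφ.integrable_bound C) ?_ ?_
  · exact fun N => ((hζ.measurable_integral_abs.comp
      (measurable_id.sub (s N).measurable)).mul hφ.measurable.abs).aestronglyMeasurable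
  · refine fun N => Eventually.of_forall fun r => ?_
    rw [Real.norm_of_nonneg (mul_nonneg (hψ0 _) (abs_nonneg _))]
    refine mul_le_mul_of_nonneg_right ((hC 0 _).trans ?_) (abs_nonneg _)
    rw [sub_zero]
    exact mul_le_mul_of_nonneg_left (add_le_add_right (hsr N r) 1) hC0
  · refine Eventually.of_forall fun r => ?_
    by_cases hr : r ∈ S
    · have h1 : Tendsto (fun N => r - s N r) atTop (𝓝 0) := by
        have := (SimpleFunc.tendsto_approxOn (measurable_id (α := ℝ)) h0
          (x := r) (subset_closure hr)).const_sub r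
        simpa using this
      simpa using (hζ.tendsto_integral_abs.comp h1).mul_const |φ r|
    · simp [hS r hr]

end HasL1Increments
end

/-! ### Laws of moving averages -/

section
variable {Ω : Type*} [MeasurableSpace Ω] {P : Measure Ω}

lemma tendstoInMeasure_of_tendsto_integral_abs {J : Type*} [Fintype J] {f : ℕ → Ω → J → ℝ}
    {g : Ω → J → ℝ} (hf : ∀ N j, Integrable (fun ω => f N ω j) P)
    (hg : ∀ j, Integrable (fun ω => g ω j) P)
    (h : ∀ j, Tendsto (fun N => ∫ ω, |f N ω j - g ω j| ∂P) atTop (𝓝 0)) :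
    TendstoInMeasure P f atTop g := by
  have hf' : ∀ N, Integrable (f N) P := fun N => Integrable.of_eval fun j => hf N j
  have hg' : Integrable g P := Integrable.of_eval fun j => hg j
  refine tendstoInMeasure_of_tendsto_eLpNorm one_ne_zero (fun N => (hf' N).1) hg'.1 ?_
  have h1 : Tendsto (fun N => ∫ ω, ‖(f N - g) ω‖ ∂P) atTop (𝓝 0) := by
    have h2 : Tendsto (fun N => ∑ j, ∫ ω, |f N ω j - g ω j| ∂P) atTop (𝓝 0) := by
      simpa using tendsto_finsetSum Finset.univ fun j _ => h j
    refine squeeze_zero (fun N => integral_nonneg fun ω => norm_nonneg _) (fun N => ?_) h2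
    have hd : ∀ j, Integrable (fun ω => |f N ω j - g ω j|) P := fun j =>
      ((hf N j).sub (hg j)).abs
    rw [← integral_finsetSum _ fun j _ => hd j]
    refine integral_mono ((hf' N).sub hg').norm (integrable_finsetSum _ fun j _ => hd j)
      fun ω => ?_
    refine (pi_norm_le_iff_of_nonneg (Finset.sum_nonneg fun j _ => abs_nonneg _)).2 fun j => ?_
    exact Finset.single_le_sum (f := fun j => |f N ω j - g ω j|) (fun j _ => abs_nonneg _)
      (Finset.mem_univ j)
  have h3 := ENNReal.tendsto_ofReal h1
  rw [ENNReal.ofReal_zero] at h3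
  refine h3.congr fun N => ?_
  rw [eLpNorm_one_eq_lintegral_enorm, ofReal_integral_norm_eq_lintegral_enorm ((hf' N).sub hg')]

lemma HasL1Increments.integrable_simpleIncrConv {ζ : ℝ → Ω → ℝ} (hζ : HasL1Increments P ζ)
    (φ : ℝ → ℝ) (s : SimpleFunc ℝ ℝ) (t : ℝ) :
    Integrable (fun ω => simpleIncrConv φ s (fun u => ζ u ω) t) P :=
  integrable_finsetSum _ fun c _ => ((hζ.integrable (t - c)).sub (hζ.integrable t)).mul_const _

section
variable {n : ℕ} {W : ℝ → Ω → Fin n → ℝ}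

/-- Only finitely many times enter. Each W(t - c) - W(t) is a difference of two increments from a
common base time, so the variables are one fixed measurable function of a vector whose law is shift
invariant. -/
lemma HasStationaryIncrements.map_simpleIncrConv (hm : IsMeasurableProcess W)
    (hs : HasStationaryIncrements P W) {J : Type*} [Fintype J] (φ : J → ℝ → ℝ) (b : J → Fin n)
    (t : J → ℝ) (s : SimpleFunc ℝ ℝ) (τ : ℝ) :
    P.map (fun ω j => simpleIncrConv (φ j) s (fun u => W u ω (b j)) (t j + τ)) =
      P.map (fun ω j => simpleIncrConv (φ j) s (fun u => W u ω (b j)) (t j)) := by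
  classical
  set T : Finset ℝ := Finset.univ.biUnion fun j => insert (t j) (s.range.image fun c => t j - c)
    with hT
  have hT1 : ∀ j, t j ∈ T := fun j => Finset.mem_biUnion.2 ⟨j, Finset.mem_univ _, by simp⟩
  have hT2 : ∀ j, ∀ c ∈ s.range, t j - c ∈ T := fun j c hc =>
    Finset.mem_biUnion.2 ⟨j, Finset.mem_univ _,
      Finset.mem_insert_of_mem (Finset.mem_image_of_mem _ hc)⟩
  set F : (T → Fin n → ℝ) → J → ℝ := fun x j =>
    simpleIncrConv (φ j) s (fun u => if h : u ∈ T then x ⟨u, h⟩ (b j) else 0) (t j) with hF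
  have hFm : Measurable F := by
    refine measurable_pi_lambda _ fun j => Finset.measurable_fun_sum _ fun c _ => ?_
    have hd : ∀ u : ℝ, Measurable fun x : T → Fin n → ℝ =>
        if h : u ∈ T then x ⟨u, h⟩ (b j) else 0 := by
      intro u
      by_cases h : u ∈ T
      · simp only [h, dif_pos]; fun_prop
      · simp only [h, dif_neg, not_false_eq_true]; fun_prop
    exact ((hd _).sub (hd _)).mul_const _
  have hFW : ∀ σ : ℝ, (fun ω j => simpleIncrConv (φ j) s (fun u => W u ω (b j)) (t j + σ)) =
      F ∘ fun ω (u : T) => W (u + σ) ω - W σ ω := by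
    intro σ
    ext ω j
    simp only [hF, Function.comp_apply, simpleIncrConv]
    refine Finset.sum_congr rfl fun c hc => ?_
    rw [dif_pos (hT2 j c hc), dif_pos (hT1 j)]
    simp only [Pi.sub_apply, sub_sub_sub_cancel_right]
    rw [sub_add_eq_add_sub]
  have hinc : ∀ σ : ℝ, Measurable fun ω (u : T) => W (u + σ) ω - W σ ω := fun σ =>
    measurable_pi_lambda _ fun u => (hm.eval _).sub (hm.eval _)
  have h0 := hFW 0
  simp only [add_zero] at h0
  have h0' := hinc 0
  simp only [add_zero] at h0'
  rw [hFW τ, h0, ← Measure.map_map hFm (hinc τ), hs τ T, Measure.map_map hFm h0']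

/-- The joint law of moving averages of stationary increments is invariant under time shifts. -/
lemma HasStationaryIncrements.map_incrConv [IsProbabilityMeasure P] (hm : IsMeasurableProcess W)
    (hi : IsIntegrableProcess P W) (hs : HasStationaryIncrements P W) {J : Type*} [Fintype J]
    {φ : J → ℝ → ℝ} (hφ : ∀ j, HasFirstMoment (φ j)) (b : J → Fin n) (t : J → ℝ) (τ : ℝ) :
    P.map (fun ω j => incrConv (φ j) (fun u => W u ω (b j)) (t j + τ)) =
      P.map (fun ω j => incrConv (φ j) (fun u => W u ω (b j)) (t j)) := by
  have hW := hs.hasL1Increments hm hi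
  set s : ℕ → SimpleFunc ℝ ℝ :=
    fun N => SimpleFunc.approxOn id measurable_id Set.univ 0 (Set.mem_univ _) N with hsdef
  have hlim : ∀ σ : ℝ, TendstoInDistribution
      (fun N ω j => simpleIncrConv (φ j) (s N) (fun u => W u ω (b j)) (t j + σ)) atTop
      (fun ω j => incrConv (φ j) (fun u => W u ω (b j)) (t j + σ)) (fun _ => P) P := by
    intro σ
    refine (tendstoInMeasure_of_tendsto_integral_abs
      (fun N j => (hW (b j)).integrable_simpleIncrConv (φ j) (s N) (t j + σ))
      (fun j => (hW (b j)).integrable_incrConv (hφ j) (t j + σ)) fun j => ?_).tendstoInDistribution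
      fun N => ?_
    · exact (hW (b j)).tendsto_integral_abs_simpleIncrConv_sub (hφ j) (Set.mem_univ 0)
        (fun r hr => absurd (Set.mem_univ r) hr) (t j + σ)
    · exact aemeasurable_pi_lambda _ fun j =>
        ((hW (b j)).integrable_simpleIncrConv (φ j) (s N) (t j + σ)).1.aemeasurable
  have h0 := hlim 0
  simp only [add_zero] at h0
  -- The two approximating sequences have equal laws term by term, and limits in distribution are
  -- unique.
  have heq := tendsto_nhds_unique (hlim τ).tendsto (h0.tendsto.congr fun N =>
    Subtype.ext (hs.map_simpleIncrConv hm φ b t (s N) τ).symm)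
  exact congrArg Subtype.val heq

lemma IsStationary.hasStationaryIncrements (hm : IsMeasurableProcess W) (hs : IsStationary P W) :
    HasStationaryIncrements P W := by
  classical
  intro r T
  set T' : Finset ℝ := insert 0 T with hT'
  set F : (T' → Fin n → ℝ) → T → Fin n → ℝ := fun x u =>
    x ⟨u, Finset.mem_insert_of_mem u.2⟩ - x ⟨0, Finset.mem_insert_self _ _⟩ with hF
  have hFm : Measurable F := by fun_prop
  have h1 : ∀ σ : ℝ, (fun ω (u : T) => W (u + σ) ω - W (0 + σ) ω) =
      F ∘ fun ω (u : T') => W (u + σ) ω := fun σ => rfl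
  have h2 : (fun ω (u : T) => W u ω - W 0 ω) = F ∘ fun ω (u : T') => W u ω := rfl
  have h3 := h1 r
  simp only [zero_add] at h3
  rw [h3, h2, ← Measure.map_map hFm (measurable_pi_lambda _ fun u => hm.eval _), hs r T',
    Measure.map_map hFm (measurable_pi_lambda _ fun u => hm.eval _)]

/-- The process `∑_b ∫ (W^b(t - r) - W^b(t)) ψ_ab(r) dr`. -/
def movingAverage (ψ : Fin n → Fin n → ℝ → ℝ) (W : ℝ → Ω → Fin n → ℝ) (t : ℝ) (ω : Ω)
    (a : Fin n) : ℝ :=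
  ∑ b, incrConv (ψ a b) (fun u => W u ω b) t

variable {ψ : Fin n → Fin n → ℝ → ℝ}

lemma isMeasurableProcess_movingAverage [IsProbabilityMeasure P] (hm : IsMeasurableProcess W)
    (hi : IsIntegrableProcess P W) (hs : HasStationaryIncrements P W)
    (hψ : ∀ a b, HasFirstMoment (ψ a b)) : IsMeasurableProcess (movingAverage ψ W) :=
  measurable_pi_lambda _ fun a => Finset.measurable_fun_sum _ fun b _ =>
    (hs.hasL1Increments hm hi b).measurable_incrConv (hψ a b).measurable

lemma isIntegrableProcess_movingAverage [IsProbabilityMeasure P] (hm : IsMeasurableProcess W)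
    (hi : IsIntegrableProcess P W) (hs : HasStationaryIncrements P W)
    (hψ : ∀ a b, HasFirstMoment (ψ a b)) : IsIntegrableProcess P (movingAverage ψ W) :=
  fun t => Integrable.of_eval fun a => integrable_finsetSum _ fun b _ =>
    (hs.hasL1Increments hm hi b).integrable_incrConv (hψ a b) t

lemma isStationary_movingAverage [IsProbabilityMeasure P] (hm : IsMeasurableProcess W)
    (hi : IsIntegrableProcess P W) (hs : HasStationaryIncrements P W)
    (hψ : ∀ a b, HasFirstMoment (ψ a b)) : IsStationary P (movingAverage ψ W) := by
  intro r T
  have h := hs.map_incrConv hm hi (J := T × Fin n × Fin n) (φ := fun j => ψ j.2.1 j.2.2)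
    (fun j => hψ _ _) (fun j => j.2.2) (fun j => j.1) r
  set F : (T × Fin n × Fin n → ℝ) → T → Fin n → ℝ := fun x u a => ∑ b, x (u, a, b) with hF
  have hFm : Measurable F := by fun_prop
  have hmeas : ∀ σ : ℝ, Measurable fun ω (j : T × Fin n × Fin n) =>
      incrConv (ψ j.2.1 j.2.2) (fun u => W u ω j.2.2) (j.1 + σ) := fun σ =>
    measurable_pi_lambda _ fun j =>
      (hs.hasL1Increments hm hi j.2.2).measurable_incrConv_eval (hψ _ _).measurable _
  have hmeas0 := hmeas 0
  simp only [add_zero] at hmeas0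
  calc _ = P.map (F ∘ fun ω (j : T × Fin n × Fin n) =>
        incrConv (ψ j.2.1 j.2.2) (fun u => W u ω j.2.2) (j.1 + r)) := rfl
    _ = P.map (F ∘ fun ω (j : T × Fin n × Fin n) =>
        incrConv (ψ j.2.1 j.2.2) (fun u => W u ω j.2.2) j.1) := by
      rw [← Measure.map_map hFm (hmeas r), h, Measure.map_map hFm hmeas0]
    _ = _ := rfl

/-- Stationarity is preserved by modifications. -/
lemma IsStationary.congr {W' : ℝ → Ω → Fin n → ℝ} (hs : IsStationary P W)
    (h : ∀ t, W' t =ᵐ[P] W t) : IsStationary P W' := by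
  intro r T
  have h1 : ∀ f : T → ℝ, (fun ω (u : T) => W' (f u) ω) =ᵐ[P] fun ω (u : T) => W (f u) ω := by
    intro f
    filter_upwards [ae_all_iff.2 fun u : T => h (f u)] with ω hω
    exact funext hω
  rw [Measure.map_congr (h1 fun u => u + r), Measure.map_congr (h1 fun u => u)]
  exact hs r T

end

/-! ### Causality -/

/-- Approximating the identity by simple functions with values in [0, ∞) makes the moving average a
limit in mean of combinations of past increments. The limsup along an almost surely convergent
subsequence is a version that is measurable everywhere. -/
lemma HasStationaryIncrements.exists_measurable_pastIncrements [IsProbabilityMeasure P] {n : ℕ}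
    {Z : ℝ → Ω → Fin n → ℝ} (hm : IsMeasurableProcess Z) (hi : IsIntegrableProcess P Z)
    (hs : HasStationaryIncrements P Z) {φ : ℝ → ℝ} (hφ : HasFirstMoment φ)
    (h0 : ∀ r < 0, φ r = 0) (b : Fin n) (t : ℝ) :
    ∃ ξ : Ω → ℝ, Measurable[pastIncrements Z t] ξ ∧
      (fun ω => incrConv φ (fun u => Z u ω b) t) =ᵐ[P] ξ := by
  have hZ := hs.hasL1Increments hm hi b
  set s : ℕ → SimpleFunc ℝ ℝ :=
    fun N => SimpleFunc.approxOn id measurable_id (Set.Ici 0) 0 (Set.mem_Ici.2 le_rfl) N with hsdef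
  have hlim : TendstoInMeasure P
      (fun N ω (_ : Unit) => simpleIncrConv φ (s N) (fun u => Z u ω b) t) atTop
      (fun ω _ => incrConv φ (fun u => Z u ω b) t) :=
    tendstoInMeasure_of_tendsto_integral_abs
      (fun N _ => hZ.integrable_simpleIncrConv φ (s N) t)
      (fun _ => hZ.integrable_incrConv hφ t) fun _ =>
      hZ.tendsto_integral_abs_simpleIncrConv_sub hφ _ (fun r hr => h0 r (not_le.1 hr)) t
  obtain ⟨ns, -, hns⟩ := hlim.exists_seq_tendsto_ae
  refine ⟨fun ω => limsup (fun i => simpleIncrConv φ (s (ns i)) (fun u => Z u ω b) t) atTop,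
    ?_, ?_⟩
  · refine Measurable.limsup fun i => Finset.measurable_fun_sum _ fun c hc => ?_
    refine Measurable.mul_const ?_ _
    obtain ⟨r, rfl⟩ := SimpleFunc.mem_range.1 hc
    have hr : (0 : ℝ) ≤ s (ns i) r := SimpleFunc.approxOn_mem measurable_id _ _ _
    rcases hr.eq_or_lt with h | h
    -- The value c = 0 does not give a time strictly before t, but its increment is identically
    -- zero.
    · simp only [← h, sub_zero, sub_self]
      exact measurable_const
    · have h1 : Measurable[pastIncrements Z t] fun ω => Z t ω - Z (t - s (ns i) r) ω :=
        Measurable.mono (comap_measurable _)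
          (le_iSup (fun s : Set.Iio t => MeasurableSpace.comap (fun ω => Z t ω - Z s ω)
            inferInstance) ⟨t - s (ns i) r, by simpa using h⟩) le_rfl
      have h2 : Measurable[pastIncrements Z t] fun ω => -(Z t ω - Z (t - s (ns i) r) ω) b :=
        ((measurable_pi_apply b).comp h1).neg
      simpa using h2
  · filter_upwards [hns] with ω hω
    exact ((tendsto_pi_nhds.1 hω ()).limsup_eq).symm

end

/-! ### Integrals of primitives with respect to a regular integrator -/

section
variable {Ω : Type*} [MeasurableSpace Ω] {P : Measure Ω} {I : L1L2 →ₗ[ℝ] Lp ℝ 1 P}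
  {ζ : ℝ → Ω → ℝ}

lemma integ_of_memLp {f : ℝ → ℝ} (h : MemLp f 1 volume ∧ MemLp f 2 volume) :
    integ I f = ⇑(I (toL1L2 f h)) := dif_pos h

lemma integ_congr {f g : ℝ → ℝ} (h : f =ᵐ[volume] g) : integ I f = integ I g := by
  by_cases hf : MemLp f 1 volume ∧ MemLp f 2 volume
  · have hg : MemLp g 1 volume ∧ MemLp g 2 volume :=
      ⟨(memLp_congr_ae h).1 hf.1, (memLp_congr_ae h).1 hf.2⟩
    have heq : toL1L2 f hf = toL1L2 g hg := Subtype.ext (AEEqFun.mk_eq_mk.2 h)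
    rw [integ_of_memLp hf, integ_of_memLp hg, heq]
  · have hg : ¬(MemLp g 1 volume ∧ MemLp g 2 volume) := fun hg =>
      hf ⟨(memLp_congr_ae h).2 hg.1, (memLp_congr_ae h).2 hg.2⟩
    rw [integ, integ, dif_neg hf, dif_neg hg]

lemma integ_sub {f g : ℝ → ℝ} (hf : MemLp f 1 volume ∧ MemLp f 2 volume)
    (hg : MemLp g 1 volume ∧ MemLp g 2 volume) :
    integ I (fun u => f u - g u) =ᵐ[P] fun ω => integ I f ω - integ I g ω := by
  have hfg : MemLp (fun u => f u - g u) 1 volume ∧ MemLp (fun u => f u - g u) 2 volume :=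
    ⟨hf.1.sub hg.1, hf.2.sub hg.2⟩
  have heq : toL1L2 _ hfg = toL1L2 f hf - toL1L2 g hg := rfl
  rw [integ_of_memLp hfg, integ_of_memLp hf, integ_of_memLp hg, heq, map_sub]
  exact Lp.coeFn_sub _ _

lemma integ_zero : integ I (fun _ => 0) =ᵐ[P] fun _ => 0 := by
  have h : MemLp (fun _ : ℝ => (0 : ℝ)) 1 volume ∧ MemLp (fun _ : ℝ => (0 : ℝ)) 2 volume :=
    ⟨MemLp.zero', MemLp.zero'⟩
  have heq : toL1L2 _ h = 0 := rfl
  rw [integ_of_memLp h, heq, map_zero]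
  exact Lp.coeFn_zero _ _ _

lemma memLp_indicator_Ioc (s t : ℝ) (p : ENNReal) :
    MemLp ((Set.Ioc s t).indicator (1 : ℝ → ℝ)) p volume :=
  memLp_indicator_const p measurableSet_Ioc 1 (Or.inr (by simp))

/-- Under u ↦ t - u the interval [r, 0) becomes (t, t - r] and [0, r) becomes (t - r, t], so the
half-open conventions match and the increment rule applies, with a minus sign for r > 0. -/
lemma IsRegularIntegral.integ_stepDiff (hI : IsRegularIntegral P ζ I) (r t : ℝ) :
    integ I (fun u => stepDiff r (t - u)) =ᵐ[P] fun ω => ζ (t - r) ω - ζ t ω := by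
  rcases lt_trichotomy r 0 with hr | rfl | hr
  · have : (fun u => stepDiff r (t - u)) = (Set.Ioc t (t - r)).indicator 1 := by
      ext u
      rw [stepDiff_of_nonpos hr.le]
      simp only [Set.indicator, Set.mem_Ico, Set.mem_Ioc, Pi.one_apply]
      split_ifs <;> grind
    rw [this]
    exact hI.increment t (t - r) (by linarith)
  · have : (fun u => stepDiff 0 (t - u)) = fun _ => 0 := by
      ext u; simp [stepDiff]
    rw [this]
    filter_upwards [integ_zero (I := I)] with ω hω
    simp [hω]
  · have : (fun u => stepDiff r (t - u)) =
        fun u => 0 - (Set.Ioc (t - r) t).indicator 1 u := by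
      ext u
      rw [stepDiff_of_nonneg hr.le]
      simp only [Set.indicator, Set.mem_Ico, Set.mem_Ioc, Pi.one_apply]
      split_ifs <;> grind
    rw [this]
    filter_upwards [integ_sub (I := I) ⟨MemLp.zero', MemLp.zero'⟩
      ⟨memLp_indicator_Ioc (t - r) t 1, memLp_indicator_Ioc (t - r) t 2⟩,
      integ_zero (I := I), hI.increment (t - r) t (by linarith)] with ω h1 h2 h3
    rw [h1, h2, h3]; ring

lemma abs_stepDiff_le_one (r v : ℝ) : |stepDiff r v| ≤ 1 := by
  rcases le_total 0 r with hr | hr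
  · rw [stepDiff_of_nonneg hr, abs_neg]
    by_cases h : v ∈ Set.Ico 0 r <;> simp [h]
  · rw [stepDiff_of_nonpos hr]
    by_cases h : v ∈ Set.Ico r 0 <;> simp [h]

lemma HasFirstMoment.integrable_stepDiff_mul {φ : ℝ → ℝ} (hφ : HasFirstMoment φ) (v : ℝ) :
    Integrable fun r => stepDiff r v * φ r :=
  hφ.integrable.bdd_mul (c := 1)
    (measurable_stepDiff.comp (measurable_const.prodMk measurable_id)).aestronglyMeasurable
    (Eventually.of_forall fun r => abs_stepDiff_le_one r v)

lemma HasFirstMoment.memLp_stepPrimitive {φ : ℝ → ℝ} (hφ : HasFirstMoment φ) :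
    MemLp (stepPrimitive φ) 1 volume ∧ MemLp (stepPrimitive φ) 2 volume := by
  have h1 := integrable_stepPrimitive hφ.measurable hφ.integrable_abs_mul
  have hb : ∀ v, ‖stepPrimitive φ v‖ ≤ ∫ r, |φ r| := fun v =>
    norm_integral_le_of_norm_le hφ.integrable.abs (Eventually.of_forall fun r => by
      rw [norm_mul]
      exact mul_le_of_le_one_left (abs_nonneg _) (abs_stepDiff_le_one r v))
  refine ⟨memLp_one_iff_integrable.2 h1, (memLp_two_iff_integrable_sq h1.1).2 ?_⟩
  simp only [pow_two]
  exact h1.mul_bdd (c := ∫ r, |φ r|) h1.1 (Eventually.of_forall hb)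

lemma memLp_comp_sub_left {f : ℝ → ℝ} {p : ENNReal} (hf : MemLp f p volume) (t : ℝ) :
    MemLp (fun u => f (t - u)) p volume :=
  hf.comp_measurePreserving (Measure.measurePreserving_sub_left volume t)

/-- The Fubini property is applied to the finite measure φ(r) dr; by `integ_stepDiff`, r ↦ ζ(t - r)
- ζ(t) is a jointly measurable version of the inner integrals. -/
lemma IsRegularIntegral.integ_stepPrimitive_of_nonneg (hI : IsRegularIntegral P ζ I)
    (hζ : HasL1Increments P ζ) {φ : ℝ → ℝ} (hφ : HasFirstMoment φ) (h0 : ∀ r, 0 ≤ φ r) (t : ℝ) :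
    integ I (fun u => stepPrimitive φ (t - u)) =ᵐ[P] fun ω => incrConv φ (fun u => ζ u ω) t := by
  set μ : Measure ℝ := volume.withDensity fun r => ENNReal.ofReal (φ r) with hμ
  have hfin : IsFiniteMeasure μ := isFiniteMeasure_withDensity_ofReal hφ.integrable.2
  have hint : ∀ k : ℝ → ℝ, ∫ r, k r ∂μ = ∫ r, k r * φ r := by
    intro k
    rw [hμ, integral_withDensity_eq_integral_toReal_smul hφ.measurable.ennreal_ofReal
      (Eventually.of_forall fun r => ENNReal.ofReal_lt_top)]
    congr 1; ext r
    rw [ENNReal.toReal_ofReal (h0 r), smul_eq_mul, mul_comm]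
  have hmom : Integrable (fun r : ℝ => |r|) μ := by
    rw [hμ, integrable_withDensity_iff hφ.measurable.ennreal_ofReal
      (Eventually.of_forall fun r => ENNReal.ofReal_lt_top)]
    simpa only [ENNReal.toReal_ofReal (h0 _)] using hφ.integrable_abs_mul
  have h := hI.fubini μ hmom t (fun r ω => ζ (t - r) ω - ζ t ω)
    ((hζ.measurable.comp ((measurable_const.sub measurable_fst).prodMk measurable_snd)).sub
      ((hζ.measurable_eval t).comp measurable_snd)) fun r => (hI.integ_stepDiff r t).symm
  simp only [hint] at h
  exact h

/-- The integral of `G(t - ·)` for a primitive `G` of a function `φ` with vanishing jump. -/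
lemma IsRegularIntegral.integ_eq_incrConv [IsFiniteMeasure P] (hI : IsRegularIntegral P ζ I)
    (hζ : HasL1Increments P ζ) {φ G : ℝ → ℝ} (hφ : HasFirstMoment φ)
    (hG : G =ᵐ[volume] stepPrimitive φ) (t : ℝ) :
    integ I (fun u => G (t - u)) =ᵐ[P] fun ω => incrConv φ (fun u => ζ u ω) t := by
  -- The Fubini property concerns positive measures, hence the splitting of `φ`; the two pathwise
  -- integrals converge almost surely and can be recombined.
  have hpos : HasFirstMoment fun r => max (φ r) 0 :=
    ⟨hφ.measurable.max measurable_const, hφ.integrable.pos_part,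
      hφ.integrable_abs_mul.pos_part.congr (Eventually.of_forall fun r => by
        simp only [mul_max_of_nonneg _ _ (abs_nonneg r), mul_zero])⟩
  have hneg : HasFirstMoment fun r => max (-φ r) 0 :=
    ⟨hφ.measurable.neg.max measurable_const, hφ.integrable.neg_part,
      hφ.integrable_abs_mul.neg_part.congr (Eventually.of_forall fun r => by
        simp only [mul_max_of_nonneg _ _ (abs_nonneg r), mul_zero, mul_neg])⟩
  have hsplit : ∀ x : ℝ, max x 0 - max (-x) 0 = x := fun x => by
    rcases le_total 0 x with h | h <;> simp [h]
  have h1 : integ I (fun u => G (t - u)) = integ I fun u =>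
      stepPrimitive (fun r => max (φ r) 0) (t - u) -
        stepPrimitive (fun r => max (-φ r) 0) (t - u) := by
    refine integ_congr ?_
    have := (quasiMeasurePreserving_sub_left volume t).ae hG
    filter_upwards [this] with u hu
    rw [hu]
    unfold stepPrimitive
    rw [← integral_sub (hpos.integrable_stepDiff_mul _) (hneg.integrable_stepDiff_mul _)]
    simp only [← mul_sub, hsplit]
  rw [h1]
  filter_upwards [integ_sub (I := I)
    ⟨memLp_comp_sub_left hpos.memLp_stepPrimitive.1 t,
      memLp_comp_sub_left hpos.memLp_stepPrimitive.2 t⟩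
    ⟨memLp_comp_sub_left hneg.memLp_stepPrimitive.1 t,
      memLp_comp_sub_left hneg.memLp_stepPrimitive.2 t⟩,
    hI.integ_stepPrimitive_of_nonneg hζ hpos (fun r => le_max_right _ _) t,
    hI.integ_stepPrimitive_of_nonneg hζ hneg (fun r => le_max_right _ _) t,
    (hζ.integrable_prod_sub hpos t).prod_left_ae,
    (hζ.integrable_prod_sub hneg t).prod_left_ae] with ω e1 e2 e3 i1 i2
  rw [e1, e2, e3]
  simp only [Function.uncurry_apply_pair] at i1 i2
  unfold incrConv
  simp only
  rw [← integral_sub i1 i2]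
  simp only [← mul_sub, hsplit]

end

/-! ### Delay integrals of processes bounded in mean -/

section
variable {Ω : Type*} [MeasurableSpace Ω] {P : Measure Ω}

/-- A measurable real process with bounded first absolute moment. -/
structure IsBoundedInMean (P : Measure Ω) (y : ℝ → Ω → ℝ) (B : ℝ) : Prop where
  measurable : Measurable fun p : ℝ × Ω => y p.1 p.2
  integrable : ∀ t, Integrable (y t) P
  bound : ∀ t, ∫ ω, |y t ω| ∂P ≤ B

namespace IsBoundedInMean
variable {y : ℝ → Ω → ℝ} {B : ℝ} (hy : IsBoundedInMean P y B)
include hy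

lemma congr {y' : ℝ → Ω → ℝ} (hm : Measurable fun p : ℝ × Ω => y' p.1 p.2)
    (h : ∀ t, y' t =ᵐ[P] y t) : IsBoundedInMean P y' B where
  measurable := hm
  integrable t := (hy.integrable t).congr (h t).symm
  bound t := by
    have h1 : (fun ω => |y' t ω|) =ᵐ[P] fun ω => |y t ω| := (h t).mono fun ω hω => by
      simp only [hω]
    rw [integral_congr_ae h1]
    exact hy.bound t

lemma abs_setIntegral_le (A : Set Ω) (t : ℝ) : |∫ ω in A, y t ω ∂P| ≤ B := by
  have h : ∫ ω in A, |y t ω| ∂P ≤ ∫ ω, |y t ω| ∂P :=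
    setIntegral_le_integral (hy.integrable t).abs (Eventually.of_forall fun ω => abs_nonneg _)
  exact (norm_integral_le_integral_norm fun ω => y t ω).trans (h.trans (hy.bound t))

lemma integrable_prod [SFinite P] {β : Type*} [MeasurableSpace β] (κ : Measure β)
    [IsFiniteMeasure κ] {τ : β → ℝ} (hτ : Measurable τ) :
    Integrable (fun x : Ω × β => y (τ x.2) x.1) (P.prod κ) := by
  have hm : Measurable fun x : Ω × β => y (τ x.2) x.1 :=
    hy.measurable.comp ((hτ.comp measurable_snd).prodMk measurable_fst)
  refine (integrable_prod_iff' hm.aestronglyMeasurable).2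
    ⟨Eventually.of_forall fun b => hy.integrable (τ b), ?_⟩
  refine (integrable_const B).mono'
    hm.norm.stronglyMeasurable.integral_prod_left'.aestronglyMeasurable
    (Eventually.of_forall fun b => ?_)
  rw [Real.norm_of_nonneg (integral_nonneg fun ω => norm_nonneg _)]
  exact hy.bound (τ b)

lemma ae_integrable_comp [SFinite P] {β : Type*} [MeasurableSpace β] (κ : Measure β)
    [IsFiniteMeasure κ] {τ : β → ℝ} (hτ : Measurable τ) :
    ∀ᵐ ω ∂P, Integrable (fun x => y (τ x) ω) κ :=
  (hy.integrable_prod κ hτ).prod_right_ae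

lemma restrict (A : Set Ω) : IsBoundedInMean (P.restrict A) y B where
  measurable := hy.measurable
  integrable t := (hy.integrable t).integrableOn
  bound t := (setIntegral_le_integral (hy.integrable t).abs
    (Eventually.of_forall fun _ => abs_nonneg _)).trans (hy.bound t)

variable [SFinite P] (ν : Measure ℝ) [IsFiniteMeasure ν] (μ : SignedMeasure ℝ)

lemma integrable_prod_sIntegral :
    Integrable (fun x : Ω × ℝ => sIntegral μ fun v => y (x.2 - v) x.1) (P.prod ν) := by
  have h := hy.integrable_prod (ν.prod μ.totalVariation) (τ := fun x => x.1 - x.2)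
    (measurable_fst.sub measurable_snd)
  exact integrable_sIntegral (f := fun (x : Ω × ℝ) v => y (x.2 - v) x.1)
    ((measurePreserving_prodAssoc P ν μ.totalVariation).integrable_comp_of_integrable h)

lemma integrable_integral_sIntegral :
    Integrable (fun ω => ∫ u, (sIntegral μ fun v => y (u - v) ω) ∂ν) P :=
  (hy.integrable_prod_sIntegral ν μ).integral_prod_left

lemma integral_integral_sIntegral :
    ∫ ω, (∫ u, (sIntegral μ fun v => y (u - v) ω) ∂ν) ∂P =
      ∫ u, (sIntegral μ fun v => ∫ ω, y (u - v) ω ∂P) ∂ν := by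
  rw [integral_integral_swap (hy.integrable_prod_sIntegral ν μ)]
  congr 1; ext u
  exact integral_sIntegral_swap (f := fun ω v => y (u - v) ω)
    (hy.integrable_prod μ.totalVariation (τ := fun v => u - v)
      (measurable_const.sub measurable_id))

end IsBoundedInMean

lemma HasL1Increments.exists_isBoundedInMean_incrConv [IsFiniteMeasure P] {ζ : ℝ → Ω → ℝ}
    (hζ : HasL1Increments P ζ) {φ : ℝ → ℝ} (hφ : HasFirstMoment φ) :
    ∃ B, IsBoundedInMean P (fun t ω => incrConv φ (fun u => ζ u ω) t) B := by
  obtain ⟨B, hB⟩ := hζ.exists_integral_abs_incrConv_le hφ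
  exact ⟨B, hζ.measurable_incrConv hφ.measurable, hζ.integrable_incrConv hφ, hB⟩

lemma exists_isBoundedInMean_sum {κ : Type*} [Fintype κ] {y : κ → ℝ → Ω → ℝ}
    (hy : ∀ k, ∃ B, IsBoundedInMean P (y k) B) :
    ∃ B, IsBoundedInMean P (fun t ω => ∑ k, y k t ω) B := by
  choose B hB using hy
  refine ⟨∑ k, B k, Finset.measurable_fun_sum _ fun k _ => (hB k).measurable,
    fun t => integrable_finsetSum _ fun k _ => (hB k).integrable t, fun t => ?_⟩
  calc ∫ ω, |∑ k, y k t ω| ∂P ≤ ∫ ω, ∑ k, |y k t ω| ∂P :=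
        integral_mono (integrable_finsetSum _ fun k _ => (hB k).integrable t).abs
          (integrable_finsetSum _ fun k _ => ((hB k).integrable t).abs)
          fun ω => Finset.abs_sum_le_sum_abs _ _
    _ = ∑ k, ∫ ω, |y k t ω| ∂P := integral_finsetSum _ fun k _ => ((hB k).integrable t).abs
    _ ≤ _ := Finset.sum_le_sum fun k _ => (hB k).bound t

/-! ### The first-order equation -/

section
variable {ι : Type*} [Fintype ι] [DecidableEq ι] {η : MatrixMeasure ι} {g : ℝ → Matrix ι ι ℝ}
  {n : ℕ} {Z : ℝ → Ω → Fin n → ℝ}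

lemma IsKernel.hasFirstMoment (hg : IsKernel η g) (p q : ι) :
    HasFirstMoment (kernelDeriv η g p q) :=
  ⟨hg.measurable_deriv p q, hg.integrable_deriv p q, hg.integrable_abs_mul_deriv p q⟩

/-- The moving averages with respect to the derivative of the kernel solve the first-order
equation. -/
lemma IsKernel.ae_sub_eq [IsFiniteMeasure P] (hg : IsKernel η g)
    (hZ : ∀ b, HasL1Increments P fun t ω => Z t ω b) (c : Fin n → ι) {x : ι → ℝ → Ω → ℝ}
    (hxm : ∀ q, Measurable fun p : ℝ × Ω => x q p.1 p.2)
    (hx : ∀ q t, x q t =ᵐ[P] fun ω =>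
      ∑ b, incrConv (kernelDeriv η g q (c b)) (fun u => Z u ω b) t)
    (p : ι) {s t : ℝ} (hst : s ≤ t) :
    ∀ᵐ ω ∂P, x p t ω - x p s ω =
      (∑ q, ∫ u in s..t, sIntegral (η p q) fun v => x q (u - v) ω) +
        ∑ b, (1 : Matrix ι ι ℝ) p (c b) * (Z t ω b - Z s ω b) := by
  have hB : ∀ q, ∃ B, IsBoundedInMean P (x q) B := by
    intro q
    obtain ⟨B, hB⟩ := exists_isBoundedInMean_sum fun b =>
      (hZ b).exists_isBoundedInMean_incrConv (hg.hasFirstMoment q (c b))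
    exact ⟨B, hB.congr (hxm q) (hx q)⟩
  choose B hB using hB
  have hi1 : ∀ q, Integrable
      (fun ω => ∫ u in s..t, sIntegral (η p q) fun v => x q (u - v) ω) P := by
    intro q
    simp only [intervalIntegral.integral_of_le hst]
    exact (hB q).integrable_integral_sIntegral _ _
  have hi2 : ∀ b, Integrable (fun ω => (1 : Matrix ι ι ℝ) p (c b) * (Z t ω b - Z s ω b)) P :=
    fun b => (((hZ b).integrable t).sub ((hZ b).integrable s)).const_mul _
  have hi3 := (integrable_finsetSum Finset.univ fun q _ => hi1 q)
  have hi4 := (integrable_finsetSum Finset.univ fun b _ => hi2 b)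
  -- Both sides are integrable, so it suffices to compare their means over every event A. There `Z`
  -- turns into continuous functions of time, and the claim into `sum_integral_sIntegral_incrConv`.
  refine Integrable.ae_eq_of_forall_setIntegral_eq _ _
    (((hB p).integrable t).sub ((hB p).integrable s)) (hi3.add hi4) fun A hA _ => ?_
  set z : Fin n → ℝ → ℝ := fun b u => ∫ ω in A, Z u ω b ∂P with hz
  have hzc : ∀ b, Continuous (z b) := fun b => (hZ b).continuous_setIntegral A
  choose C hC using fun b => (hZ b).exists_abs_setIntegral_le A
  have hxA : ∀ q u, ∫ ω in A, x q u ω ∂P = ∑ b, incrConv (kernelDeriv η g q (c b)) (z b) u := by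
    intro q u
    rw [integral_congr_ae (ae_restrict_of_ae (hx q u)), integral_finsetSum _ fun b _ =>
      ((hZ b).integrable_incrConv (hg.hasFirstMoment q (c b)) u).integrableOn]
    exact Finset.sum_congr rfl fun b _ =>
      (hZ b).setIntegral_incrConv (hg.hasFirstMoment q (c b)) A u
  have hb : ∀ q b u, |incrConv (kernelDeriv η g q (c b)) (z b) u| ≤
      ∫ r, C b * (1 + |r|) * |kernelDeriv η g q (c b) r| := fun q b u =>
    abs_incrConv_le (hg.integrable_deriv q (c b)) (hg.integrable_abs_mul_deriv q (c b)) (hC b) u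
  have hm : ∀ q b, Measurable (incrConv (kernelDeriv η g q (c b)) (z b)) := fun q b =>
    MSDDE.measurable_incrConv (hg.measurable_deriv q (c b)) (hzc b).measurable
  have hprod : ∀ q b, Integrable (Function.uncurry fun u v =>
      incrConv (kernelDeriv η g q (c b)) (z b) (u - v))
      ((volume.restrict (Set.Ioc s t)).prod (η p q).totalVariation) := fun q b =>
    (integrable_const _).mono' ((hm q b).comp (measurable_fst.sub measurable_snd)
      ).aestronglyMeasurable (Eventually.of_forall fun x => hb q b _)
  have h1 : ∀ q, ∫ ω in A, (∫ u in s..t, sIntegral (η p q) fun v => x q (u - v) ω) ∂P =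
      ∑ b, ∫ u in s..t, sIntegral (η p q) fun v =>
        incrConv (kernelDeriv η g q (c b)) (z b) (u - v) := by
    intro q
    simp only [intervalIntegral.integral_of_le hst]
    rw [((hB q).restrict A).integral_integral_sIntegral]
    simp only [hxA]
    rw [← integral_finsetSum _ fun b _ => integrable_sIntegral (hprod q b)]
    congr 1; ext u
    exact sIntegral_finset_sum _ fun b _ => (integrable_const _).mono'
      ((hm q b).comp (measurable_const.sub measurable_id)).aestronglyMeasurable
      (Eventually.of_forall fun v => hb q b _)
  have h2 : ∀ b, ∫ ω in A, (1 : Matrix ι ι ℝ) p (c b) * (Z t ω b - Z s ω b) ∂P =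
      (1 : Matrix ι ι ℝ) p (c b) * (z b t - z b s) := fun b => by
    rw [integral_const_mul, integral_sub ((hZ b).integrable _).integrableOn
      ((hZ b).integrable _).integrableOn]
  rw [integral_sub ((hB p).integrable t).integrableOn ((hB p).integrable s).integrableOn,
    integral_add hi3.integrableOn hi4.integrableOn,
    integral_finsetSum _ fun q _ => (hi1 q).integrableOn,
    integral_finsetSum _ fun b _ => (hi2 b).integrableOn, hxA, hxA,
    Finset.sum_congr rfl fun q _ => h1 q, Finset.sum_congr rfl fun b _ => h2 b,
    Finset.sum_comm, Finset.sum_congr rfl fun b _ =>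
      hg.sum_integral_sIntegral_incrConv p (c b) (hzc b) (hC b) hst]
  rw [Finset.sum_sub_distrib, Finset.sum_sub_distrib]
  ring

end
end

/-! ### Derivatives of integrals of stationary processes -/

lemma hasFirstMoment_stepDiff (r : ℝ) : HasFirstMoment (stepDiff r) where
  measurable := measurable_stepDiff.comp (measurable_id.prodMk measurable_const)
  integrable := integrable_stepDiff r
  integrable_abs_mul := by
    refine ((integrable_stepDiff r).const_mul |r|).mono
      (measurable_id.abs.mul (measurable_stepDiff.comp
        (measurable_id.prodMk measurable_const))).aestronglyMeasurable
      (Eventually.of_forall fun v => ?_)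
    simp only [norm_mul, Real.norm_eq_abs, abs_abs]
    by_cases hv : |v| ≤ |r|
    · gcongr
    · have : stepDiff r v = 0 := by
        rcases le_total 0 r with hr | hr
        · rw [stepDiff_of_nonneg hr, Set.indicator_of_notMem, neg_zero]
          rintro ⟨h1, h2⟩
          exact hv (by rw [abs_of_nonneg h1, abs_of_nonneg hr]; exact h2.le)
        · rw [stepDiff_of_nonpos hr, Set.indicator_of_notMem]
          rintro ⟨h1, h2⟩
          exact hv (by rw [abs_of_neg h2, abs_of_nonpos hr]; linarith)
      simp [this]

lemma locallyIntegrable_of_intervalIntegrable {z : ℝ → ℝ}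
    (hz : ∀ a b, IntervalIntegrable z volume a b) : LocallyIntegrable z := by
  refine locallyIntegrable_iff.2 fun K hK => ?_
  obtain ⟨R, hR0, hR⟩ := hK.isBounded.subset_closedBall_lt 0 0
  rw [Real.closedBall_eq_Icc] at hR
  exact ((intervalIntegrable_iff_integrableOn_Icc_of_le (by linarith)).1 (hz _ _)).mono_set hR

/-- The error of the first-order expansion of the primitive at t is a moving average of increments
with kernel f_{-ε}. Its joint laws over ε are therefore accessible to shift invariance. -/
lemma incrConv_stepDiff {z : ℝ → ℝ} (hz : ∀ a b, IntervalIntegrable z volume a b) (t ε : ℝ) :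
    incrConv (stepDiff (-ε)) z t =
      (∫ u in (0 : ℝ)..(t + ε), z u) - (∫ u in (0 : ℝ)..t, z u) - ε * z t := by
  unfold incrConv
  simp only [mul_comm _ (stepDiff _ _), ← smul_eq_mul (a := stepDiff _ _)]
  rw [integral_stepDiff_smul,
    intervalIntegral.integral_comp_sub_left (fun x => z x - z t),
    intervalIntegral.integral_sub (hz _ _) intervalIntegrable_const,
    intervalIntegral.integral_const, sub_neg_eq_add, sub_zero,
    intervalIntegral.integral_symm, intervalIntegral.integral_interval_sub_left (hz _ _) (hz _ _)]
  simp only [smul_eq_mul]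
  ring

/-- The families `(a_ε)`, indexed by rationals, with `a_ε = o(ε)` as `ε → 0`. -/
def rationalLittleO : Set (ℚ → ℝ) :=
  ⋂ N : ℕ, ⋃ M : ℕ, ⋂ ε : ℚ, ⋂ (_ : |(ε : ℝ)| < 1 / (M + 1)),
    {a | |a ε| ≤ 1 / (N + 1) * |(ε : ℝ)|}

lemma measurableSet_rationalLittleO : MeasurableSet rationalLittleO := by
  refine MeasurableSet.iInter fun N => MeasurableSet.iUnion fun M => MeasurableSet.iInter fun ε =>
    MeasurableSet.iInter fun _ => ?_
  exact measurableSet_le (measurable_pi_apply ε).abs measurable_const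

/-- The error depends continuously on ε, so rational ε decide differentiability, which becomes a
measurable condition on countably many coordinates. -/
lemma hasDerivAt_integral_iff {z : ℝ → ℝ} (hz : ∀ a b, IntervalIntegrable z volume a b) (t : ℝ) :
    HasDerivAt (fun x => ∫ u in (0 : ℝ)..x, z u) (z t) t ↔
      (fun ε : ℚ => incrConv (stepDiff (-ε)) z t) ∈ rationalLittleO := by
  set A : ℝ → ℝ := fun ε => incrConv (stepDiff (-ε)) z t with hA
  have hAc : Continuous A := by
    have h : Continuous fun x => ∫ u in (0 : ℝ)..x, z u := intervalIntegral.continuous_primitive hz 0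
    simp only [hA, incrConv_stepDiff hz]
    fun_prop
  have h1 : HasDerivAt (fun x => ∫ u in (0 : ℝ)..x, z u) (z t) t ↔
      ∀ c > 0, ∀ᶠ ε in 𝓝 0, |A ε| ≤ c * |ε| := by
    rw [hasDerivAt_iff_isLittleO_nhds_zero, Asymptotics.isLittleO_iff]
    simp only [hA, incrConv_stepDiff hz, Real.norm_eq_abs, smul_eq_mul]
  rw [h1]
  simp only [rationalLittleO, Set.mem_iInter, Set.mem_iUnion, Set.mem_ofPred_eq]
  constructor
  · intro h N
    obtain ⟨δ, hδ, hball⟩ := Metric.eventually_nhds_iff.1 (h (1 / (N + 1)) (by positivity))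
    obtain ⟨M, hM⟩ := exists_nat_one_div_lt hδ
    exact ⟨M, fun ε hε => hball (by rw [Real.dist_eq, sub_zero]; exact hε.trans hM)⟩
  · intro h c hc
    obtain ⟨N, hN⟩ := exists_nat_one_div_lt hc
    obtain ⟨M, hM⟩ := h N
    have hopen : IsOpen {ε : ℝ | |ε| < 1 / (M + 1)} := isOpen_lt continuous_abs continuous_const
    have hclosed : IsClosed {ε : ℝ | |A ε| ≤ 1 / (N + 1) * |ε|} :=
      isClosed_le hAc.abs (continuous_const.mul continuous_abs)
    have hsub : {ε : ℝ | |ε| < 1 / (M + 1)} ⊆ {ε : ℝ | |A ε| ≤ 1 / (N + 1) * |ε|} := by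
      refine (Rat.denseRange_cast.open_subset_closure_inter hopen).trans
        (closure_minimal ?_ hclosed)
      rintro _ ⟨hε, ε, rfl⟩
      exact hM ε hε
    filter_upwards [hopen.mem_nhds (x := 0) (by simp; positivity)] with ε hε
    exact (hsub hε).trans (mul_le_mul_of_nonneg_right hN.le (abs_nonneg ε))

section
variable {Ω : Type*} [MeasurableSpace Ω] {P : Measure Ω}

lemma HasL1Increments.ae_intervalIntegrable [IsFiniteMeasure P] {ζ : ℝ → Ω → ℝ}
    (hζ : HasL1Increments P ζ) :
    ∀ᵐ ω ∂P, ∀ a b, IntervalIntegrable (fun t => ζ t ω) volume a b := by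
  filter_upwards [hζ.ae_integrableOn] with ω hω a b
  obtain ⟨N, hN⟩ := exists_nat_ge (max |a| |b|)
  refine ((hω N).mono_set ?_).intervalIntegrable
  refine Set.ordConnected_Icc.uIcc_subset ?_ ?_
  · exact abs_le.1 ((le_max_left _ _).trans hN)
  · exact abs_le.1 ((le_max_right _ _).trans hN)

/-- For a measurable process with stationary increments every time point is almost surely a
Lebesgue point. -/
lemma HasStationaryIncrements.ae_hasDerivAt_integral [IsProbabilityMeasure P] {n : ℕ}
    {W : ℝ → Ω → Fin n → ℝ} (hm : IsMeasurableProcess W) (hi : IsIntegrableProcess P W)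
    (hs : HasStationaryIncrements P W) (k : Fin n) (t : ℝ) :
    ∀ᵐ ω ∂P, HasDerivAt (fun x => ∫ u in (0 : ℝ)..x, W u ω k) (W t ω k) t := by
  have hW := hs.hasL1Increments hm hi k
  set A : ℝ → Ω → ℚ → ℝ := fun t ω ε => incrConv (stepDiff (-ε)) (fun u => W u ω k) t with hA
  have hAm : Measurable fun p : ℝ × Ω => A p.1 p.2 := measurable_pi_lambda _ fun ε =>
    hW.measurable_incrConv (hasFirstMoment_stepDiff _).measurable
  have hAt : ∀ t, Measurable (A t) := fun t =>
    hAm.comp (measurable_const.prodMk measurable_id)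
  -- The law of a countable family is determined by its finite subfamilies, to which shift
  -- invariance of moving averages applies.
  have hlaw : ∀ t, P.map (A t) = P.map (A 0) := by
    intro t
    refine (ProbabilityTheory.map_eq_iff_forall_finset_map_restrict_eq (X := fun (ε : ℚ) ω => A t ω ε)
      (Y := fun (ε : ℚ) ω => A 0 ω ε) (hAt t).aemeasurable (hAt 0).aemeasurable).2 fun J => ?_
    have h := hs.map_incrConv hm hi (J := J) (φ := fun ε => stepDiff (-(ε : ℚ)))
      (fun ε => hasFirstMoment_stepDiff _) (fun _ => k) (fun _ => 0) t
    simp only [zero_add] at h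
    exact h
  have hcongr : ∀ t, (∀ᵐ ω ∂P, A t ω ∈ rationalLittleO) ↔ ∀ᵐ ω ∂P, A 0 ω ∈ rationalLittleO := by
    intro t
    have h1 : ∀ t, (∀ᵐ a ∂P.map (A t), a ∈ rationalLittleO) ↔
        ∀ᵐ ω ∂P, A t ω ∈ rationalLittleO := fun t =>
      ae_map_iff (hAt t).aemeasurable measurableSet_rationalLittleO
    rw [← h1, hlaw t, h1]
  have hpath := hW.ae_intervalIntegrable
  -- Lebesgue's differentiation theorem along each locally integrable path, with the two quantifiers
  -- exchanged by Fubini.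
  have hae : ∀ᵐ t : ℝ, ∀ᵐ ω ∂P, A t ω ∈ rationalLittleO := by
    have hset : MeasurableSet {p : ℝ × Ω | A p.1 p.2 ∈ rationalLittleO} :=
      hAm measurableSet_rationalLittleO
    rw [Measure.ae_ae_comm hset]
    filter_upwards [hpath] with ω hω
    filter_upwards [LocallyIntegrable.ae_hasDerivAt_integral
        (locallyIntegrable_of_intervalIntegrable hω)] with t ht
    exact (hasDerivAt_integral_iff hω t).1 (ht 0)
  -- One good time is enough, because the event has the same probability at all times.
  obtain ⟨t0, ht0⟩ := hae.exists
  filter_upwards [hpath, (hcongr t).2 ((hcongr t0).1 ht0)] with ω h1 h2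
  exact (hasDerivAt_integral_iff h1 t).2 h2

end

/-! ### Existence of a solution -/

section
variable {Ω : Type*} [MeasurableSpace Ω] {P : Measure Ω}

lemma IsMeasurableProcess.integral {n : ℕ} {W : ℝ → Ω → Fin n → ℝ} (hW : IsMeasurableProcess W) :
    IsMeasurableProcess fun t ω k => ∫ u in (0 : ℝ)..t, W u ω k := by
  refine measurable_pi_lambda _ fun k => ?_
  -- Written over the whole line with a jointly measurable weight, the oriented integral is visibly
  -- measurable in (t, ω).
  have h : ∀ p : ℝ × Ω, ∫ u in (0 : ℝ)..p.1, W u p.2 k =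
      -∫ v, stepDiff p.1 v • W v p.2 k := fun p => by
    rw [integral_stepDiff_smul, neg_neg]
  simp only [h]
  refine (StronglyMeasurable.integral_prod_right
    (f := fun (p : ℝ × Ω) v => stepDiff p.1 v • W v p.2 k)
    (Measurable.stronglyMeasurable (Measurable.fun_smul ?_ ?_))).measurable.neg
  · exact measurable_stepDiff.comp (f := fun x : (ℝ × Ω) × ℝ => (x.2, x.1.1)) (by fun_prop)
  · exact (measurable_pi_apply k).comp
      (hW.comp (f := fun x : (ℝ × Ω) × ℝ => (x.2, x.1.2)) (by fun_prop))

/-- Paths of two modifications agree almost everywhere. -/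
lemma ae_ae_eq_of_forall_ae_eq [SFinite P] {n : ℕ} {W W' : ℝ → Ω → Fin n → ℝ}
    (hW : IsMeasurableProcess W) (hW' : IsMeasurableProcess W') (h : ∀ t, W' t =ᵐ[P] W t) :
    ∀ᵐ ω ∂P, ∀ᵐ t : ℝ, W' t ω = W t ω := by
  have hset : MeasurableSet {p : ℝ × Ω | W' p.1 p.2 = W p.1 p.2} := measurableSet_eq_fun hW' hW
  exact (Measure.ae_ae_comm hset).1 (Eventually.of_forall h)

/-- A primitive sees its density only almost everywhere, so the modification `W'` may replace `W` on
almost every path; at a fixed time, differentiability is the Lebesgue point property of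
`ae_hasDerivAt_integral`. -/
lemma isDerivativeProcess_integral [IsProbabilityMeasure P] {n : ℕ}
    {W W' Y : ℝ → Ω → Fin n → ℝ} (hm : IsMeasurableProcess W) (hi : IsIntegrableProcess P W)
    (hs : HasStationaryIncrements P W) (hm' : IsMeasurableProcess W')
    (h : ∀ t, W' t =ᵐ[P] W t) {Y0 : Ω → Fin n → ℝ}
    (hY : ∀ t ω k, Y t ω k = Y0 ω k + ∫ u in (0 : ℝ)..t, W u ω k) :
    IsDerivativeProcess P Y W' where
  measurable := hm'
  absCont := by
    filter_upwards [ae_ae_eq_of_forall_ae_eq hm hm' h,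
      ae_all_iff.2 fun k => (hs.hasL1Increments hm hi k).ae_intervalIntegrable] with ω h1 h2 k s t
    have h3 : (fun u => W u ω k) =ᵐ[volume] fun u => W' u ω k :=
      h1.mono fun u hu => by simp only [hu]
    refine ⟨(h2 k s t).congr_ae (ae_restrict_of_ae h3), ?_⟩
    rw [hY, hY, add_sub_add_left_eq_sub, intervalIntegral.integral_interval_sub_left (h2 k _ _)
      (h2 k _ _)]
    exact intervalIntegral.integral_congr_ae (h3.mono fun u hu _ => hu)
  hasDeriv t := by
    filter_upwards [ae_all_iff.2 fun k => hs.ae_hasDerivAt_integral hm hi k t, h t] with ω h1 h2 k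
    rw [h2]
    refine ((h1 k).const_add (Y0 ω k)).congr_of_eventuallyEq
      (Eventually.of_forall fun u => hY u ω k)

section
variable {m n : ℕ} (hm : 0 < m) {ϖ : Fin m → MatrixMeasure (Fin n)}
  {g : ℝ → Matrix (Fin m × Fin n) (Fin m × Fin n) ℝ} {Z : ℝ → Ω → Fin n → ℝ}

/-- The index of the last block. -/
def lastBlock (hm : 0 < m) (b : Fin n) : Fin m × Fin n := (⟨m - 1, Nat.sub_one_lt_of_lt hm⟩, b)

/-- The `j`-th block of the solution of the first-order system. -/
def systemSolution (hm : 0 < m) (ϖ : Fin m → MatrixMeasure (Fin n))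
    (g : ℝ → Matrix (Fin m × Fin n) (Fin m × Fin n) ℝ) (Z : ℝ → Ω → Fin n → ℝ) (j : ℕ) :
    ℝ → Ω → Fin n → ℝ :=
  if h : j < m then
    movingAverage (fun a b => kernelDeriv (companionMeasure ϖ) g (⟨j, h⟩, a) (lastBlock hm b)) Z
  else 0

set_option linter.unusedSectionVars false in
lemma systemSolution_of_lt {j : ℕ} (h : j < m) :
    systemSolution hm ϖ g Z j =
      movingAverage (fun a b => kernelDeriv (companionMeasure ϖ) g (⟨j, h⟩, a) (lastBlock hm b)) Z :=
  dif_pos h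

/-- A modification of the `j`-th block of the solution of the first-order system whose paths are
primitives of the paths of the next block. -/
def smoothSolution (hm : 0 < m) (ϖ : Fin m → MatrixMeasure (Fin n))
    (g : ℝ → Matrix (Fin m × Fin n) (Fin m × Fin n) ℝ) (Z : ℝ → Ω → Fin n → ℝ) (j : ℕ)
    (t : ℝ) (ω : Ω) (k : Fin n) : ℝ :=
  if j + 1 < m then systemSolution hm ϖ g Z j 0 ω k +
    ∫ u in (0 : ℝ)..t, systemSolution hm ϖ g Z (j + 1) u ω k
  else systemSolution hm ϖ g Z j t ω k

variable [IsProbabilityMeasure P] (hg : IsKernel (companionMeasure ϖ) g)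
  (hZm : IsMeasurableProcess Z) (hZi : IsIntegrableProcess P Z)
  (hZs : HasStationaryIncrements P Z)
include hg hZm hZi hZs

lemma systemSolution_spec {j : ℕ} (hj : j < m) :
    IsMeasurableProcess (systemSolution hm ϖ g Z j) ∧
      IsIntegrableProcess P (systemSolution hm ϖ g Z j) ∧
      IsStationary P (systemSolution hm ϖ g Z j) := by
  rw [systemSolution_of_lt hm hj]
  exact ⟨isMeasurableProcess_movingAverage hZm hZi hZs fun a b => hg.hasFirstMoment _ _,
    isIntegrableProcess_movingAverage hZm hZi hZs fun a b => hg.hasFirstMoment _ _,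
    isStationary_movingAverage hZm hZi hZs fun a b => hg.hasFirstMoment _ _⟩

/-- Block row j carries only δ_0 in block column j + 1, and the driver enters the last block alone,
so the first-order equation reduces to this. -/
lemma ae_systemSolution_eq_integral {j : ℕ} (hj : j + 1 < m) (k : Fin n) {s t : ℝ} (hst : s ≤ t) :
    ∀ᵐ ω ∂P, systemSolution hm ϖ g Z j t ω k - systemSolution hm ϖ g Z j s ω k =
      ∫ u in s..t, systemSolution hm ϖ g Z (j + 1) u ω k := by
  have hsol := hg.ae_sub_eq (fun b => hZs.hasL1Increments hZm hZi b) (lastBlock hm)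
    (x := fun q t ω => systemSolution hm ϖ g Z q.1 t ω q.2)
    (fun q => (measurable_pi_apply q.2).comp
      (systemSolution_spec hm hg hZm hZi hZs q.1.2).1)
    (fun q t => by rw [systemSolution_of_lt hm q.1.2]; rfl)
    (⟨j, by omega⟩, k) hst
  filter_upwards [hsol] with ω hω
  rw [hω]
  have h0 : ∀ b, (1 : Matrix (Fin m × Fin n) (Fin m × Fin n) ℝ)
      (⟨j, by omega⟩, k) (lastBlock hm b) = 0 := by
    intro b
    refine Matrix.one_apply_ne fun h => ?_
    have := congrArg (fun q => (q.1 : ℕ)) h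
    simp only [lastBlock] at this
    omega
  simp only [h0, zero_mul, Finset.sum_const_zero, add_zero]
  rw [Finset.sum_eq_single (⟨j + 1, hj⟩, k)]
  · rw [companionMeasure_of_lt (i := ⟨j, by omega⟩) hj, if_pos rfl]
    simp only [sIntegral_toSignedMeasure, integral_dirac, sub_zero]
  · intro q _ hq
    rw [companionMeasure_of_lt (i := ⟨j, by omega⟩) hj, if_neg hq]
    simp only [sIntegral_zero, intervalIntegral.integral_zero]
  · simp

lemma isMeasurableProcess_smoothSolution {j : ℕ} (hj : j < m) :
    IsMeasurableProcess (smoothSolution hm ϖ g Z j) := by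
  by_cases h : j + 1 < m
  · have h1 := (systemSolution_spec hm hg hZm hZi hZs hj).1
    have h2 := (systemSolution_spec hm hg hZm hZi hZs h).1.integral
    have h3 : Measurable fun p : ℝ × Ω => systemSolution hm ϖ g Z j 0 p.2 :=
      h1.comp (measurable_const.prodMk measurable_snd)
    have : smoothSolution hm ϖ g Z j = fun t ω k => systemSolution hm ϖ g Z j 0 ω k +
        ∫ u in (0 : ℝ)..t, systemSolution hm ϖ g Z (j + 1) u ω k := by
      ext t ω k; simp only [smoothSolution, if_pos h]
    rw [this]
    exact h3.add h2
  · have : smoothSolution hm ϖ g Z j = systemSolution hm ϖ g Z j := by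
      ext t ω k; simp only [smoothSolution, if_neg h]
    rw [this]
    exact (systemSolution_spec hm hg hZm hZi hZs hj).1

lemma smoothSolution_ae_eq (j : ℕ) (t : ℝ) :
    smoothSolution hm ϖ g Z j t =ᵐ[P] systemSolution hm ϖ g Z j t := by
  by_cases h : j + 1 < m
  · have h1 : ∀ k, ∀ᵐ ω ∂P, smoothSolution hm ϖ g Z j t ω k = systemSolution hm ϖ g Z j t ω k := by
      intro k
      simp only [smoothSolution, if_pos h]
      rcases le_total 0 t with ht | ht
      · filter_upwards [ae_systemSolution_eq_integral hm hg hZm hZi hZs h k ht] with ω hω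
        rw [← hω]; ring
      · filter_upwards [ae_systemSolution_eq_integral hm hg hZm hZi hZs h k ht] with ω hω
        rw [intervalIntegral.integral_symm, ← hω]; ring
    filter_upwards [ae_all_iff.2 h1] with ω hω
    exact funext hω
  · refine Eventually.of_forall fun ω => ?_
    ext k; simp only [smoothSolution, if_neg h]

lemma measurable_smoothSolution (j : Fin m) (l : Fin n) :
    Measurable fun p : ℝ × Ω => smoothSolution hm ϖ g Z j p.1 p.2 l :=
  (measurable_pi_apply l).comp (isMeasurableProcess_smoothSolution hm hg hZm hZi hZs j.2)

lemma smoothSolution_ae_eq_sum (j : Fin m) (l : Fin n) (t : ℝ) :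
    (fun ω => smoothSolution hm ϖ g Z j t ω l) =ᵐ[P] fun ω =>
      ∑ b, incrConv (kernelDeriv (companionMeasure ϖ) g (j, l) (lastBlock hm b))
        (fun u => Z u ω b) t := by
  filter_upwards [smoothSolution_ae_eq hm hg hZm hZi hZs (j : ℕ) t] with ω hω
  rw [hω, systemSolution_of_lt hm j.2]; rfl

lemma ae_integrable_smoothSolution (j : Fin m) (k l : Fin n) (s t : ℝ) :
    ∀ᵐ ω ∂P, Integrable (fun p : ℝ × ℝ => smoothSolution hm ϖ g Z j (p.1 - p.2) ω l)
      ((volume.restrict (Set.Ioc s t)).prod (ϖ j k l).totalVariation) := by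
  obtain ⟨B, hB⟩ := exists_isBoundedInMean_sum fun b =>
    (hZs.hasL1Increments hZm hZi b).exists_isBoundedInMean_incrConv
      (hg.hasFirstMoment (j, l) (lastBlock hm b))
  exact (hB.congr (measurable_smoothSolution hm hg hZm hZi hZs j l)
    (smoothSolution_ae_eq_sum hm hg hZm hZi hZs j l)).ae_integrable_comp
    ((volume.restrict (Set.Ioc s t)).prod (ϖ j k l).totalVariation)
    (measurable_fst.sub measurable_snd)

/-- This is the last block row of the system: its delay measures are the ϖ_j, and the identity
matrix selects component k of the driver. -/
lemma ae_smoothSolution_sub_eq (k : Fin n) {s t : ℝ} (hst : s ≤ t) :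
    ∀ᵐ ω ∂P, smoothSolution hm ϖ g Z (m - 1) t ω k - smoothSolution hm ϖ g Z (m - 1) s ω k =
      (∑ j : Fin m, ∑ l : Fin n, ∫ u in s..t, sIntegral (ϖ j k l) fun v =>
        smoothSolution hm ϖ g Z j (u - v) ω l) + (Z t ω k - Z s ω k) := by
  have hsol := hg.ae_sub_eq (fun b => hZs.hasL1Increments hZm hZi b) (lastBlock hm)
    (x := fun q t ω => smoothSolution hm ϖ g Z q.1 t ω q.2)
    (fun q => measurable_smoothSolution hm hg hZm hZi hZs q.1 q.2)
    (fun q t => smoothSolution_ae_eq_sum hm hg hZm hZi hZs q.1 q.2 t) (lastBlock hm k) hst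
  have hϖ : ∀ j l, companionMeasure ϖ (lastBlock hm k) (j, l) = ϖ j k l := fun j l =>
    companionMeasure_last (i := ⟨m - 1, Nat.sub_one_lt_of_lt hm⟩) (by simp only; omega) k (j, l)
  filter_upwards [hsol] with ω hω
  have h1 : ∑ b, (1 : Matrix (Fin m × Fin n) (Fin m × Fin n) ℝ)
      (lastBlock hm k) (lastBlock hm b) * (Z t ω b - Z s ω b) = Z t ω k - Z s ω k := by
    rw [Finset.sum_eq_single k]
    · rw [Matrix.one_apply_eq, one_mul]
    · intro b _ hb
      rw [Matrix.one_apply_ne, zero_mul]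
      intro h
      exact hb (congrArg Prod.snd h).symm
    · simp
  rw [h1, Fintype.sum_prod_type] at hω
  simp only [hϖ] at hω
  exact hω

lemma isSolution_smoothSolution : IsSolution P ϖ Z (smoothSolution hm ϖ g Z 0) where
  measurable := isMeasurableProcess_smoothSolution hm hg hZm hZi hZs hm
  integrable t := ((systemSolution_spec hm hg hZm hZi hZs hm).2.1 t).congr
    (smoothSolution_ae_eq hm hg hZm hZi hZs 0 t).symm
  stationary := (systemSolution_spec hm hg hZm hZi hZs hm).2.2.congr
    (smoothSolution_ae_eq hm hg hZm hZi hZs 0)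
  equation := by
    refine ⟨smoothSolution hm ϖ g Z, rfl, fun j hj => ?_, fun s t hst => ?_⟩
    · obtain ⟨h1, h2, h3⟩ := systemSolution_spec hm hg hZm hZi hZs hj
      exact isDerivativeProcess_integral h1 h2 (h3.hasStationaryIncrements h1)
        (isMeasurableProcess_smoothSolution hm hg hZm hZi hZs hj)
        (smoothSolution_ae_eq hm hg hZm hZi hZs (j + 1))
        (Y0 := systemSolution hm ϖ g Z j 0) fun t ω k => by simp only [smoothSolution, if_pos hj]
    · filter_upwards [ae_all_iff.2 fun j => ae_all_iff.2 fun k => ae_all_iff.2 fun l =>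
        ae_integrable_smoothSolution hm hg hZm hZi hZs j k l s t,
        ae_all_iff.2 fun k => ae_smoothSolution_sub_eq hm hg hZm hZi hZs k hst.le] with ω h1 h2
      exact ⟨h1, h2⟩

end
end

/-! ### Smoothing by test functions -/

/-- A test function supported in `(-R, R)` together with its successive derivatives. -/
structure IsTestSequence (ρ : ℕ → ℝ → ℝ) (R : ℝ) : Prop where
  hasDerivAt : ∀ j x, HasDerivAt (ρ j) (ρ (j + 1) x) x
  eq_zero : ∀ j x, R ≤ |x| → ρ j x = 0

lemma exists_isTestSequence {ρ : ℝ → ℝ} (hρ : ContDiff ℝ (⊤ : ℕ∞) ρ) (hc : HasCompactSupport ρ) :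
    ∃ R, 0 < R ∧ IsTestSequence (fun j => iteratedDeriv j ρ) R := by
  obtain ⟨R, hR0, hR⟩ := hc.isBounded.subset_ball_lt 0 0
  refine ⟨R, hR0, fun j x => ?_, fun j x hx => ?_⟩
  · rw [iteratedDeriv_succ]
    exact ((hρ.differentiable_iteratedDeriv j (by exact_mod_cast ENat.natCast_lt_top j)) x).hasDerivAt
  · have hsupp : ∀ j, tsupport (iteratedDeriv j ρ) ⊆ tsupport ρ := by
      intro j
      induction j with
      | zero => rw [iteratedDeriv_zero]
      | succ j ih =>
        rw [iteratedDeriv_succ]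
        exact (closure_minimal support_deriv_subset (isClosed_tsupport _)).trans ih
    by_contra h
    have := hR (hsupp j (subset_tsupport _ h))
    rw [Metric.mem_ball, Real.dist_eq, sub_zero] at this
    linarith

namespace IsTestSequence
variable {ρ : ℕ → ℝ → ℝ} {R : ℝ} (hρ : IsTestSequence ρ R)
include hρ

lemma continuous (j : ℕ) : Continuous (ρ j) :=
  continuous_iff_continuousAt.2 fun x => (hρ.hasDerivAt j x).continuousAt

lemma hasCompactSupport (j : ℕ) : HasCompactSupport (ρ j) :=
  HasCompactSupport.intro (isCompact_closedBall (0 : ℝ) R) fun x hx => hρ.eq_zero j x (by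
    rw [Metric.mem_closedBall, Real.dist_eq, sub_zero, not_le] at hx
    exact hx.le)

lemma integrable (j : ℕ) : Integrable (ρ j) :=
  (hρ.continuous j).integrable_of_hasCompactSupport (hρ.hasCompactSupport j)

lemma eq_zero_of_notMem (j : ℕ) {t u : ℝ} (hu : u ∉ Set.Ioc (t - R) (t + R)) :
    ρ j (t - u) = 0 := by
  refine hρ.eq_zero j _ ?_
  rw [Set.mem_Ioc, not_and_or, not_lt, not_le] at hu
  rcases hu with h | h
  · exact le_abs.2 (Or.inl (by linarith))
  · exact le_abs.2 (Or.inr (by linarith))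

lemma setIntegral_eq (j : ℕ) (f : ℝ → ℝ) (t : ℝ) :
    ∫ u in Set.Ioc (t - R) (t + R), f u * ρ j (t - u) = ∫ u, f u * ρ j (t - u) :=
  setIntegral_eq_integral_of_forall_compl_eq_zero fun u hu => by
    rw [hρ.eq_zero_of_notMem j hu, mul_zero]

lemma exists_bound (j : ℕ) : ∃ C, ∀ x, ‖ρ j x‖ ≤ C :=
  (hρ.continuous j).bounded_above_of_compact_support (hρ.hasCompactSupport j)

lemma integrable_mul {f : ℝ → ℝ} (hf : ∀ a b, IntervalIntegrable f volume a b) (j : ℕ) (t : ℝ) :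
    Integrable fun u => f u * ρ j (t - u) := by
  obtain ⟨C, hC⟩ := hρ.exists_bound j
  have h : IntegrableOn (fun u => f u * ρ j (t - u)) (Set.Ioc (t - R) (t + R)) := by
    refine Integrable.mul_bdd (c := C) ?_
      ((hρ.continuous j).comp (continuous_const.sub continuous_id)).aestronglyMeasurable
      (Eventually.of_forall fun u => hC _)
    exact (hf (t - R) (t + R)).1
  refine (integrableOn_iff_integrable_of_support_subset fun u hu => ?_).1 h
  by_contra h
  exact hu (by simp only [hρ.eq_zero_of_notMem j h, mul_zero])

/-- Integration by parts against a test function. -/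
lemma integral_mul_succ {y F : ℝ → ℝ} {c t : ℝ} (hR : 0 < R)
    (hF : IntegrableOn F (Set.Ioc (t - R) (t + R)))
    (hy : ∀ᵐ u, u ∈ Set.Ioc (t - R) (t + R) → y u = c + ∫ w in Set.Ioc (t - R) u, F w) (j : ℕ) :
    ∫ u, y u * ρ (j + 1) (t - u) = ∫ u, F u * ρ j (t - u) := by
  obtain ⟨C, hC⟩ := hρ.exists_bound (j + 1)
  set S := Set.Ioc (t - R) (t + R) with hS
  have hc1 : Continuous fun u => ρ (j + 1) (t - u) :=
    (hρ.continuous (j + 1)).comp (continuous_const.sub continuous_id)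
  have hderiv : ∀ a, ∫ u in a..(t + R), ρ (j + 1) (t - u) = ρ j (t - a) := by
    intro a
    rw [intervalIntegral.integral_comp_sub_left (fun x => ρ (j + 1) x),
      intervalIntegral.integral_eq_sub_of_hasDerivAt (fun x _ => hρ.hasDerivAt j x)
        ((hρ.continuous (j + 1)).intervalIntegrable _ _), hρ.eq_zero j (t - (t + R)), sub_zero]
    rw [sub_add_cancel_left, abs_neg]
    exact le_abs_self R
  -- The double integral runs over the triangle w ≤ u. Exchanging the order integrates the
  -- derivative from w to t + R, where the test function vanishes; the constant c drops out for the
  -- same reason at the other end.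
  set T : Set (ℝ × ℝ) := {p | p.2 ≤ p.1} with hT
  have hTm : MeasurableSet T := measurableSet_le measurable_snd measurable_fst
  have hint : Integrable (Function.uncurry fun u w =>
      T.indicator (fun p => F p.2 * ρ (j + 1) (t - p.1)) (u, w))
      ((volume.restrict S).prod (volume.restrict S)) := by
    refine Integrable.indicator ?_ hTm
    have h1 : Integrable (fun p : ℝ × ℝ => F p.2) ((volume.restrict S).prod (volume.restrict S)) :=
      Integrable.comp_snd (f := F) hF _
    exact h1.mul_bdd (c := C) (hc1.measurable.comp measurable_fst).aestronglyMeasurable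
      (Eventually.of_forall fun p => hC _)
  have hyi : ∀ u ∈ S, ∫ w in Set.Ioc (t - R) u, F w * ρ (j + 1) (t - u) =
      ∫ w in S, T.indicator (fun p => F p.2 * ρ (j + 1) (t - p.1)) (u, w) := by
    intro u hu
    have : ∀ w, T.indicator (fun p => F p.2 * ρ (j + 1) (t - p.1)) (u, w) =
        (Set.Iic u).indicator (fun w => F w * ρ (j + 1) (t - u)) w := fun w => rfl
    simp only [this]
    rw [setIntegral_indicator measurableSet_Iic, hS, Set.Ioc_inter_Iic, min_eq_right hu.2]
  have hint2 : Integrable (fun u => ∫ w in S,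
      T.indicator (fun p => F p.2 * ρ (j + 1) (t - p.1)) (u, w)) (volume.restrict S) :=
    hint.integral_prod_left
  calc ∫ u, y u * ρ (j + 1) (t - u)
      = ∫ u in S, y u * ρ (j + 1) (t - u) := (hρ.setIntegral_eq (j + 1) y t).symm
    _ = ∫ u in S, (c * ρ (j + 1) (t - u) +
          ∫ w in S, T.indicator (fun p => F p.2 * ρ (j + 1) (t - p.1)) (u, w)) := by
        refine setIntegral_congr_ae measurableSet_Ioc ?_
        filter_upwards [hy] with u hu huS
        rw [hu huS, ← hyi u huS, add_mul, integral_mul_const]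
    _ = c * (∫ u in S, ρ (j + 1) (t - u)) +
          ∫ u in S, ∫ w in S, T.indicator (fun p => F p.2 * ρ (j + 1) (t - p.1)) (u, w) := by
        rw [integral_add _ hint2, integral_const_mul]
        exact (hc1.integrableOn_Ioc).const_mul c
    _ = ∫ w in S, ∫ u in S, T.indicator (fun p => F p.2 * ρ (j + 1) (t - p.1)) (u, w) := by
        rw [← intervalIntegral.integral_of_le (by linarith), hderiv, integral_integral_swap hint,
          sub_sub_cancel, hρ.eq_zero j R (le_abs_self R), mul_zero, zero_add]
    _ = ∫ w in S, F w * ρ j (t - w) := by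
        refine setIntegral_congr_fun measurableSet_Ioc fun w hw => ?_
        have : ∀ u, T.indicator (fun p => F p.2 * ρ (j + 1) (t - p.1)) (u, w) =
            (Set.Ici w).indicator (fun u => F w * ρ (j + 1) (t - u)) u := fun u => rfl
        simp only [this]
        rw [setIntegral_indicator measurableSet_Ici, integral_const_mul]
        have hset : S ∩ Set.Ici w = Set.Icc w (t + R) := by
          ext u; simp only [hS, Set.mem_inter_iff, Set.mem_Ioc, Set.mem_Ici, Set.mem_Icc]
          exact ⟨fun h => ⟨h.2, h.1.2⟩, fun h => ⟨⟨hw.1.trans_le h.1, h.2⟩, h.1⟩⟩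
        rw [hset, integral_Icc_eq_integral_Ioc, ← intervalIntegral.integral_of_le hw.2, hderiv]
    _ = _ := hρ.setIntegral_eq j F t

end IsTestSequence

section
variable {Ω : Type*} [MeasurableSpace Ω] {P : Measure Ω}

lemma IsBoundedInMean.integrable_prod_smoothing [SFinite P] {y : ℝ → Ω → ℝ} {B : ℝ}
    (hy : IsBoundedInMean P y B) {ρ : ℕ → ℝ → ℝ} {R : ℝ} (hρ : IsTestSequence ρ R) (j : ℕ) (t : ℝ) :
    Integrable (Function.uncurry fun u ω => y u ω * ρ j (t - u)) (volume.prod P) := by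
  have hρt : Integrable fun u => ρ j (t - u) := (hρ.integrable j).comp_sub_left t
  have hm : Measurable (Function.uncurry fun u ω => y u ω * ρ j (t - u)) :=
    hy.measurable.mul (((hρ.continuous j).measurable.comp
      (measurable_const.sub measurable_id)).comp measurable_fst)
  refine (integrable_prod_iff hm.aestronglyMeasurable).2
    ⟨Eventually.of_forall fun u => (hy.integrable u).mul_const (ρ j (t - u)), ?_⟩
  refine (hρt.norm.const_mul B).mono'
    hm.norm.stronglyMeasurable.integral_prod_right.aestronglyMeasurable
    (Eventually.of_forall fun u => ?_)
  rw [Real.norm_of_nonneg (integral_nonneg fun ω => norm_nonneg _)]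
  simp only [Function.uncurry_apply_pair, norm_mul]
  rw [integral_mul_const]
  exact mul_le_mul_of_nonneg_right (hy.bound u) (norm_nonneg _)

lemma IsBoundedInMean.smoothing [SFinite P] {y : ℝ → Ω → ℝ} {B : ℝ} (hy : IsBoundedInMean P y B)
    {ρ : ℕ → ℝ → ℝ} {R : ℝ} (hρ : IsTestSequence ρ R) (j : ℕ) :
    IsBoundedInMean P (fun t ω => ∫ u, y u ω * ρ j (t - u)) (B * ∫ u, |ρ j u|) where
  measurable := by
    refine (StronglyMeasurable.integral_prod_right
      (f := fun (p : ℝ × Ω) u => y u p.2 * ρ j (p.1 - u))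
      (Measurable.stronglyMeasurable (Measurable.mul ?_ ?_))).measurable
    · exact hy.measurable.comp (f := fun x : (ℝ × Ω) × ℝ => (x.2, x.1.2)) (by fun_prop)
    · exact (hρ.continuous j).measurable.comp
        (f := fun x : (ℝ × Ω) × ℝ => x.1.1 - x.2) (by fun_prop)
  integrable t := (hy.integrable_prod_smoothing hρ j t).integral_prod_right
  bound t := by
    have hi := hy.integrable_prod_smoothing hρ j t
    have hρt : Integrable fun u => ρ j (t - u) := (hρ.integrable j).comp_sub_left t
    calc ∫ ω, |∫ u, y u ω * ρ j (t - u)| ∂P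
        ≤ ∫ ω, (∫ u, ‖y u ω * ρ j (t - u)‖) ∂P :=
          integral_mono hi.integral_prod_right.abs hi.norm.integral_prod_right
            fun ω => norm_integral_le_integral_norm fun u => y u ω * ρ j (t - u)
      _ = ∫ u, (∫ ω, ‖y u ω * ρ j (t - u)‖ ∂P) := (integral_integral_swap hi.norm).symm
      _ ≤ ∫ u, B * |ρ j (t - u)| := by
          refine integral_mono hi.norm.integral_prod_left (hρt.abs.const_mul B) fun u => ?_
          simp only [norm_mul]
          rw [integral_mul_const]
          exact mul_le_mul_of_nonneg_right (hy.bound u) (norm_nonneg _)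
      _ = B * ∫ u, |ρ j u| := by
          rw [integral_const_mul, integral_sub_left_eq_self (fun u => |ρ j u|)]

lemma IsBoundedInMean.integral_smoothing [SFinite P] {y : ℝ → Ω → ℝ} {B : ℝ}
    (hy : IsBoundedInMean P y B)
    {ρ : ℕ → ℝ → ℝ} {R : ℝ} (hρ : IsTestSequence ρ R) (j : ℕ) (t : ℝ) :
    ∫ ω, (∫ u, y u ω * ρ j (t - u)) ∂P = ∫ u, (∫ ω, y u ω ∂P) * ρ j (t - u) := by
  rw [← integral_integral_swap (hy.integrable_prod_smoothing hρ j t)]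
  congr 1; ext u
  rw [integral_mul_const]

lemma measurable_setIntegral_Ioc {F : ℝ × Ω → ℝ} (hF : Measurable F) (a : ℝ) :
    Measurable fun p : ℝ × Ω => ∫ w in Set.Ioc a p.1, F (w, p.2) := by
  have h : ∀ p : ℝ × Ω, ∫ w in Set.Ioc a p.1, F (w, p.2) =
      ∫ w, {x : (ℝ × Ω) × ℝ | x.2 ∈ Set.Ioc a x.1.1}.indicator
        (fun x => F (x.2, x.1.2)) (p, w) := fun p =>
    (integral_indicator measurableSet_Ioc).symm
  simp only [h]
  refine (StronglyMeasurable.integral_prod_right (f := fun (p : ℝ × Ω) w =>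
    {x : (ℝ × Ω) × ℝ | x.2 ∈ Set.Ioc a x.1.1}.indicator (fun x => F (x.2, x.1.2)) (p, w))
    (Measurable.stronglyMeasurable (Measurable.indicator ?_ ?_))).measurable
  · exact hF.comp (f := fun x : (ℝ × Ω) × ℝ => (x.2, x.1.2)) (by fun_prop)
  · exact (measurableSet_lt measurable_const measurable_snd).inter
      (measurableSet_le measurable_snd measurable_fst.fst)

/-! ### Uniqueness of the solution -/

section
variable {m n : ℕ} {ϖ : Fin m → MatrixMeasure (Fin n)} {Z X : ℝ → Ω → Fin n → ℝ}

lemma IsSolution.hasL1Increments (hX : IsSolution P ϖ Z X) (k : Fin n) :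
    HasL1Increments P fun t ω => X t ω k :=
  (hX.stationary.hasStationaryIncrements hX.measurable).hasL1Increments hX.measurable
    hX.integrable k

lemma IsStationary.integral_abs_eq {X : ℝ → Ω → Fin n → ℝ} (hm : IsMeasurableProcess X)
    (hs : IsStationary P X) (k : Fin n) (t : ℝ) :
    ∫ ω, |X t ω k| ∂P = ∫ ω, |X 0 ω k| ∂P := by
  set T : Finset ℝ := {0}
  have hT : (0 : ℝ) ∈ T := by simp [T]
  set F : (T → Fin n → ℝ) → ℝ := fun x => |x ⟨0, hT⟩ k|
  have hF : Measurable F := by fun_prop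
  have hmeas : ∀ a : ℝ → ℝ, Measurable fun ω (u : T) => X (a u) ω := fun a =>
    measurable_pi_lambda _ fun u => hm.eval _
  have h2 : ∫ x, F x ∂P.map (fun ω (u : T) => X (u + t) ω) =
      ∫ x, F x ∂P.map (fun ω (u : T) => X u ω) := by rw [hs t T]
  rw [integral_map (hmeas fun u => u + t).aemeasurable hF.aestronglyMeasurable,
    integral_map (hmeas fun u => u).aemeasurable hF.aestronglyMeasurable] at h2
  simpa [F] using h2

lemma IsSolution.isBoundedInMean (hX : IsSolution P ϖ Z X) (k : Fin n) :
    IsBoundedInMean P (fun t ω => X t ω k) (∫ ω, |X 0 ω k| ∂P) where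
  measurable := (measurable_pi_apply k).comp hX.measurable
  integrable t := (hX.integrable t).eval k
  bound t := (hX.stationary.integral_abs_eq hX.measurable k t).le

/-- Integration by parts along the chain of derivatives. -/
lemma integral_mul_add_eq {y : ℕ → ℝ → ℝ} {ρ : ℕ → ℝ → ℝ} {R : ℝ} (hρ : IsTestSequence ρ R)
    (hR : 0 < R) (h0 : ∀ a b, IntervalIntegrable (y 0) volume a b)
    (h : ∀ j, j + 1 < m → ∀ s t, IntervalIntegrable (y (j + 1)) volume s t ∧
      y j t - y j s = ∫ u in s..t, y (j + 1) u) {j : ℕ} (hj : j < m) :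
    (∀ a b, IntervalIntegrable (y j) volume a b) ∧
      ∀ i t, ∫ u, y j u * ρ i (t - u) = ∫ u, y 0 u * ρ (i + j) (t - u) := by
  induction j with
  | zero => exact ⟨h0, fun i t => rfl⟩
  | succ j ih =>
    obtain ⟨h1, h2⟩ := ih (by omega)
    refine ⟨fun a b => (h j hj a b).1, fun i t => ?_⟩
    rw [show i + (j + 1) = i + 1 + j by omega, ← h2]
    refine (hρ.integral_mul_succ (c := y j (t - R)) hR (h j hj _ _).1.1
      (Eventually.of_forall fun u hu => ?_) i).symm
    rw [← intervalIntegral.integral_of_le hu.1.le, ← (h j hj _ _).2]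
    ring

/-- The equation tested against a test function. -/
lemma IsSolution.ae_smoothing_eq [IsProbabilityMeasure P] (hm : 0 < m)
    (hX : IsSolution P ϖ Z X) (hZm : IsMeasurableProcess Z)
    (hZ : ∀ k, HasL1Increments P fun t ω => Z t ω k)
    {ρ : ℕ → ℝ → ℝ} {R : ℝ} (hρ : IsTestSequence ρ R) (hR : 0 < R) (k : Fin n) (t : ℝ) :
    ∀ᵐ ω ∂P, ∫ u, X u ω k * ρ m (t - u) =
      (∑ j : Fin m, ∑ l, sIntegral (ϖ j k l) fun v => ∫ u, X u ω l * ρ j (t - v - u)) +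
        ∫ u, Z u ω k * ρ 1 (t - u) := by
  obtain ⟨Y, hY0, hder, heq⟩ := hX.equation
  have hYm : ∀ j, j < m → IsMeasurableProcess (Y j) := by
    rintro (_ | j) hj
    · rw [hY0]; exact hX.measurable
    · exact (hder j hj).measurable
  set S := Set.Ioc (t - R) (t + R) with hS
  have hsm : ∀ (j : Fin m) (l : Fin n), Measurable fun p : ℝ × Ω =>
      sIntegral (ϖ j k l) fun v => Y j (p.1 - v) p.2 l := by
    intro j l
    refine (stronglyMeasurable_sIntegral (ϖ j k l)
      (f := fun (p : ℝ × Ω) v => Y j (p.1 - v) p.2 l) (Measurable.stronglyMeasurable ?_)).measurable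
    exact (measurable_pi_apply l).comp ((hYm j j.2).comp
      (f := fun x : (ℝ × Ω) × ℝ => (x.1.1 - x.2, x.1.2)) (by fun_prop))
  -- For each u the equation holds almost surely. Fubini exchanges the quantifiers: almost every
  -- path satisfies it for almost every u, which is all that testing requires. Times u ≤ t - R lie
  -- outside the window where the test function may be nonzero.
  have heq' : ∀ᵐ ω ∂P, ∀ᵐ u : ℝ, u ≤ t - R ∨ Y (m - 1) u ω k - Y (m - 1) (t - R) ω k =
      (∑ j : Fin m, ∑ l : Fin n, ∫ w in Set.Ioc (t - R) u,
        sIntegral (ϖ j k l) fun v => Y j (w - v) ω l) + (Z u ω k - Z (t - R) ω k) := by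
    have hset : MeasurableSet {p : ℝ × Ω | p.1 ≤ t - R ∨
        Y (m - 1) p.1 p.2 k - Y (m - 1) (t - R) p.2 k =
        (∑ j : Fin m, ∑ l : Fin n, ∫ w in Set.Ioc (t - R) p.1,
          sIntegral (ϖ j k l) fun v => Y j (w - v) p.2 l) +
            (Z p.1 p.2 k - Z (t - R) p.2 k)} := by
      have hev : ∀ {W : ℝ → Ω → Fin n → ℝ}, IsMeasurableProcess W →
          Measurable fun p : ℝ × Ω => W p.1 p.2 k - W (t - R) p.2 k := fun hW =>
        ((measurable_pi_apply k).comp hW).sub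
          ((measurable_pi_apply k).comp ((hW.eval (t - R)).comp measurable_snd))
      refine (measurableSet_le measurable_fst measurable_const).union
        (measurableSet_eq_fun (hev (hYm (m - 1) (by omega))) (Measurable.add ?_ (hev hZm)))
      exact Finset.measurable_fun_sum _ fun j _ => Finset.measurable_fun_sum _ fun l _ =>
        measurable_setIntegral_Ioc (hsm j l) (t - R)
    refine (Measure.ae_ae_comm hset).1 (Eventually.of_forall fun u => ?_)
    rcases le_or_gt u (t - R) with hu | hu
    · exact Eventually.of_forall fun ω => Or.inl hu
    · filter_upwards [heq _ _ hu] with ω hω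
      refine Or.inr ?_
      simp only [← intervalIntegral.integral_of_le hu.le]
      exact hω.2 k
  have hderω : ∀ᵐ ω ∂P, ∀ j, j + 1 < m → ∀ (k : Fin n) (s t : ℝ),
      IntervalIntegrable (fun u => Y (j + 1) u ω k) volume s t ∧
        Y j t ω k - Y j s ω k = ∫ u in s..t, Y (j + 1) u ω k := by
    refine ae_all_iff.2 fun j => ?_
    by_cases hj : j + 1 < m
    · filter_upwards [(hder j hj).absCont] with ω hω _ using hω
    · exact Eventually.of_forall fun ω h => absurd h hj
  filter_upwards [heq', hderω, heq (t - R) (t + R) (by linarith),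
    ae_all_iff.2 fun l => (hX.hasL1Increments l).ae_intervalIntegrable,
    (hZ k).ae_intervalIntegrable] with ω h1 h2 h3 h4 h5
  have hchain : ∀ (l : Fin n) {j : ℕ}, j < m →
      (∀ a b, IntervalIntegrable (fun u => Y j u ω l) volume a b) ∧
      ∀ i t, ∫ u, Y j u ω l * ρ i (t - u) = ∫ u, X u ω l * ρ (i + j) (t - u) := by
    intro l j hj
    have := integral_mul_add_eq (m := m) (y := fun j u => Y j u ω l) hρ hR
      (by rw [hY0]; exact h4 l) (fun j hj s t => h2 j hj l s t) hj
    simpa only [hY0] using this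
  obtain ⟨hlast, hlast'⟩ := hchain k (j := m - 1) (by omega)
  have hFi : ∀ (j : Fin m) (l : Fin n), IntegrableOn
      (fun w => sIntegral (ϖ j k l) fun v => Y j (w - v) ω l) S := fun j l =>
    integrable_sIntegral (f := fun w v => Y j (w - v) ω l) (h3.1 j k l)
  have hF : IntegrableOn (fun w => ∑ j : Fin m, ∑ l : Fin n,
      sIntegral (ϖ j k l) fun v => Y j (w - v) ω l) S :=
    integrable_finsetSum _ fun j _ => integrable_finsetSum _ fun l _ => hFi j l
  -- With the noise moved to the left, Y_{m-1} - Z is almost everywhere a primitive of an integrable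
  -- function, so integration by parts costs no regularity of `Z`.
  have hparts := hρ.integral_mul_succ (y := fun u => Y (m - 1) u ω k - Z u ω k)
    (c := Y (m - 1) (t - R) ω k - Z (t - R) ω k) (t := t) hR hF (by
      filter_upwards [h1] with u hu huS
      have hu' := hu.resolve_left (not_le.2 huS.1)
      have hsub : Set.Ioc (t - R) u ⊆ S := Set.Ioc_subset_Ioc_right huS.2
      rw [integral_finsetSum _ fun j _ => integrable_finsetSum _ fun l _ =>
        (hFi j l).mono_set hsub]
      simp only [integral_finsetSum _ fun l _ => (hFi _ l).mono_set hsub]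
      linarith) 0
  have hrhs : ∀ (j : Fin m) (l : Fin n),
      ∫ u in S, (sIntegral (ϖ j k l) fun v => Y j (u - v) ω l) * ρ 0 (t - u) =
        sIntegral (ϖ j k l) fun v => ∫ u, X u ω l * ρ j (t - v - u) := by
    intro j l
    obtain ⟨C, hC⟩ := hρ.exists_bound 0
    have hint : Integrable (Function.uncurry fun u v => ρ 0 (t - u) * Y j (u - v) ω l)
        ((volume.restrict S).prod (ϖ j k l).totalVariation) :=
      (h3.1 j k l).bdd_mul (c := C) ((hρ.continuous 0).measurable.comp
        (measurable_const.sub measurable_fst)).aestronglyMeasurable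
        (Eventually.of_forall fun p => hC _)
    calc _ = ∫ u in S, sIntegral (ϖ j k l) fun v => ρ 0 (t - u) * Y j (u - v) ω l := by
          congr 1; ext u
          rw [mul_comm, ← smul_eq_mul, ← sIntegral_const_smul]
          simp only [smul_eq_mul]
      _ = sIntegral (ϖ j k l) fun v => ∫ u in S, ρ 0 (t - u) * Y j (u - v) ω l :=
          integral_sIntegral_swap hint
      _ = _ := by
          congr 1; ext v
          simp only [mul_comm (ρ 0 _)]
          rw [hρ.setIntegral_eq 0 (fun u => Y j (u - v) ω l)]
          -- The j derivatives are passed from Y_j to the test function, so that only `X` remains.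
          have h6 := (hchain l j.2).2 0 (t - v)
          rw [zero_add] at h6
          rw [← h6, ← integral_sub_right_eq_self (fun u => Y j u ω l * ρ 0 (t - v - u)) v]
          simp only [sub_sub_sub_cancel_right]
  have hmi : ∀ (j : Fin m) (l : Fin n), IntegrableOn
      (fun u => (sIntegral (ϖ j k l) fun v => Y j (u - v) ω l) * ρ 0 (t - u)) S := by
    intro j l
    obtain ⟨C, hC⟩ := hρ.exists_bound 0
    exact (hFi j l).mul_bdd (c := C) ((hρ.continuous 0).comp
      (continuous_const.sub continuous_id)).aestronglyMeasurable
      (Eventually.of_forall fun p => hC _)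
  rw [← hρ.setIntegral_eq 0] at hparts
  simp only [Finset.sum_mul, sub_mul] at hparts
  rw [integral_finsetSum _ fun j _ => integrable_finsetSum _ fun l _ => hmi j l,
    integral_sub (hρ.integrable_mul hlast _ _) (hρ.integrable_mul h5 _ _), hlast',
    show 0 + 1 + (m - 1) = m by omega] at hparts
  simp only [integral_finsetSum _ fun l _ => hmi _ l, hrhs] at hparts
  linarith

lemma IsSolution.integrable_smoothing [IsProbabilityMeasure P] (hX : IsSolution P ϖ Z X)
    {ρ : ℕ → ℝ → ℝ} {R : ℝ} (hρ : IsTestSequence ρ R) (μ : SignedMeasure ℝ) (A : Set Ω)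
    (l : Fin n) (j : ℕ) (t : ℝ) :
    Integrable (fun v => ∫ u, (∫ ω in A, X u ω l ∂P) * ρ j (t - v - u)) μ.totalVariation := by
  have h := ((((hX.isBoundedInMean l).restrict A).smoothing hρ j).integrable_prod
    μ.totalVariation (τ := fun v => t - v) (measurable_const.sub measurable_id)).integral_prod_right
  simpa only [((hX.isBoundedInMean l).restrict A).integral_smoothing hρ j] using h

/-- Fubini for the tested equation. The constant bound on E|X_t| suffices, as no derivative of `X`
occurs any more. -/
lemma IsSolution.setIntegral_smoothing [IsProbabilityMeasure P] (hX : IsSolution P ϖ Z X)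
    {ρ : ℕ → ℝ → ℝ} {R : ℝ} (hρ : IsTestSequence ρ R) (A : Set Ω) (k : Fin n) (t : ℝ) :
    ∫ ω in A, ((∫ u, X u ω k * ρ m (t - u)) -
      ∑ j : Fin m, ∑ l, sIntegral (ϖ j k l) fun v => ∫ u, X u ω l * ρ j (t - v - u)) ∂P =
    (∫ u, (∫ ω in A, X u ω k ∂P) * ρ m (t - u)) - ∑ j : Fin m, ∑ l,
      sIntegral (ϖ j k l) fun v => ∫ u, (∫ ω in A, X u ω l ∂P) * ρ j (t - v - u) := by
  have hB := fun l => (hX.isBoundedInMean l).restrict A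
  have hp : ∀ (j : Fin m) (l : Fin n), Integrable (Function.uncurry fun ω v =>
      ∫ u, X u ω l * ρ j (t - v - u)) ((P.restrict A).prod (ϖ j k l).totalVariation) :=
    fun j l => ((hB l).smoothing hρ j).integrable_prod (ϖ j k l).totalVariation
      (τ := fun v => t - v) (measurable_const.sub measurable_id)
  have hi := fun j l => integrable_sIntegral (hp j l)
  rw [integral_sub (((hB k).smoothing hρ m).integrable t)
    (integrable_finsetSum _ fun j _ => integrable_finsetSum _ fun l _ => hi j l),
    (hB k).integral_smoothing hρ,
    integral_finsetSum _ fun j _ => integrable_finsetSum _ fun l _ => hi j l]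
  congr 1
  refine Finset.sum_congr rfl fun j _ => ?_
  rw [integral_finsetSum _ fun l _ => hi j l]
  refine Finset.sum_congr rfl fun l _ => ?_
  rw [integral_sIntegral_swap (hp j l)]
  congr 1; ext v
  exact (hB l).integral_smoothing hρ j (t - v)

lemma IsTestSequence.hasDerivAt_smoothing {ρ : ℕ → ℝ → ℝ} {R : ℝ} (hρ : IsTestSequence ρ R)
    {f : ℝ → ℝ} (hf : Continuous f) (j : ℕ) (t : ℝ) :
    HasDerivAt (fun t => ∫ u, f u * ρ j (t - u)) (∫ u, f u * ρ (j + 1) (t - u)) t := by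
  have hd : deriv (ρ j) = ρ (j + 1) := funext fun x => (hρ.hasDerivAt j x).deriv
  have h := (hρ.hasCompactSupport j).hasDerivAt_convolution_right (ContinuousLinearMap.mul ℝ ℝ)
    (hf.locallyIntegrable (μ := volume)) (contDiff_one_iff_deriv.2
      ⟨fun x => (hρ.hasDerivAt j x).differentiableAt, hd ▸ hρ.continuous (j + 1)⟩) t
  rw [hd] at h
  exact h

/-- Two solutions have the same means on every event. -/
lemma IsSolution.setIntegral_eq [IsProbabilityMeasure P] (hm : 0 < m)
    (hZm : IsMeasurableProcess Z) (hZ : ∀ k, HasL1Increments P fun t ω => Z t ω k)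
    {g : ℝ → Matrix (Fin m × Fin n) (Fin m × Fin n) ℝ} (hg : IsKernel (companionMeasure ϖ) g)
    {X X' : ℝ → Ω → Fin n → ℝ} (hX : IsSolution P ϖ Z X) (hX' : IsSolution P ϖ Z X')
    (A : Set Ω) (k : Fin n) (t : ℝ) :
    ∫ ω in A, X t ω k ∂P = ∫ ω in A, X' t ω k ∂P := by
  set d : Fin n → ℝ → ℝ := fun l u => ∫ ω in A, X u ω l ∂P with hd
  set d' : Fin n → ℝ → ℝ := fun l u => ∫ ω in A, X' u ω l ∂P with hd'
  have hdc : ∀ l, Continuous (d l) := fun l => (hX.hasL1Increments l).continuous_setIntegral A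
  have hdc' : ∀ l, Continuous (d' l) := fun l => (hX'.hasL1Increments l).continuous_setIntegral A
  set e : Fin n → ℝ → ℝ := fun l u => d l u - d' l u with he
  have hec : ∀ l, Continuous (e l) := fun l => (hdc l).sub (hdc' l)
  obtain ⟨B, hB⟩ : ∃ B, ∀ l u, |e l u| ≤ B := by
    refine ⟨∑ l, ((∫ ω, |X 0 ω l| ∂P) + ∫ ω, |X' 0 ω l| ∂P), fun l u => ?_⟩
    refine le_trans ?_ (Finset.single_le_sum (f := fun l => (∫ ω, |X 0 ω l| ∂P) +
      ∫ ω, |X' 0 ω l| ∂P) (fun l _ => add_nonneg (integral_nonneg fun ω => abs_nonneg _)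
        (integral_nonneg fun ω => abs_nonneg _)) (Finset.mem_univ l))
    exact (abs_sub _ _).trans (add_le_add ((hX.isBoundedInMean l).abs_setIntegral_le A u)
      ((hX'.isBoundedInMean l).abs_setIntegral_le A u))
  have hzero : ∀ {ρ : ℕ → ℝ → ℝ} {R : ℝ}, IsTestSequence ρ R → 0 < R → ∀ t,
      ∫ u, e k u * ρ 0 (t - u) = 0 := by
    intro ρ R hρ hR t
    -- Smoothing with the successive derivatives of the test function produces a bounded
    -- differentiable state vector for the first-order system.
    set V : Fin m × Fin n → ℝ → ℝ := fun q t => ∫ u, e q.2 u * ρ q.1 (t - u) with hV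
    have hVB : ∀ q t, |V q t| ≤ ∑ q : Fin m × Fin n, B * ∫ u, |ρ q.1 u| := by
      intro q t
      have hB0 : 0 ≤ B := (abs_nonneg _).trans (hB k 0)
      refine le_trans ?_ (Finset.single_le_sum (f := fun q : Fin m × Fin n => B * ∫ u, |ρ q.1 u|)
        (fun q _ => mul_nonneg hB0 (integral_nonneg fun u => abs_nonneg _)) (Finset.mem_univ q))
      rw [← integral_sub_left_eq_self (fun u => |ρ q.1 u|) volume t, ← integral_const_mul]
      refine norm_integral_le_of_norm_le (G := ℝ) (((hρ.integrable q.1).comp_sub_left t).abs.const_mul B)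
        (Eventually.of_forall fun u => ?_)
      rw [Real.norm_eq_abs, abs_mul]
      exact mul_le_mul_of_nonneg_right (hB _ _) (abs_nonneg _)
    have hsub : ∀ l j t, ∫ u, e l u * ρ j (t - u) =
        (∫ u, d l u * ρ j (t - u)) - ∫ u, d' l u * ρ j (t - u) := by
      intro l j t
      rw [← integral_sub
        (hρ.integrable_mul (fun a b => (hdc l).intervalIntegrable a b) j t)
        (hρ.integrable_mul (fun a b => (hdc' l).intervalIntegrable a b) j t)]
      simp only [he, sub_mul]
    -- Both solutions satisfy the tested equation with the same noise term, which cancels in the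
    -- difference.
    have hlast : ∀ k t, ∫ u, e k u * ρ m (t - u) =
        ∑ j : Fin m, ∑ l, sIntegral (ϖ j k l) fun v => V (j, l) (t - v) := by
      intro k t
      have h1 : ∫ ω in A, ((∫ u, X u ω k * ρ m (t - u)) -
          ∑ j : Fin m, ∑ l, sIntegral (ϖ j k l) fun v => ∫ u, X u ω l * ρ j (t - v - u)) ∂P =
          ∫ ω in A, ((∫ u, X' u ω k * ρ m (t - u)) -
          ∑ j : Fin m, ∑ l, sIntegral (ϖ j k l) fun v => ∫ u, X' u ω l * ρ j (t - v - u)) ∂P := by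
        refine integral_congr_ae (ae_restrict_of_ae ?_)
        filter_upwards [hX.ae_smoothing_eq hm hZm hZ hρ hR k t,
          hX'.ae_smoothing_eq hm hZm hZ hρ hR k t] with ω h1 h2
        rw [h1, h2]; ring
      rw [hX.setIntegral_smoothing hρ, hX'.setIntegral_smoothing hρ] at h1
      have h2 : ∀ (j : Fin m) (l : Fin n), (sIntegral (ϖ j k l) fun v => V (j, l) (t - v)) =
          (sIntegral (ϖ j k l) fun v => ∫ u, d l u * ρ j (t - v - u)) -
            sIntegral (ϖ j k l) fun v => ∫ u, d' l u * ρ j (t - v - u) := by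
        intro j l
        rw [← sIntegral_sub (hX.integrable_smoothing hρ _ A l j t)
          (hX'.integrable_smoothing hρ _ A l j t)]
        simp only [hV, hsub, hd, hd']
      simp only [hsub, h2, Finset.sum_sub_distrib]
      linarith
    refine hg.eq_zero_of_bounded_solution (V := V) hVB (fun p t => ?_) (⟨0, hm⟩, k) t
    obtain ⟨i, l⟩ := p
    by_cases hi : (i : ℕ) + 1 < m
    · rw [sum_sIntegral_companionMeasure_of_lt hi]
      exact hρ.hasDerivAt_smoothing (hec l) i t
    · have h1 := hρ.hasDerivAt_smoothing (hec l) i t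
      have him : (i : ℕ) + 1 = m := by omega
      rw [him, hlast, ← Fintype.sum_prod_type'
        (f := fun j l' => sIntegral (ϖ j l l') fun v => V (j, l') (t - v))] at h1
      simp only [companionMeasure_last hi]
      exact h1
  have hae : ∀ᵐ u, e k u = 0 := by
    refine ae_eq_zero_of_integral_contDiff_smul_eq_zero (hec k).locallyIntegrable
      fun ψ hψ hψc => ?_
    -- Smoothing at time 0 pairs `e k` with the reflected test function, hence the reflection
    -- beforehand.
    have hc : HasCompactSupport fun x => ψ (-x) := hψc.comp_homeomorph (Homeomorph.neg ℝ)
    obtain ⟨R, hR, hρ⟩ := exists_isTestSequence (ρ := fun x => ψ (-x)) (hψ.comp contDiff_neg) hc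
    have := hzero hρ hR 0
    simpa [mul_comm] using this
  have := (Continuous.ae_eq_iff_eq volume (hec k) continuous_const).1 hae
  exact sub_eq_zero.1 (congrFun this t)

end
end

/-- The derivative of a causal kernel vanishes on the negative half-line. -/
lemma kernelDeriv_eq_zero {ι : Type*} [Fintype ι] [DecidableEq ι] {η : MatrixMeasure ι}
    {g : ℝ → Matrix ι ι ℝ} (hη : ConcentratedOnNonneg η) (h0 : ∀ u < 0, ∀ a b, g u a b = 0)
    (p q : ι) {r : ℝ} (hr : r < 0) : kernelDeriv η g p q r = 0 := by
  refine Finset.sum_eq_zero fun k _ => ?_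
  have h : (fun v => g (r - v) k q) =ᵐ[(η p k).totalVariation] fun _ => 0 := by
    filter_upwards [ae_nonneg hη p k] with v hv
    exact h0 _ (by linarith) _ _
  rw [sConv, sIntegral_congr_ae h]
  simp [sIntegral]

end
end MSDDE

/-! ### The main theorem -/

open MSDDE in
theorem mainTheorem5 {Ω : Type*} [MeasurableSpace Ω] (P : MeasureTheory.Measure Ω)
    [MeasureTheory.IsProbabilityMeasure P] (m n : ℕ) (hm : 0 < m)
    (ϖ : Fin m → MSDDE.MatrixMeasure (Fin n))
    (hϖ_conc : ∀ j, MSDDE.ConcentratedOnNonneg (ϖ j))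
    (hϖ_mom : ∀ j, MSDDE.HasMoment (ϖ j) 2)
    (Z : ℝ → Ω → Fin n → ℝ)
    (hZ_meas : MSDDE.IsMeasurableProcess Z)
    (hZ_int : MSDDE.IsIntegrableProcess P Z)
    (hZ_incr : MSDDE.HasStationaryIncrements P Z)
    (I : Fin n → MSDDE.L1L2 →ₗ[ℝ] MeasureTheory.Lp ℝ 1 P)
    (hI : ∀ k, MSDDE.IsRegularIntegral P (fun t ω => Z t ω k) (I k)) :
    (∀ z ∈ MSDDE.laplaceDomain (MSDDE.companionMeasure ϖ),
      (MSDDE.charMatrix (MSDDE.companionMeasure ϖ) z).det =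
        ((-z) ^ m • (1 : Matrix (Fin n) (Fin n) ℂ)
          - ∑ j : Fin m, (-z) ^ (j : ℕ) • MSDDE.laplace (ϖ j) z).det) ∧
    ((∀ y : ℝ, (MSDDE.charMatrix (MSDDE.companionMeasure ϖ) (Complex.I * y)).det ≠ 0) →
      ∃ g : ℝ → Matrix (Fin m × Fin n) (Fin m × Fin n) ℝ,
        MSDDE.EntriesMemLp g 1 ∧ MSDDE.EntriesMemLp g 2 ∧
        (∀ y : ℝ, MSDDE.fourierFun g y =
          (MSDDE.charMatrix (MSDDE.companionMeasure ϖ) (Complex.I * y))⁻¹) ∧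
        (∀ y : ℝ, MSDDE.fourierFun (fun u => MSDDE.topRightBlock hm (g u)) y =
          ((-(Complex.I * y)) ^ m • (1 : Matrix (Fin n) (Fin n) ℂ)
            - ∑ j : Fin m, (-(Complex.I * y)) ^ (j : ℕ) • MSDDE.fourier (ϖ j) y)⁻¹) ∧
        (∀ g' : ℝ → Matrix (Fin n) (Fin n) ℝ, MSDDE.EntriesMemLp g' 1 →
          (∀ y : ℝ, MSDDE.fourierFun g' y =
            ((-(Complex.I * y)) ^ m • (1 : Matrix (Fin n) (Fin n) ℂ)
              - ∑ j : Fin m, (-(Complex.I * y)) ^ (j : ℕ) • MSDDE.fourier (ϖ j) y)⁻¹) →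
          ∀ᵐ u : ℝ, g' u = MSDDE.topRightBlock hm (g u)) ∧
        ∃ X : ℝ → Ω → Fin n → ℝ,
          MSDDE.IsSolution P ϖ Z X ∧
          (∀ X' : ℝ → Ω → Fin n → ℝ, MSDDE.IsSolution P ϖ Z X' → ∀ t, X' t =ᵐ[P] X t) ∧
          (∀ (t : ℝ) (a : Fin n), (fun ω => X t ω a) =ᵐ[P] fun ω =>
            ∑ b : Fin n,
              MSDDE.integ (I b) (fun u => MSDDE.topRightBlock hm (g (t - u)) a b) ω) ∧
          ((∀ z : ℂ, z.re ≤ 0 →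
              (MSDDE.charMatrix (MSDDE.companionMeasure ϖ) z).det ≠ 0) →
            MSDDE.IsCausal P Z X)) := by
  refine ⟨fun z _ => ?_, fun hdet => ?_⟩
  · rw [charMatrix_companionMeasure, det_blockCompanion hm]
    rfl
  have hηc := concentratedOnNonneg_companionMeasure hϖ_conc
  have hη2 := hasMoment_companionMeasure hϖ_mom
  obtain ⟨g, hgm, hg1, hg2, hga, hgF, hgc⟩ := exists_kernel hηc hη2 hdet
  have hker : IsKernel (companionMeasure ϖ) g :=
    ⟨hdet, hη2.mono (by norm_num), hgm, fun a b => memLp_one_iff_integrable.1 (hg1 a b), hga, hgF⟩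
  have hblock : ∀ y : ℝ, fourierFun (fun u => topRightBlock hm (g u)) y =
      ((-(Complex.I * y)) ^ m • (1 : Matrix (Fin n) (Fin n) ℂ)
        - ∑ j : Fin m, (-(Complex.I * y)) ^ (j : ℕ) • fourier (ϖ j) y)⁻¹ := by
    intro y
    have h1 : fourierFun (fun u => topRightBlock hm (g u)) y =
        topRightBlock hm (fourierFun g y) := rfl
    have h2 := isUnit_iff_ne_zero.2 (hdet y)
    rw [charMatrix_companionMeasure] at h2
    rw [h1, hgF, charMatrix_companionMeasure, topRightBlock_inv_blockCompanion hm _ _ h2]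
    rfl
  have hZ := fun b => hZ_incr.hasL1Increments hZ_meas hZ_int b
  have hsol := isSolution_smoothSolution hm hker hZ_meas hZ_int hZ_incr
  have hXeq := fun a t => smoothSolution_ae_eq_sum hm hker hZ_meas hZ_int hZ_incr ⟨0, hm⟩ a t
  refine ⟨g, hg1, hg2, hgF, hblock, fun g' hg' hF => ?_, smoothSolution hm ϖ g Z 0, hsol,
    fun X' hX' t => ?_, fun t a => ?_, fun hre t => ?_⟩
  · have h : ∀ a b, (fun u => g' u a b) =ᵐ[volume] fun u => topRightBlock hm (g u) a b :=
      fun a b => ae_eq_of_fourier_eq (memLp_one_iff_integrable.1 (hg' a b))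
        (hker.integrable _ _) fun y _ =>
        congrFun (congrFun ((hF y).trans (hblock y).symm) a) b
    filter_upwards [ae_all_iff.2 fun a => ae_all_iff.2 fun b => h a b] with u hu
    ext a b
    exact hu a b
  · have h : ∀ k, (fun ω => X' t ω k) =ᵐ[P] fun ω => smoothSolution hm ϖ g Z 0 t ω k := fun k =>
      Integrable.ae_eq_of_forall_setIntegral_eq _ _ ((hX'.integrable t).eval k)
        ((hsol.integrable t).eval k) fun A _ _ =>
          hX'.setIntegral_eq hm hZ_meas hZ hker hsol A k t
    filter_upwards [ae_all_iff.2 h] with ω hω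
    exact funext hω
  -- Both sides equal the same pathwise moving average of the increments of `Z`; for the integral
  -- this is the primitive representation of the last block column of g.
  · filter_upwards [hXeq a t, ae_all_iff.2 fun b => (hI b).integ_eq_incrConv (hZ b)
      (hker.hasFirstMoment (⟨0, hm⟩, a) (lastBlock hm b)) (hker.ae_eq_stepPrimitive _ _) t]
      with ω h1 h2
    exact h1.trans (Finset.sum_congr rfl fun b _ => (h2 b).symm)
  · have h0 := hgc hre
    choose ξ hξm hξ using fun a b => hZ_incr.exists_measurable_pastIncrements hZ_meas hZ_int
      (hker.hasFirstMoment (⟨0, hm⟩, a) (lastBlock hm b))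
      (fun r hr => kernelDeriv_eq_zero hηc h0 _ _ hr) b t
    refine ⟨fun ω a => ∑ b, ξ a b ω, ?_, ?_⟩
    · refine @measurable_pi_lambda _ _ _ (pastIncrements Z t) _ _ fun a => ?_
      exact Finset.measurable_fun_sum _ fun b _ => hξm a b
    filter_upwards [ae_all_iff.2 fun a => hXeq a t,
      ae_all_iff.2 fun a => ae_all_iff.2 fun b => hξ a b] with ω h1 h2
    ext a
    exact (h1 a).trans (Finset.sum_congr rfl fun b _ => h2 a b)
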